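/- **Setting.** Let $a<b$, $\Omega=(a,b)^2$, $1<\alpha\le 2$, $T>0$, and put $\mu_j=\frac{2\pi j}{b-a}$, $\delta_{kl}=\sqrt{1+(\mu_k^2+\mu_l^2)^{\alpha/2}}$. For $w\in L^2(\Omega)$ with Fourier coefficients $\widehat w_{kl}=\frac1{(b-a)^2}\int_\Omega w\,e^{-i\mu_k(x-a)-i\mu_l(y-a)}\,dx\,dy$, let $\|w\|_s^2=\sum_{k,l\in\mathbb Z}(1+\mu_k^2+\mu_l^2)^s|\widehat w_{kl}|^2$, let $H^s$ be the space where this is finite, and let $\|\cdot\|=\|\cdot\|_0$. The operators $(-\Delta)^{\alpha/2}$ and $\langle\nabla\rangle_\alpha$ have Fourier symbols $(\mu_k^2+\mu_l^2)^{\alpha/2}$ and $\delta_{kl}$. For $0<\varepsilon\le1$ let $u$ be a complex-valued solution on $[0,T_\varepsilon]$, $T_\varepsilon=T/\varepsilon^2$, of $$\partial_{tt}u+(-\Delta)^{\alpha/2}u+\tfrac1\varepsilon\sin(\varepsilon u)=0\ \text{ in }\Omega,\qquad u(\cdot,0)=u_0,\quad \partial_tu(\cdot,0)=u_1,$$ with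 periodic boundary conditions and continuous periodic data (the equation being understood for every Fourier coefficient). With $f(w)=\frac1\varepsilon\sin(\varepsilon w)-w$ and $\varphi_\pm=u\mp i\langle\nabla\rangle_\alpha^{-1}\partial_tu$ it becomes the coupled relativistic fractional Schrödinger system $$i\partial_t\varphi_\pm\pm\langle\nabla\rangle_\alpha\varphi_\pm\pm\langle\nabla\rangle_\alpha^{-1}f\big(\tfrac{\varphi_++\varphi_-}2\big)=0 .$$ **Scheme.** Let $N\ge2$ be even, $h=(b-a)/N$, $(x_p,y_q)=(a+ph,a+qh)$ for $0\le p,q<N$, and $T_N=\{-\frac N2,\dots,\frac N2-1\}$. For a grid function $g$ let $\widetilde g_{kl}=\frac1{N^2}\sum_{p,q=0}^{N-1}g_{pq}e^{-i\mu_k(x_p-a)-i\mu_l(y_q-a)}$ and let $I_Ng=\sum_{k,l\in T_N}\widetilde g_{kl}e^{i\mu_k(x-a)+i\mu_l(y-a)}$ be its trigonometric interpolant; a discrete Fourier multiplier $\sigma$ maps $g$ to the grid values of $\sum_{k,l\in T_N}\sigma_{kl}\widetilde g_{kl}e^{i\mu_k(x-a)+i\mu_l(y-a)}$, and functions of $\langle\nabla\rangle_\alpha$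 act on grid functions in this way. The time-splitting Fourier pseudo-spectral (TSFP) scheme with step $\tau>0$ starts from $\varphi_\pm^0=u_0\mp i\langle\nabla\rangle_\alpha^{-1}u_1$ on the grid and iterates $$\varphi_\pm^{(1)}=e^{\pm i\frac\tau2\langle\nabla\rangle_\alpha}\varphi_\pm^n,\qquad \varphi_\pm^{(2)}=\varphi_\pm^{(1)}\pm i\tau\langle\nabla\rangle_\alpha^{-1}f\Big(\tfrac{\varphi_+^{(1)}+\varphi_-^{(1)}}2\Big),\qquad \varphi_\pm^{n+1}=e^{\pm i\frac\tau2\langle\nabla\rangle_\alpha}\varphi_\pm^{(2)};$$ the approximations at $t_n=n\tau$ are $u^n=\frac12(\varphi_+^n+\varphi_-^n)$ and $v^n=\frac i2\langle\nabla\rangle_\alpha(\varphi_+^n-\varphi_-^n)$. **Assumption (A)** with exponent $m$ and bound $M$: $u\in L^\infty([0,T_\varepsilon];H^{m+\alpha/2})$ and $\partial_tu\in L^\infty([0,T_\varepsilon];H^m)$, both with norm at most $M$. **Theorem.** Fix $\gamma>0$. (i) Let $m>1$ and $M$ be given. There are $C>0$, $h_0>0$ and $\tau^*\in(0,1)$,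 depending only on $a,b,\alpha,T,\gamma,m,M$, such that for all $0<\tau_0\le\tau^*$, all $0<\varepsilon\le1$, every solution $u$ satisfying (A), all $0<h\le h_0$ and all $0<\tau<\gamma\tau_0$, $$\|u(\cdot,t_n)-I_Nu^n\|_{\alpha/2}+\|\partial_tu(\cdot,t_n)-I_Nv^n\|\le C\big(h^m+\varepsilon^2\tau^2+\tau_0^{m+\alpha/2}\big),\qquad 0\le n\le T_\varepsilon/\tau .$$ (ii) Suppose the solution is smooth, in the sense that (A) holds for every exponent $s\ge0$ with a bound $M_s$. Let $m\ge0$ and let $\kappa>0$ be arbitrary. There are $C,h_0,c>0$, depending only on $a,b,\alpha,T,m,\kappa$ and $(M_s)_{s\ge0}$, such that for all $0<\varepsilon\le1$, every such solution, all $0<h\le h_0$ and all sufficiently small $\tau$, namely $0<\tau\le c\,\varepsilon^\kappa$, $$\|u(\cdot,t_n)-I_Nu^n\|_{\alpha/2}+\|\partial_tu(\cdot,t_n)-I_Nv^n\|\le C\big(h^m+\varepsilon^2\tau^2\big),\qquad 0\le n\le T_\varepsilon/\tau .$$ -/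

import Mathlib

open MeasureTheory

noncomputable section

namespace NSFSGE

/-! ### Fourier analysis on the square `Ω = (a, b)²` -/

/-- The square `Ω = (a, b) × (a, b)`. -/
def square (a b : ℝ) : Set (ℝ × ℝ) := Set.Ioo a b ×ˢ Set.Ioo a b

/-- The frequency `μ_j = 2πj / (b - a)`. -/
def freq (a b : ℝ) (j : ℤ) : ℝ := 2 * Real.pi * j / (b - a)

/-- `|μ_k|² + |μ_l|²` for the pair `(k, l)`. -/
def freqSq (a b : ℝ) (k : ℤ × ℤ) : ℝ := freq a b k.1 ^ 2 + freq a b k.2 ^ 2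

/-- The Fourier mode `exp (i μ_k (x - a) + i μ_l (y - a))`. -/
def mode (a b : ℝ) (k : ℤ × ℤ) (z : ℝ × ℝ) : ℂ :=
  Complex.exp (Complex.I * ((freq a b k.1 * (z.1 - a) + freq a b k.2 * (z.2 - a) : ℝ) : ℂ))

/-- The Fourier coefficient
`(b - a)⁻² ∫_Ω w(x, y) exp (-i μ_k (x - a) - i μ_l (y - a)) dx dy`. -/
def coeff (a b : ℝ) (w : ℝ × ℝ → ℂ) (k : ℤ × ℤ) : ℂ :=
  (1 / ((b - a) ^ 2 : ℝ) : ℂ) * ∫ z in square a b, w z * mode a b (-k) z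

/-- The summand `(1 + |μ_k|² + |μ_l|²)^s |ŵ_{kl}|²` of the squared `H^s`-norm. -/
def sobolevTerm (a b s : ℝ) (w : ℝ × ℝ → ℂ) (k : ℤ × ℤ) : ℝ :=
  (1 + freqSq a b k) ^ s * ‖coeff a b w k‖ ^ 2

/-- Membership in the periodic Sobolev space `H^s(Ω)`. -/
def MemH (a b s : ℝ) (w : ℝ × ℝ → ℂ) : Prop :=
  MemLp w 2 (volume.restrict (square a b)) ∧ Summable (sobolevTerm a b s w)

/-- The norm of `H^s(Ω)`; `s = 0` is the `L²`-norm. -/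
def normH (a b s : ℝ) (w : ℝ × ℝ → ℂ) : ℝ := Real.sqrt (∑' k, sobolevTerm a b s w k)

/-- Continuous functions on the plane with period `b - a` in each variable. -/
def ContPer (a b : ℝ) (w : ℝ × ℝ → ℂ) : Prop :=
  Continuous w ∧ ∀ x y, w (x + (b - a), y) = w (x, y) ∧ w (x, y + (b - a)) = w (x, y)

/-- The Fourier symbol `(|μ_k|² + |μ_l|²)^{α/2}` of the fractional Laplacian `(-Δ)^{α/2}`. -/
def fracSymbol (a b α : ℝ) (k : ℤ × ℤ) : ℝ := freqSq a b k ^ (α / 2)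

/-- The Fourier symbol `δ_{kl} = √(1 + (|μ_k|² + |μ_l|²)^{α/2})` of `⟨∇⟩_α`. -/
def delta (a b α : ℝ) (k : ℤ × ℤ) : ℝ := Real.sqrt (1 + fracSymbol a b α k)

/-! ### The complex equation -/

/-- `u`, with time derivative `v = ∂ₜu`, solves on `[0, S]` the complex equation
`∂ₜₜu + (-Δ)^{α/2} u + ε⁻¹ sin (ε u) = 0` on `Ω` with periodic boundary conditions and data
`u(0) = u₀`, `∂ₜu(0) = u₁`. The equation is imposed on every Fourier coefficient, that is,
in the weak sense against every Fourier mode. -/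
structure IsSolution (a b α ε S : ℝ) (u₀ u₁ : ℝ × ℝ → ℂ) (u v : ℝ → ℝ × ℝ → ℂ) : Prop where
  contPer_u₀ : ContPer a b u₀
  contPer_u₁ : ContPer a b u₁
  init_u : ∀ z ∈ Set.Icc a b ×ˢ Set.Icc a b, u 0 z = u₀ z
  init_v : ∀ z ∈ Set.Icc a b ×ˢ Set.Icc a b, v 0 z = u₁ z
  memLp_u : ∀ t ∈ Set.Icc 0 S, MemLp (u t) 2 (volume.restrict (square a b))
  memLp_v : ∀ t ∈ Set.Icc 0 S, MemLp (v t) 2 (volume.restrict (square a b))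
  integrable_sin : ∀ t ∈ Set.Icc 0 S,
    IntegrableOn (fun z => Complex.sin ((ε : ℂ) * u t z)) (square a b)
  cont_u : ∀ k, ContinuousOn (fun t => coeff a b (u t) k) (Set.Icc 0 S)
  cont_v : ∀ k, ContinuousOn (fun t => coeff a b (v t) k) (Set.Icc 0 S)
  deriv_u : ∀ k, ∀ t ∈ Set.Ioo 0 S,
    HasDerivAt (fun r => coeff a b (u r) k) (coeff a b (v t) k) t
  deriv_v : ∀ k, ∀ t ∈ Set.Ioo 0 S,
    HasDerivAt (fun r => coeff a b (v r) k)
      (-((fracSymbol a b α k : ℂ) * coeff a b (u t) k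
        + coeff a b (fun z => (1 / (ε : ℂ)) * Complex.sin ((ε : ℂ) * u t z)) k)) t

/-- `u` belongs to `L^∞([0, S]; H^{m+α/2})` and `v = ∂ₜu` to `L^∞([0, S]; H^m)`, with norms
at most `M`. -/
structure AssumptionA (a b α m S M : ℝ) (u v : ℝ → ℝ × ℝ → ℂ) : Prop where
  memH_u : ∀ t ∈ Set.Icc 0 S, MemH a b (m + α / 2) (u t)
  memH_v : ∀ t ∈ Set.Icc 0 S, MemH a b m (v t)
  bound_u : ∀ᵐ t ∂(volume.restrict (Set.Icc 0 S)), normH a b (m + α / 2) (u t) ≤ M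
  bound_v : ∀ᵐ t ∂(volume.restrict (Set.Icc 0 S)), normH a b m (v t) ≤ M

/-! ### The time-splitting Fourier pseudo-spectral scheme -/

/-- Grid functions; the values at the indices `N` are those at `0` by periodicity. -/
abbrev Grid (N : ℕ) : Type := Fin N × Fin N → ℂ

/-- The space step `h = (b - a) / N`. -/
def meshSize (a b : ℝ) (N : ℕ) : ℝ := (b - a) / N

/-- The grid point `(x_p, y_q) = (a + p h, a + q h)`. -/
def gridPoint (a b : ℝ) (N : ℕ) (p : Fin N × Fin N) : ℝ × ℝ :=
  (a + (p.1 : ℕ) * meshSize a b N, a + (p.2 : ℕ) * meshSize a b N)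

/-- Index pairs from `T_N = {-N/2, …, N/2 - 1}`, for even `N`. -/
def indexSet (N : ℕ) : Finset (ℤ × ℤ) :=
  Finset.Ico (-((N : ℤ) / 2)) ((N : ℤ) / 2) ×ˢ Finset.Ico (-((N : ℤ) / 2)) ((N : ℤ) / 2)

/-- The discrete Fourier coefficient
`N⁻² ∑_{p,q} g_{pq} exp (-i μ_k (x_p - a) - i μ_l (y_q - a))`. -/
def discreteCoeff (a b : ℝ) {N : ℕ} (g : Grid N) (k : ℤ × ℤ) : ℂ :=
  (1 / (N : ℂ) ^ 2) * ∑ p, g p * mode a b (-k) (gridPoint a b N p)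

/-- Trigonometric interpolation `I_N`. -/
def interp (a b : ℝ) {N : ℕ} (g : Grid N) (z : ℝ × ℝ) : ℂ :=
  ∑ k ∈ indexSet N, discreteCoeff a b g k * mode a b k z

/-- The discrete Fourier multiplier with symbol `s`, acting on grid functions. -/
def multiplier (a b : ℝ) {N : ℕ} (s : ℤ × ℤ → ℂ) (g : Grid N) : Grid N := fun p =>
  ∑ k ∈ indexSet N, s k * discreteCoeff a b g k * mode a b k (gridPoint a b N p)

/-- The nonlinearity `f(w) = ε⁻¹ sin (ε w) - w`. -/
def nonlin (ε : ℝ) (w : ℂ) : ℂ := (1 / (ε : ℂ)) * Complex.sin ((ε : ℂ) * w) - w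

/-- The half step `exp (± i (τ/2) ⟨∇⟩_α)` of the linear flow; `σ = ± 1` is the sign. -/
def linearHalfStep (a b α τ : ℝ) {N : ℕ} (σ : ℤ) (g : Grid N) : Grid N :=
  multiplier a b (fun k => Complex.exp (Complex.I * ((σ * (τ / 2) * delta a b α k : ℝ) : ℂ))) g

/-- One Strang step for the coupled system
`i ∂ₜφ_± ± ⟨∇⟩_α φ_± ± ⟨∇⟩_α⁻¹ f((φ₊ + φ₋)/2) = 0`: half a linear step, a full nonlinear step
(which leaves `φ₊ + φ₋` unchanged and so is solved exactly), half a linear step. -/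
def strangStep (a b α ε τ : ℝ) {N : ℕ} (φ : Grid N × Grid N) : Grid N × Grid N :=
  let gp : Grid N := linearHalfStep a b α τ 1 φ.1
  let gm : Grid N := linearHalfStep a b α τ (-1) φ.2
  let G : Grid N := multiplier a b (fun k => Complex.I / (delta a b α k : ℂ))
    (fun p => nonlin ε ((gp p + gm p) / 2))
  (linearHalfStep a b α τ 1 (fun p => gp p + (τ : ℂ) * G p),
    linearHalfStep a b α τ (-1) (fun p => gm p - (τ : ℂ) * G p))

/-- The initial grid functions `φ_±⁰ = u₀ ∓ i ⟨∇⟩_α⁻¹ u₁`. -/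
def initialState (a b α : ℝ) (N : ℕ) (u₀ u₁ : ℝ × ℝ → ℂ) : Grid N × Grid N :=
  let g₀ : Grid N := fun p => u₀ (gridPoint a b N p)
  let g₁ : Grid N := multiplier a b (fun k => 1 / (delta a b α k : ℂ))
    (fun p => u₁ (gridPoint a b N p))
  (fun p => g₀ p - Complex.I * g₁ p, fun p => g₀ p + Complex.I * g₁ p)

/-- The grid functions `(φ₊ⁿ, φ₋ⁿ)` of the scheme. -/
def tsfp (a b α ε τ : ℝ) (N : ℕ) (u₀ u₁ : ℝ × ℝ → ℂ) : ℕ → Grid N × Grid N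
  | 0 => initialState a b α N u₀ u₁
  | n + 1 => strangStep a b α ε τ (tsfp a b α ε τ N u₀ u₁ n)

/-- The approximation `uⁿ = (φ₊ⁿ + φ₋ⁿ) / 2` of `u(tₙ)`. -/
def numU (a b α ε τ : ℝ) (N : ℕ) (u₀ u₁ : ℝ × ℝ → ℂ) (n : ℕ) : Grid N := fun p =>
  ((tsfp a b α ε τ N u₀ u₁ n).1 p + (tsfp a b α ε τ N u₀ u₁ n).2 p) / 2

/-- The approximation `vⁿ = (i/2) ⟨∇⟩_α (φ₊ⁿ - φ₋ⁿ)` of `∂ₜu(tₙ)`. -/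
def numV (a b α ε τ : ℝ) (N : ℕ) (u₀ u₁ : ℝ × ℝ → ℂ) (n : ℕ) : Grid N :=
  multiplier a b (fun k => Complex.I / 2 * (delta a b α k : ℂ))
    (fun p => (tsfp a b α ε τ N u₀ u₁ n).1 p - (tsfp a b α ε τ N u₀ u₁ n).2 p)

/-- The error `‖u(tₙ) - I_N uⁿ‖_{α/2} + ‖∂ₜu(tₙ) - I_N vⁿ‖` at `tₙ = n τ`. -/
def schemeError (a b α ε τ : ℝ) (N : ℕ) (u₀ u₁ : ℝ × ℝ → ℂ) (u v : ℝ → ℝ × ℝ → ℂ) (n : ℕ) : ℝ :=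
  normH a b (α / 2) (fun z => u (n * τ) z - interp a b (numU a b α ε τ N u₀ u₁ n) z)
    + normH a b 0 (fun z => v (n * τ) z - interp a b (numV a b α ε τ N u₀ u₁ n) z)

end NSFSGE

end

/-! Undoing the free flow, Ψ_± = e^{∓iδt} φ̂_±, turns a Strang step into exactly one step Z ↦ Z +
ε²τ N(t_n + τ/2, Z) of an explicit rule with midpoint phases (`gridTwist_strangStep`). Here f = ε² g
and N is `nl (gfun ε)`. The exact solution, truncated to T_N, solves Ψ' = ε² (N(t, Ψ) + ρ), where
the defect ρ is pure aliasing and of size h^m (`hasDerivAt_exactTwist`, `hnorm_defectFun_le`). Both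
evolutions move at speed ε² during a time T/ε², so Gronwall costs only a constant; what matters is
the sum of the local errors.

Estimated one by one, the local errors ε²τ·τ² add up to τ², a factor ε² short of the claim. Three
facts recover that factor. (1) g(w) = -w³/6 + ε² r(w). The quintic part r already carries ε², and
for it a second-order Taylor expansion at the midpoint suffices (`pnorm_nl_taylor_le`). (2) Inside a
step Ψ drifts by ε²τ, but the function u built from it only by ε²τ², because the two components of
the forcing cancel in u to first order (`hnorm_uOf_force_le`, `hnorm_uOf_sub_le`). (3) For frozen Ψ
the cubic part is a sum of exponentials e^{iθt} of resonance phases θ. The midpoint error of e^{iθt}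
over a step equals a kernel in θ times the increment of e^{iθt} over the same step (`midKer_spec`),
so it can be summed by parts (`pnorm_sum_corr_le`): the boundary terms are O(ε²τ²), and each
interior term contains a difference of Ψ over one step, which is again O(ε²τ). The kernel is at most
τ²|θ| for |θ|τ ≤ 2. It vanishes at θ = 0, so resonances produce no small divisors; the factor |θ|
costs one δ on one factor of the product, which the regularity of Ψ affords (`pnorm_tri_le`).

The restriction |θ|τ ≤ 2 is enforced by discarding δ > 2/(9τ), which costs τ^{m+α/2}
(`pnorm_sub_low_le`); this is the source of the third term of (i). All Lipschitz bounds need the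
numerical solution bounded in some H^σ with 1 < σ < m. A cruder first-order error estimate in that
algebra norm provides this (`pnorm_error_le_one`), after which the sharp estimate is run in H^{α/2}
(`pnorm_error_le`).

In space everything is done on the finite group of grid frequencies, with constants independent of
N. The regularity of g(u) is the limit N → ∞ of uniform discrete algebra bounds (`seqBound_ghat`),
and aliasing is controlled by a lattice sum (`wnorm_alias_le`).

Part (ii) is the same bound with the exponent m + 2 + 2/κ, for which τ ≤ ε^κ makes the third term
smaller than ε²τ². -/

open MeasureTheory

noncomputable section

namespace NSFSGE

/-! ### Weighted `ℓ²` norms on finite index sets -/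

section WeightedNorm

variable {ι : Type} [Fintype ι]

/-- The diagonal map `c ↦ (W ^ s) c` into the Euclidean space. -/
def wmap (W : ι → ℝ) (s : ℝ) : (ι → ℂ) →ₗ[ℝ] EuclideanSpace ℂ ι where
  toFun c := WithLp.toLp 2 fun i => ((W i ^ s : ℝ) : ℂ) * c i
  map_add' c d := by ext i; simp [mul_add]
  map_smul' r c := by ext i; simp; ring

/-- The weighted norm `(∑ W ^ (2 s) |c|²) ^ (1/2)`. -/
def wnorm (W : ι → ℝ) (s : ℝ) (c : ι → ℂ) : ℝ := ‖wmap W s c‖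

variable {W : ι → ℝ} {s : ℝ}

lemma wnorm_nonneg (c : ι → ℂ) : 0 ≤ wnorm W s c := norm_nonneg _

lemma wnorm_zero : wnorm W s (0 : ι → ℂ) = 0 := by simp [wnorm]

lemma wnorm_add_le (c d : ι → ℂ) : wnorm W s (c + d) ≤ wnorm W s c + wnorm W s d := by
  simpa [wnorm] using norm_add_le (wmap W s c) (wmap W s d)

lemma wnorm_sub_le (c d : ι → ℂ) : wnorm W s (c - d) ≤ wnorm W s c + wnorm W s d := by
  simpa [wnorm] using norm_sub_le (wmap W s c) (wmap W s d)

lemma wnorm_neg (c : ι → ℂ) : wnorm W s (-c) = wnorm W s c := by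
  simp [wnorm]

lemma wnorm_sub_comm (c d : ι → ℂ) : wnorm W s (c - d) = wnorm W s (d - c) := by
  rw [← wnorm_neg, neg_sub]

lemma wnorm_sum_le {κ : Type*} (t : Finset κ) (c : κ → ι → ℂ) :
    wnorm W s (∑ i ∈ t, c i) ≤ ∑ i ∈ t, wnorm W s (c i) := by
  simpa [wnorm, map_sum] using norm_sum_le t fun i => wmap W s (c i)

lemma wnorm_real_smul (r : ℝ) (c : ι → ℂ) : wnorm W s (r • c) = |r| * wnorm W s c := by
  simp [wnorm, norm_smul]

lemma wnorm_sq (hW : ∀ i, 1 ≤ W i) (c : ι → ℂ) :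
    wnorm W s c ^ 2 = ∑ i, (W i ^ s * ‖c i‖) ^ 2 := by
  rw [wnorm, EuclideanSpace.norm_sq_eq]
  refine Finset.sum_congr rfl fun i _ => ?_
  have : 0 ≤ W i ^ s := Real.rpow_nonneg (by linarith [hW i]) _
  simp [wmap, abs_of_nonneg this]

/-- All Fourier multiplier estimates reduce to this pointwise comparison; `r` counts the derivatives
lost, or gained if negative. -/
lemma wnorm_le_of_le (hW : ∀ i, 1 ≤ W i) {r κ : ℝ} (hκ : 0 ≤ κ) {c d : ι → ℂ}
    (h : ∀ i, ‖c i‖ ≤ κ * (W i ^ r * ‖d i‖)) : wnorm W s c ≤ κ * wnorm W (s + r) d := by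
  refine abs_le_of_sq_le_sq' ?_ (mul_nonneg hκ (wnorm_nonneg _)) |>.2
  rw [mul_pow, wnorm_sq hW, wnorm_sq hW, Finset.mul_sum]
  refine Finset.sum_le_sum fun i _ => ?_
  have h0 : 0 < W i := by linarith [hW i]
  have : 0 ≤ W i ^ s := Real.rpow_nonneg h0.le _
  rw [← mul_pow, Real.rpow_add h0]
  refine pow_le_pow_left₀ (by positivity) ?_ 2
  calc W i ^ s * ‖c i‖ ≤ W i ^ s * (κ * (W i ^ r * ‖d i‖)) := by gcongr; exact h i
    _ = _ := by ring

lemma wnorm_le_of_le' (hW : ∀ i, 1 ≤ W i) {κ : ℝ} (hκ : 0 ≤ κ) {c d : ι → ℂ}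
    (h : ∀ i, ‖c i‖ ≤ κ * ‖d i‖) : wnorm W s c ≤ κ * wnorm W s d := by
  simpa using wnorm_le_of_le (s := s) (r := 0) hW hκ (c := c) (d := d) (by simpa using h)

lemma wnorm_smul (hW : ∀ i, 1 ≤ W i) (z : ℂ) (c : ι → ℂ) :
    wnorm W s (z • c) ≤ ‖z‖ * wnorm W s c :=
  wnorm_le_of_le' hW (norm_nonneg _) fun i => by simp

lemma wnorm_mono (hW : ∀ i, 1 ≤ W i) {t : ℝ} (hst : s ≤ t) (c : ι → ℂ) :
    wnorm W s c ≤ wnorm W t c := by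
  have := wnorm_le_of_le (s := s) (r := t - s) hW zero_le_one (c := c) (d := c) fun i => by
    have : 1 ≤ W i ^ (t - s) := Real.one_le_rpow (hW i) (by linarith)
    nlinarith [norm_nonneg (c i)]
  simpa using this

lemma wnorm_eq_wnorm_zero (c : ι → ℂ) :
    wnorm W s c = wnorm W 0 (fun i => ((W i ^ s : ℝ) : ℂ) * c i) := by
  simp [wnorm, wmap]

lemma wnorm_congr_norm (hW : ∀ i, 1 ≤ W i) {c d : ι → ℂ} (h : ∀ i, ‖c i‖ = ‖d i‖) :
    wnorm W s c = wnorm W s d := by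
  have h1 := wnorm_le_of_le' (s := s) hW zero_le_one (c := c) (d := d) fun i => by simp [h i]
  have h2 := wnorm_le_of_le' (s := s) hW zero_le_one (c := d) (d := c) fun i => by simp [h i]
  linarith

/-- Cauchy–Schwarz: the `ℓ¹` norm is controlled by a weighted `ℓ²` norm. -/
lemma sum_norm_le_wnorm (hW : ∀ i, 1 ≤ W i) {K : ℝ} (hK : ∑ i, W i ^ (-(2 * s)) ≤ K)
    (c : ι → ℂ) : ∑ i, ‖c i‖ ≤ √K * wnorm W s c := by
  have hK0 : 0 ≤ K := le_trans (Finset.sum_nonneg fun i _ =>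
    Real.rpow_nonneg (by linarith [hW i]) _) hK
  have h := Finset.sum_mul_sq_le_sq_mul_sq Finset.univ (fun i => W i ^ (-s))
    (fun i => W i ^ s * ‖c i‖)
  refine abs_le_of_sq_le_sq' ?_ (mul_nonneg (Real.sqrt_nonneg _) (wnorm_nonneg _)) |>.2
  rw [mul_pow, Real.sq_sqrt hK0, wnorm_sq hW]
  have e1 : ∀ i, W i ^ (-s) * (W i ^ s * ‖c i‖) = ‖c i‖ := fun i => by
    rw [← mul_assoc, ← Real.rpow_add (by linarith [hW i])]; simp
  have e2 : ∀ i, (W i ^ (-s)) ^ 2 = W i ^ (-(2 * s)) := fun i => by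
    rw [← Real.rpow_natCast, ← Real.rpow_mul (by linarith [hW i])]; congr 1; push_cast; ring
  simp only [e1, e2] at h
  refine h.trans ?_
  gcongr

/-- Mean value inequality in a weighted norm. -/
lemma wnorm_sub_le_of_deriv {F F' : ℝ → ι → ℂ} {x y C : ℝ} (hxy : x ≤ y)
    (hc : ContinuousOn F (Set.Icc x y)) (hd : ∀ t ∈ Set.Ioo x y, HasDerivAt F (F' t) t)
    (hb : ∀ t ∈ Set.Ioo x y, wnorm W s (F' t) ≤ C) :
    wnorm W s (F y - F x) ≤ C * (y - x) := by
  rcases hxy.eq_or_lt with rfl | hlt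
  · simp [wnorm_zero]
  let L : (ι → ℂ) →L[ℝ] EuclideanSpace ℂ ι := (wmap W s).toContinuousLinearMap
  have hL : ContinuousOn (fun t => L (F t)) (Set.Icc x y) := L.continuous.comp_continuousOn hc
  -- The derivative is known only in the open interval, so the estimate is proved between interior
  -- points and carried to the endpoints by continuity of both sides.
  have key : ∀ p ∈ Set.Ioo x y, ∀ q ∈ Set.Ioo x y, ‖L (F q) - L (F p)‖ ≤ C * ‖q - p‖ := by
    intro p hp q hq
    refine Convex.norm_image_sub_le_of_norm_hasDerivWithin_le (f := fun t => L (F t))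
      (f' := fun t => L (F' t)) (s := Set.Ioo x y) (fun t ht => ?_) hb (convex_Ioo x y) hp hq
    exact (L.hasFDerivAt.comp_hasDerivAt t (hd t ht)).hasDerivWithinAt
  have hcl : closure (Set.Ioo x y ×ˢ Set.Ioo x y) = Set.Icc x y ×ˢ Set.Icc x y := by
    rw [closure_prod_eq, closure_Ioo hlt.ne]
  have hmem : ((x, y) : ℝ × ℝ) ∈ closure (Set.Ioo x y ×ˢ Set.Ioo x y) := by
    rw [hcl]; exact ⟨⟨le_rfl, hxy⟩, ⟨hxy, le_rfl⟩⟩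
  have h1 : ContinuousOn (fun p : ℝ × ℝ => ‖L (F p.2) - L (F p.1)‖)
      (closure (Set.Ioo x y ×ˢ Set.Ioo x y)) := by
    rw [hcl]
    exact ((hL.comp continuousOn_snd fun p hp => hp.2).sub
      (hL.comp continuousOn_fst fun p hp => hp.1)).norm
  have h2 := le_on_closure (s := Set.Ioo x y ×ˢ Set.Ioo x y)
    (f := fun p : ℝ × ℝ => ‖L (F p.2) - L (F p.1)‖) (g := fun p => C * ‖p.2 - p.1‖)
    (fun p hp => key p.1 hp.1 p.2 hp.2) h1 (by fun_prop) hmem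
  have h3 : wnorm W s (F y - F x) = ‖L (F y) - L (F x)‖ := by
    rw [← map_sub]; rfl
  rw [h3]
  simpa [abs_of_nonneg (sub_nonneg.2 hxy)] using h2

end WeightedNorm

/-! ### Finite Fourier analysis -/

/-- A finite group `G` of frequencies acting by characters on a finite set `P` of grid points,
with a subadditive weight `w ≥ 1` on the frequencies and a dispersion relation `δ ∼ w ^ β`. -/
structure GridSystem (G P : Type) [AddCommGroup G] [Fintype G] [Fintype P] (β : ℝ) where
  e : G → P → ℂ
  e_add : ∀ k l p, e (k + l) p = e k p * e l p
  norm_e : ∀ k p, ‖e k p‖ = 1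
  sum_e : ∀ k, k ≠ 0 → ∑ p, e k p = 0
  card_eq : Fintype.card G = Fintype.card P
  w : G → ℝ
  one_le_w : ∀ k, 1 ≤ w k
  w_add_le : ∀ k l, w (k + l) ≤ w k + w l
  δ : G → ℝ
  le_δ : ∀ k, w k ^ β ≤ δ k
  δ_le : ∀ k, δ k ≤ 2 * w k ^ β

namespace GridSystem

variable {G P : Type} [AddCommGroup G] [Fintype G] [Fintype P] {β : ℝ} (S : GridSystem G P β)

/-- The grid function with given Fourier coefficients. -/
def synth (c : G → ℂ) (p : P) : ℂ := ∑ k, c k * S.e k p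

/-- The Fourier coefficients of a grid function. -/
def anal (g : P → ℂ) (k : G) : ℂ := (Fintype.card P : ℂ)⁻¹ * ∑ p, g p * S.e (-k) p

/-- The discrete Sobolev norm. -/
def hnorm (s : ℝ) (g : P → ℂ) : ℝ := wnorm S.w s (S.anal g)

lemma w_pos (k : G) : 0 < S.w k := by linarith [S.one_le_w k]


lemma card_pos (S : GridSystem G P β) : 0 < Fintype.card P := S.card_eq ▸ Fintype.card_pos

lemma e_zero (p : P) : S.e 0 p = 1 := by
  have h := S.e_add 0 0 p
  have h0 : S.e 0 p ≠ 0 := norm_ne_zero_iff.1 (by rw [S.norm_e]; exact one_ne_zero)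
  rw [add_zero] at h
  exact (mul_eq_left₀ h0).1 h.symm

lemma e_neg_mul (k : G) (p : P) : S.e k p * S.e (-k) p = 1 := by
  rw [← S.e_add, add_neg_cancel, S.e_zero]

lemma conj_e (k : G) (p : P) : (starRingEnd ℂ) (S.e k p) = S.e (-k) p := by
  have h0 : S.e k p ≠ 0 := norm_ne_zero_iff.1 (by rw [S.norm_e]; exact one_ne_zero)
  apply mul_left_cancel₀ h0
  rw [S.e_neg_mul, Complex.mul_conj, Complex.normSq_eq_norm_sq, S.norm_e]; simp

lemma sum_e_eq [DecidableEq G] (k : G) :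
    ∑ p, S.e k p = if k = 0 then (Fintype.card P : ℂ) else 0 := by
  split_ifs with h
  · subst h; simp [S.e_zero]
  · exact S.sum_e k h

lemma anal_e [DecidableEq G] (l k : G) : S.anal (S.e l) k = if l = k then 1 else 0 := by
  have hc : (Fintype.card P : ℂ) ≠ 0 := by exact_mod_cast S.card_pos.ne'
  simp only [anal, ← S.e_add, S.sum_e_eq, ← sub_eq_add_neg, sub_eq_zero]
  split_ifs <;> simp [hc]

/-- `anal` as a linear map. -/
def analL : (P → ℂ) →ₗ[ℂ] (G → ℂ) where
  toFun := S.anal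
  map_add' f g := by ext k; simp [anal, add_mul, Finset.sum_add_distrib, mul_add]
  map_smul' r g := by
    ext k; simp only [anal, Pi.smul_apply, smul_eq_mul, RingHom.id_apply, mul_assoc,
      ← Finset.mul_sum]; ring

/-- `synth` as a linear map. -/
def synthL : (G → ℂ) →ₗ[ℂ] (P → ℂ) where
  toFun := S.synth
  map_add' f g := by ext k; simp [synth, add_mul, Finset.sum_add_distrib]
  map_smul' r g := by
    ext k; simp only [synth, Pi.smul_apply, smul_eq_mul, RingHom.id_apply, mul_assoc,
      ← Finset.mul_sum]

lemma anal_add (f g : P → ℂ) : S.anal (f + g) = S.anal f + S.anal g := S.analL.map_add f g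
lemma anal_sub (f g : P → ℂ) : S.anal (f - g) = S.anal f - S.anal g := S.analL.map_sub f g
lemma anal_smul (r : ℂ) (g : P → ℂ) : S.anal (r • g) = r • S.anal g := S.analL.map_smul r g
lemma anal_sum {κ : Type*} (t : Finset κ) (g : κ → P → ℂ) :
    S.anal (∑ i ∈ t, g i) = ∑ i ∈ t, S.anal (g i) := map_sum S.analL g t

lemma synth_eq_sum (c : G → ℂ) : S.synth c = ∑ k, c k • S.e k := by
  ext p; simp [synth]

lemma anal_synth (c : G → ℂ) : S.anal (S.synth c) = c := by
  classical
  ext k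
  simp [synth_eq_sum, anal_sum, anal_smul, S.anal_e]

/-- Orthogonality makes synthesis injective; since there are as many frequencies as grid points, it
is then bijective by dimension, and `anal` is a two-sided inverse. -/
lemma synth_anal (g : P → ℂ) : S.synth (S.anal g) = g := by
  have hinj : Function.Injective S.synthL := fun c d h => by
    have := congrArg S.anal h
    change S.anal (S.synth c) = S.anal (S.synth d) at this
    rwa [S.anal_synth, S.anal_synth] at this
  have hd : Module.finrank ℂ (G → ℂ) = Module.finrank ℂ (P → ℂ) := by
    simp [S.card_eq]
  obtain ⟨c, rfl⟩ := (LinearMap.injective_iff_surjective_of_finrank_eq_finrank hd).1 hinj g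
  change S.synth (S.anal (S.synth c)) = S.synth c
  rw [S.anal_synth]

lemma hnorm_synth (s : ℝ) (c : G → ℂ) : S.hnorm s (S.synth c) = wnorm S.w s c := by
  rw [hnorm, S.anal_synth]

/-- Parseval's identity on the grid. -/
lemma hnorm_zero_sq (g : P → ℂ) :
    S.hnorm 0 g ^ 2 = (Fintype.card P : ℝ)⁻¹ * ∑ p, ‖g p‖ ^ 2 := by
  have hc : (Fintype.card P : ℂ) ≠ 0 := by exact_mod_cast S.card_pos.ne'
  rw [hnorm, wnorm_sq S.one_le_w]
  simp only [Real.rpow_zero, one_mul]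
  have key : ∑ p, g p * (starRingEnd ℂ) (g p)
      = (Fintype.card P : ℂ) * ∑ k, S.anal g k * (starRingEnd ℂ) (S.anal g k) := by
    conv_lhs => enter [2, p, 2]; rw [← S.synth_anal g, synth, map_sum]
    simp only [map_mul, S.conj_e, Finset.mul_sum]
    rw [Finset.sum_comm]
    refine Finset.sum_congr rfl fun k _ => ?_
    rw [← mul_assoc]
    nth_rewrite 2 [anal]
    rw [← mul_assoc, mul_inv_cancel₀ hc, one_mul, Finset.sum_mul]
    refine Finset.sum_congr rfl fun p _ => by ring
  simp only [Complex.mul_conj, Complex.normSq_eq_norm_sq] at key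
  have key' : ∑ p, ‖g p‖ ^ 2 = (Fintype.card P : ℝ) * ∑ k, ‖S.anal g k‖ ^ 2 := by
    exact_mod_cast key
  rw [key', ← mul_assoc, inv_mul_cancel₀ (by exact_mod_cast S.card_pos.ne'), one_mul]

lemma hnorm_nonneg (s : ℝ) (g : P → ℂ) : 0 ≤ S.hnorm s g := wnorm_nonneg _

lemma hnorm_add_le (s : ℝ) (f g : P → ℂ) : S.hnorm s (f + g) ≤ S.hnorm s f + S.hnorm s g := by
  rw [hnorm, S.anal_add]; exact wnorm_add_le _ _

lemma hnorm_smul (s : ℝ) (z : ℂ) (g : P → ℂ) : S.hnorm s (z • g) ≤ ‖z‖ * S.hnorm s g := by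
  rw [hnorm, S.anal_smul]; exact wnorm_smul S.one_le_w z _

lemma hnorm_mono {s t : ℝ} (h : s ≤ t) (g : P → ℂ) : S.hnorm s g ≤ S.hnorm t g :=
  wnorm_mono S.one_le_w h _

/-- By Parseval the norm of index 0 is a mean square over grid points, so it is the one norm that
pointwise bounds control. Every estimate not using the algebra property goes through it. -/
lemma hnorm_zero_le_of_le {f g : P → ℂ} {κ : ℝ} (hκ : 0 ≤ κ) (h : ∀ p, ‖f p‖ ≤ κ * ‖g p‖) :
    S.hnorm 0 f ≤ κ * S.hnorm 0 g := by
  refine abs_le_of_sq_le_sq' ?_ (mul_nonneg hκ (S.hnorm_nonneg _ _)) |>.2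
  rw [mul_pow, S.hnorm_zero_sq, S.hnorm_zero_sq, mul_left_comm, Finset.mul_sum (a := κ ^ 2)]
  have hc : (0 : ℝ) ≤ (Fintype.card P : ℝ)⁻¹ := by positivity
  refine mul_le_mul_of_nonneg_left (Finset.sum_le_sum fun p _ => ?_) hc
  rw [← mul_pow]
  exact pow_le_pow_left₀ (norm_nonneg _) (h p) 2

lemma norm_synth_le (c : G → ℂ) (p : P) : ‖S.synth c p‖ ≤ ∑ k, ‖c k‖ :=
  (norm_sum_le _ _).trans (Finset.sum_le_sum fun k _ => by simp [S.norm_e])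

variable {K σ : ℝ}

lemma norm_le_hnorm (hK : ∑ k, S.w k ^ (-(2 * σ)) ≤ K) (g : P → ℂ) (p : P) :
    ‖g p‖ ≤ √K * S.hnorm σ g := by
  conv_lhs => rw [← S.synth_anal g]
  exact (S.norm_synth_le _ p).trans (sum_norm_le_wnorm S.one_le_w hK _)

lemma anal_mul [DecidableEq G] (f g : P → ℂ) (k : G) :
    S.anal (f * g) k = ∑ l, ∑ j, if l + j = k then S.anal f l * S.anal g j else 0 := by
  have : f * g = ∑ l, ∑ j, (S.anal f l * S.anal g j) • S.e (l + j) := by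
    conv_lhs => rw [← S.synth_anal f, ← S.synth_anal g]
    ext p
    simp only [Pi.mul_apply, synth, Finset.sum_mul_sum, Finset.sum_apply, Pi.smul_apply,
      smul_eq_mul, S.e_add]
    refine Finset.sum_congr rfl fun _ _ => Finset.sum_congr rfl fun _ _ => by ring
  rw [this]
  simp [anal_sum, anal_smul, S.anal_e]

/-- The grid function whose Fourier coefficients are `w ^ s |c|`. -/
def absSynth (s : ℝ) (c : G → ℂ) : P → ℂ := S.synth fun k => ((S.w k ^ s * ‖c k‖ : ℝ) : ℂ)

lemma hnorm_absSynth (s : ℝ) (c : G → ℂ) : S.hnorm 0 (S.absSynth s c) = wnorm S.w s c := by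
  rw [absSynth, hnorm_synth, wnorm_eq_wnorm_zero (s := s) c]
  refine wnorm_congr_norm S.one_le_w fun k => ?_
  have := Real.rpow_nonneg (S.w_pos k).le s
  simp [abs_of_nonneg this]

lemma norm_absSynth_le (hK : ∑ k, S.w k ^ (-(2 * σ)) ≤ K) (c : G → ℂ) (p : P) :
    ‖S.absSynth 0 c p‖ ≤ √K * wnorm S.w σ c := by
  refine (S.norm_synth_le _ p).trans ((le_of_eq ?_).trans (sum_norm_le_wnorm S.one_le_w hK c))
  simp

lemma w_add_rpow_le {s : ℝ} (hs : 0 ≤ s) (k l : G) :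
    S.w (k + l) ^ s ≤ 2 ^ s * (S.w k ^ s + S.w l ^ s) := by
  have hk := S.w_pos k
  have hl := S.w_pos l
  have h1 : S.w (k + l) ≤ 2 * max (S.w k) (S.w l) := by
    linarith [S.w_add_le k l, le_max_left (S.w k) (S.w l), le_max_right (S.w k) (S.w l)]
  have h2 : S.w (k + l) ^ s ≤ 2 ^ s * max (S.w k) (S.w l) ^ s := by
    rw [← Real.mul_rpow (by norm_num) (by positivity)]
    exact Real.rpow_le_rpow (S.w_pos _).le h1 hs
  refine h2.trans ?_
  gcongr
  rcases max_cases (S.w k) (S.w l) with ⟨h, _⟩ | ⟨h, _⟩ <;> rw [h]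
  · linarith [Real.rpow_nonneg hl.le s]
  · linarith [Real.rpow_nonneg hk.le s]

/-- The discrete Sobolev spaces above the critical exponent are algebras. -/
lemma hnorm_mul_le (hK : ∑ k, S.w k ^ (-(2 * σ)) ≤ K) {s : ℝ} (hσ : 0 ≤ σ) (hs : σ ≤ s)
    (f g : P → ℂ) :
    S.hnorm s (f * g) ≤ 2 ^ (s + 1) * √K * S.hnorm s f * S.hnorm s g := by
  classical
  have hs0 : 0 ≤ s := hσ.trans hs
  obtain ⟨F0, hF⟩ : ∃ F, F = S.absSynth 0 (S.anal f) := ⟨_, rfl⟩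
  obtain ⟨G0, hG⟩ : ∃ F, F = S.absSynth 0 (S.anal g) := ⟨_, rfl⟩
  obtain ⟨Fs, hFs'⟩ : ∃ F, F = S.absSynth s (S.anal f) := ⟨_, rfl⟩
  obtain ⟨Gs, hGs'⟩ : ∃ F, F = S.absSynth s (S.anal g) := ⟨_, rfl⟩
  have hFs : S.hnorm 0 Fs = S.hnorm s f := hFs' ▸ S.hnorm_absSynth s (S.anal f)
  have hGs : S.hnorm 0 Gs = S.hnorm s g := hGs' ▸ S.hnorm_absSynth s (S.anal g)
  -- The weight w^s of a sum of frequencies is distributed onto one of the two factors. Replacing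
  -- all coefficients by their absolute values makes the convolution sums dominate, and the result
  -- is again the transform of products of grid functions, which can be estimated in physical space
  -- as sup norm times L².
  have hpt : ∀ k, S.w k ^ s * ‖S.anal (f * g) k‖ ≤ 2 ^ s * ‖S.anal (Fs * G0 + F0 * Gs) k‖ := by
    intro k
    have e : S.anal (Fs * G0 + F0 * Gs) k
        = ((∑ l, ∑ j, if l + j = k then
            (S.w l ^ s + S.w j ^ s) * (‖S.anal f l‖ * ‖S.anal g j‖) else 0 : ℝ) : ℂ) := by
      rw [S.anal_add, Pi.add_apply, S.anal_mul, S.anal_mul]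
      simp only [hFs', hG, hF, hGs', absSynth, S.anal_synth, ← Finset.sum_add_distrib,
        Complex.ofReal_sum]
      refine Finset.sum_congr rfl fun l _ => Finset.sum_congr rfl fun j _ => ?_
      split_ifs
      · push_cast; simp; ring
      · simp
    have hnn : 0 ≤ ∑ l, ∑ j, if l + j = k then
            (S.w l ^ s + S.w j ^ s) * (‖S.anal f l‖ * ‖S.anal g j‖) else 0 := by
      refine Finset.sum_nonneg fun l _ => Finset.sum_nonneg fun j _ => ?_
      have := Real.rpow_nonneg (S.w_pos l).le s
      have := Real.rpow_nonneg (S.w_pos j).le s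
      split_ifs <;> positivity
    rw [e, Complex.norm_real, Real.norm_of_nonneg hnn, S.anal_mul, Finset.mul_sum]
    have hw := Real.rpow_nonneg (S.w_pos k).le s
    calc S.w k ^ s * ‖∑ l, ∑ j, if l + j = k then S.anal f l * S.anal g j else 0‖
        ≤ S.w k ^ s * ∑ l, ∑ j, if l + j = k then ‖S.anal f l‖ * ‖S.anal g j‖ else 0 := by
          gcongr
          refine (norm_sum_le _ _).trans (Finset.sum_le_sum fun l _ => ?_)
          refine (norm_sum_le _ _).trans (Finset.sum_le_sum fun j _ => ?_)
          split_ifs <;> simp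
      _ ≤ _ := by
          simp only [Finset.mul_sum]
          refine Finset.sum_le_sum fun l _ => Finset.sum_le_sum fun j _ => ?_
          split_ifs with h
          · subst h
            have h0 : 0 ≤ ‖S.anal f l‖ * ‖S.anal g j‖ := by positivity
            exact (mul_le_mul_of_nonneg_right (S.w_add_rpow_le hs0 l j) h0).trans_eq
              (mul_assoc _ _ _)
          · simp
  have h1 : S.hnorm s (f * g) ≤ 2 ^ s * S.hnorm 0 (Fs * G0 + F0 * Gs) := by
    rw [hnorm, wnorm_eq_wnorm_zero]
    refine wnorm_le_of_le' S.one_le_w (by positivity) fun k => ?_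
    have := Real.rpow_nonneg (S.w_pos k).le s
    rw [norm_mul, Complex.norm_real, Real.norm_of_nonneg this]
    exact hpt k
  have hG0 : ∀ p, ‖G0 p‖ ≤ _ := hG ▸ S.norm_absSynth_le hK (S.anal g)
  have hF0 : ∀ p, ‖F0 p‖ ≤ _ := hF ▸ S.norm_absSynth_le hK (S.anal f)
  have h2 : S.hnorm 0 (Fs * G0) ≤ √K * S.hnorm s g * S.hnorm s f := by
    rw [← hFs]
    refine S.hnorm_zero_le_of_le (by have := S.hnorm_nonneg s f; have := S.hnorm_nonneg s g; positivity)
      fun p => ?_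
    rw [Pi.mul_apply, norm_mul, mul_comm]
    exact mul_le_mul_of_nonneg_right ((hG0 p).trans (mul_le_mul_of_nonneg_left
      (S.hnorm_mono hs g) (Real.sqrt_nonneg _))) (norm_nonneg _)
  have h3 : S.hnorm 0 (F0 * Gs) ≤ √K * S.hnorm s f * S.hnorm s g := by
    rw [← hGs]
    refine S.hnorm_zero_le_of_le (by have := S.hnorm_nonneg s f; have := S.hnorm_nonneg s g; positivity)
      fun p => ?_
    rw [Pi.mul_apply, norm_mul]
    exact mul_le_mul_of_nonneg_right ((hF0 p).trans (mul_le_mul_of_nonneg_left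
      (S.hnorm_mono hs f) (Real.sqrt_nonneg _))) (norm_nonneg _)
  calc S.hnorm s (f * g) ≤ 2 ^ s * (S.hnorm 0 (Fs * G0) + S.hnorm 0 (F0 * Gs)) := by
        exact h1.trans (mul_le_mul_of_nonneg_left (S.hnorm_add_le _ _ _) (by positivity))
    _ ≤ 2 ^ s * (√K * S.hnorm s g * S.hnorm s f + √K * S.hnorm s f * S.hnorm s g) :=
        mul_le_mul_of_nonneg_left (add_le_add h2 h3) (by positivity)
    _ = _ := by rw [Real.rpow_add (by norm_num)]; simp; ring

end GridSystem
end NSFSGE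

namespace NSFSGE

/-! ### Entire functions dominated by the exponential series -/

/-- Entire functions without constant term whose coefficients are dominated by those of `exp`. -/
def ExpMajorized (F : ℂ → ℂ) : Prop :=
  ∃ (a : ℕ → ℂ) (n : ℕ → ℕ), Function.Injective n ∧
    (∀ j, ‖a j‖ ≤ 1 / ((n j + 1).factorial : ℝ)) ∧
    ∀ z, HasSum (fun j => a j * z ^ (n j + 1)) (F z)

lemma hasSum_exp_real (x : ℝ) :
    HasSum (fun n : ℕ => x ^ n / (n.factorial : ℝ)) (Real.exp x) := by
  rw [Real.exp_eq_exp_ℝ]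
  exact NormedSpace.expSeries_div_hasSum_exp x

lemma summable_exp_comp {n : ℕ → ℕ} (hn : Function.Injective n) (x : ℝ) :
    Summable fun j => x ^ (n j + 1) / ((n j + 1).factorial : ℝ) :=
  (hasSum_exp_real x).summable.comp_injective (i := fun j => n j + 1)
    fun i j h => hn (by simpa using h)

lemma tsum_exp_comp_le {n : ℕ → ℕ} (hn : Function.Injective n) {x : ℝ} (hx : 0 ≤ x) :
    ∑' j, x ^ (n j + 1) / ((n j + 1).factorial : ℝ) ≤ Real.exp x := by
  have h := tsum_comp_le_tsum_of_inj (hasSum_exp_real x).summable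
    (fun i => by positivity) (i := fun j => n j + 1) fun i j h => hn (by simpa using h)
  rwa [(hasSum_exp_real x).tsum_eq] at h

lemma ExpMajorized.norm_le_exp {F : ℂ → ℂ} (hF : ExpMajorized F) (z : ℂ) :
    ‖F z‖ ≤ Real.exp ‖z‖ := by
  obtain ⟨a, n, hn, ha, hs⟩ := hF
  rw [← (hs z).tsum_eq]
  refine (tsum_of_norm_bounded (summable_exp_comp hn ‖z‖).hasSum fun j => ?_).trans
    (tsum_exp_comp_le hn (norm_nonneg z))
  rw [norm_mul, norm_pow, div_eq_mul_one_div, mul_comm]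
  exact mul_le_mul_of_nonneg_left (ha j) (by positivity)

lemma ExpMajorized.neg {F : ℂ → ℂ} (hF : ExpMajorized F) : ExpMajorized fun z => -F z := by
  obtain ⟨a, n, hn, ha, hs⟩ := hF
  exact ⟨fun j => -a j, n, hn, by simpa using ha, fun z => by simpa using (hs z).neg⟩

/-- Since |ε| ≤ 1, the powers ε^{2n} only help; the majorant is the same exponential series for all
ε, and this makes every later constant uniform in ε. -/
lemma ExpMajorized.of_hasSum {F : ℂ → ℂ} {ε : ℝ} (hε : |ε| ≤ 1) (r : ℕ) (c : ℕ → ℂ)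
    (hc : ∀ n, ‖c n‖ ≤ 1)
    (h : ∀ z, HasSum (fun n => c n * (ε : ℂ) ^ (2 * n) * z ^ (2 * n + r + 1)
      / ((2 * n + r + 1).factorial : ℂ)) (F z)) : ExpMajorized F := by
  refine ⟨fun n => c n * (ε : ℂ) ^ (2 * n) / ((2 * n + r + 1).factorial : ℂ),
    fun n => 2 * n + r, fun i j h => by simpa using h, fun j => ?_, fun z => ?_⟩
  · rw [norm_div, norm_mul, norm_pow, Complex.norm_real, Real.norm_eq_abs, Complex.norm_natCast]
    gcongr
    exact mul_le_one₀ (hc j) (by positivity) (pow_le_one₀ (abs_nonneg _) hε)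
  · convert h z using 2
    ring

/-- Lipschitz bound on discs. -/
lemma norm_sub_le_of_expMajorized {F F' : ℂ → ℂ} (hd : ∀ z, HasDerivAt F (F' z) z)
    (hF' : ExpMajorized F') {R : ℝ} {z z' : ℂ} (hz : ‖z‖ ≤ R) (hz' : ‖z'‖ ≤ R) :
    ‖F z - F z'‖ ≤ Real.exp R * ‖z - z'‖ := by
  refine Convex.norm_image_sub_le_of_norm_hasDerivWithin_le (s := Metric.closedBall (0 : ℂ) R)
    (fun w _ => (hd w).hasDerivWithinAt) (fun w hw => ?_) (convex_closedBall 0 R) ?_ ?_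
  · refine (hF'.norm_le_exp w).trans (Real.exp_le_exp.2 ?_)
    simpa using hw
  · simpa using hz'
  · simpa using hz

/-! ### The rescaled nonlinearity and its quintic remainder -/

/-- `ε⁻² f(w)` for the nonlinearity `f` of the scheme. -/
def gfun (ε : ℝ) (w : ℂ) : ℂ := (Complex.sin (ε * w) - ε * w) / (ε : ℂ) ^ 3
/-- The derivative of `gfun`. -/
def gfun' (ε : ℝ) (w : ℂ) : ℂ := (Complex.cos (ε * w) - 1) / (ε : ℂ) ^ 2
/-- The remainder of `gfun` after its cubic term, divided by `ε²`. -/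
def rfun (ε : ℝ) (w : ℂ) : ℂ := (Complex.sin (ε * w) - ε * w + (ε * w) ^ 3 / 6) / (ε : ℂ) ^ 5
/-- The derivative of `rfun`. -/
def rfun' (ε : ℝ) (w : ℂ) : ℂ := (Complex.cos (ε * w) - 1 + (ε * w) ^ 2 / 2) / (ε : ℂ) ^ 4

section

variable {ε : ℝ}

/-- The factor ε² is the strength of the interaction and the reason why times of order ε⁻² are
within reach of Gronwall. -/
lemma nonlin_eq (hε : 0 < ε) (w : ℂ) : nonlin ε w = (ε : ℂ) ^ 2 * gfun ε w := by
  have : (ε : ℂ) ≠ 0 := by exact_mod_cast hε.ne'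
  rw [nonlin, gfun]; field_simp

/-- The second summand carries an extra ε², so only the cubic term has to be treated by summation by
parts. -/
lemma gfun_eq (hε : 0 < ε) (w : ℂ) : gfun ε w = -(1 / 6) * w ^ 3 + (ε : ℂ) ^ 2 * rfun ε w := by
  have : (ε : ℂ) ≠ 0 := by exact_mod_cast hε.ne'
  rw [gfun, rfun]; field_simp; ring

lemma hasDerivAt_gfun (hε : 0 < ε) (w : ℂ) : HasDerivAt (gfun ε) (gfun' ε w) w := by
  have h0 : (ε : ℂ) ≠ 0 := by exact_mod_cast hε.ne'
  have h1 : HasDerivAt (fun w : ℂ => (ε : ℂ) * w) ε w := by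
    simpa using (hasDerivAt_id w).const_mul (ε : ℂ)
  refine ((h1.csin.sub h1).div_const ((ε : ℂ) ^ 3)).congr_deriv ?_
  rw [gfun']; field_simp

lemma hasDerivAt_rfun (hε : 0 < ε) (w : ℂ) : HasDerivAt (rfun ε) (rfun' ε w) w := by
  have h0 : (ε : ℂ) ≠ 0 := by exact_mod_cast hε.ne'
  have h1 : HasDerivAt (fun w : ℂ => (ε : ℂ) * w) ε w := by
    simpa using (hasDerivAt_id w).const_mul (ε : ℂ)
  refine (((h1.csin.sub h1).add ((h1.pow 3).div_const 6)).div_const ((ε : ℂ) ^ 5)).congr_deriv ?_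
  rw [rfun']; push_cast; field_simp; ring

/-- The second derivative of `rfun` leads back to `gfun`, so the second-order Taylor estimate needs
no further majorant. -/
lemma hasDerivAt_rfun' (hε : 0 < ε) (w : ℂ) : HasDerivAt (rfun' ε) (-gfun ε w) w := by
  have h0 : (ε : ℂ) ≠ 0 := by exact_mod_cast hε.ne'
  have h1 : HasDerivAt (fun w : ℂ => (ε : ℂ) * w) ε w := by
    simpa using (hasDerivAt_id w).const_mul (ε : ℂ)
  refine (((h1.ccos.sub_const 1).add ((h1.pow 2).div_const 2)).div_const
    ((ε : ℂ) ^ 4)).congr_deriv ?_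
  rw [gfun]; push_cast; field_simp; ring

lemma expMajorized_gfun (hε : 0 < ε) (hε1 : ε ≤ 1) : ExpMajorized (gfun ε) := by
  have h0 : (ε : ℂ) ≠ 0 := by exact_mod_cast hε.ne'
  refine ExpMajorized.of_hasSum (ε := ε) (by rwa [abs_of_pos hε]) 2 (fun n => (-1) ^ (n + 1))
    (fun n => by simp) fun z => ?_
  have h := ((hasSum_nat_add_iff' 1).2 (Complex.hasSum_sin (ε * z))).div_const ((ε : ℂ) ^ 3)
  convert h using 1
  · rfl
  · ext n
    rw [show 2 * (n + 1) + 1 = 2 * n + 2 + 1 by ring, mul_pow,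
      show (ε : ℂ) ^ (2 * n + 2 + 1) = ε ^ (2 * n) * ε ^ 3 by ring]
    field_simp
  · simp [gfun]

lemma expMajorized_gfun' (hε : 0 < ε) (hε1 : ε ≤ 1) : ExpMajorized (gfun' ε) := by
  have h0 : (ε : ℂ) ≠ 0 := by exact_mod_cast hε.ne'
  refine ExpMajorized.of_hasSum (ε := ε) (by rwa [abs_of_pos hε]) 1 (fun n => (-1) ^ (n + 1))
    (fun n => by simp) fun z => ?_
  have h := ((hasSum_nat_add_iff' 1).2 (Complex.hasSum_cos (ε * z))).div_const ((ε : ℂ) ^ 2)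
  convert h using 1
  · rfl
  · ext n
    rw [show 2 * (n + 1) = 2 * n + 1 + 1 by ring, mul_pow,
      show (ε : ℂ) ^ (2 * n + 1 + 1) = ε ^ (2 * n) * ε ^ 2 by ring]
    field_simp
  · simp [gfun']

lemma expMajorized_rfun (hε : 0 < ε) (hε1 : ε ≤ 1) : ExpMajorized (rfun ε) := by
  have h0 : (ε : ℂ) ≠ 0 := by exact_mod_cast hε.ne'
  refine ExpMajorized.of_hasSum (ε := ε) (by rwa [abs_of_pos hε]) 4 (fun n => (-1) ^ (n + 2))
    (fun n => by simp) fun z => ?_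
  have h := ((hasSum_nat_add_iff' 2).2 (Complex.hasSum_sin (ε * z))).div_const ((ε : ℂ) ^ 5)
  convert h using 1
  · rfl
  · ext n
    rw [show 2 * (n + 2) + 1 = 2 * n + 4 + 1 by ring, mul_pow,
      show (ε : ℂ) ^ (2 * n + 4 + 1) = ε ^ (2 * n) * ε ^ 5 by ring]
    field_simp
  · simp [rfun, Finset.sum_range_succ, Nat.factorial]; ring

lemma expMajorized_rfun' (hε : 0 < ε) (hε1 : ε ≤ 1) : ExpMajorized (rfun' ε) := by
  have h0 : (ε : ℂ) ≠ 0 := by exact_mod_cast hε.ne'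
  refine ExpMajorized.of_hasSum (ε := ε) (by rwa [abs_of_pos hε]) 3 (fun n => (-1) ^ (n + 2))
    (fun n => by simp) fun z => ?_
  have h := ((hasSum_nat_add_iff' 2).2 (Complex.hasSum_cos (ε * z))).div_const ((ε : ℂ) ^ 4)
  convert h using 1
  · rfl
  · ext n
    rw [show 2 * (n + 2) = 2 * n + 3 + 1 by ring, mul_pow,
      show (ε : ℂ) ^ (2 * n + 3 + 1) = ε ^ (2 * n) * ε ^ 4 by ring]
    field_simp
  · simp [rfun', Finset.sum_range_succ]; ring

end

/-! ### Composition with entire functions in the discrete Sobolev algebra -/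

namespace GridSystem

variable {G P : Type} [AddCommGroup G] [Fintype G] [Fintype P] {β : ℝ} (S : GridSystem G P β)
variable {K σ : ℝ}

lemma hasDerivAt_anal {q : ℝ → P → ℂ} {q' : P → ℂ} {t : ℝ} (h : HasDerivAt q q' t) :
    HasDerivAt (fun r => S.anal (q r)) (S.anal q') t :=
  ((S.analL.restrictScalars ℝ).toContinuousLinearMap.hasFDerivAt.comp_hasDerivAt t h)

/-- A constant making the discrete Sobolev spaces normed algebras. -/
def algC (K s : ℝ) : ℝ := 2 ^ (s + 1) * √K + 1

lemma one_le_algC (K s : ℝ) : 1 ≤ algC K s := by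
  have : 0 ≤ (2 : ℝ) ^ (s + 1) * √K := by positivity
  unfold algC; linarith

lemma hnorm_mul_le' (hK : ∑ k, S.w k ^ (-(2 * σ)) ≤ K) {s : ℝ} (hσ : 0 ≤ σ) (hs : σ ≤ s)
    (f g : P → ℂ) : S.hnorm s (f * g) ≤ algC K s * (S.hnorm s f * S.hnorm s g) := by
  refine (S.hnorm_mul_le hK hσ hs f g).trans ?_
  have := mul_nonneg (S.hnorm_nonneg s f) (S.hnorm_nonneg s g)
  rw [algC]; nlinarith

lemma hnorm_pow_le (hK : ∑ k, S.w k ^ (-(2 * σ)) ≤ K) {s : ℝ} (hσ : 0 ≤ σ) (hs : σ ≤ s)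
    (f : P → ℂ) (j : ℕ) : S.hnorm s (f ^ (j + 1)) ≤ (algC K s * S.hnorm s f) ^ (j + 1) := by
  have hA := one_le_algC K s
  have hf := S.hnorm_nonneg s f
  induction j with
  | zero => simp; nlinarith
  | succ j ih =>
    rw [pow_succ]
    refine (S.hnorm_mul_le' hK hσ hs _ _).trans ?_
    calc _ = S.hnorm s (f ^ (j + 1)) * (algC K s * S.hnorm s f) := by ring
      _ ≤ (algC K s * S.hnorm s f) ^ (j + 1) * (algC K s * S.hnorm s f) := by gcongr
      _ = _ := by ring

/-- Composition with a majorized entire function in the discrete Sobolev algebra. -/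
lemma hnorm_comp_le (hK : ∑ k, S.w k ^ (-(2 * σ)) ≤ K) {s : ℝ} (hσ : 0 ≤ σ) (hs : σ ≤ s)
    {F : ℂ → ℂ} (hF : ExpMajorized F) {R : ℝ} {f : P → ℂ} (hf : S.hnorm s f ≤ R) :
    S.hnorm s (fun p => F (f p)) ≤ Real.exp (algC K s * R) := by
  obtain ⟨a, n, hn, ha, hsum⟩ := hF
  have hA := one_le_algC K s
  have hf0 := S.hnorm_nonneg s f
  -- The series converges at each grid point, hence in the finite-dimensional space of grid
  -- functions; applying the linear map whose norm is `hnorm` turns it into a series that can be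
  -- bounded termwise by the algebra property.
  have h1 : HasSum (fun j => a j • f ^ (n j + 1)) (fun p => F (f p)) :=
    Pi.hasSum.2 fun p => by simpa using hsum (f p)
  let L : (P → ℂ) →L[ℝ] EuclideanSpace ℂ G :=
    ((wmap S.w s).comp (S.analL.restrictScalars ℝ)).toContinuousLinearMap
  have h2 := (h1.mapL L)
  have hx : 0 ≤ algC K s * S.hnorm s f := by positivity
  have h3 : ‖L (fun p => F (f p))‖ ≤ Real.exp (algC K s * S.hnorm s f) := by
    rw [← h2.tsum_eq]
    refine (tsum_of_norm_bounded (summable_exp_comp hn (algC K s * S.hnorm s f)).hasSum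
      fun j => ?_).trans (tsum_exp_comp_le hn hx)
    change S.hnorm s (a j • f ^ (n j + 1)) ≤ _
    refine (S.hnorm_smul s _ _).trans ?_
    rw [div_eq_mul_one_div, mul_comm]
    exact mul_le_mul (S.hnorm_pow_le hK hσ hs f _) (ha j) (norm_nonneg _) (by positivity)
  refine h3.trans (Real.exp_le_exp.2 ?_)
  gcongr

/-- Lipschitz bound for composition in the discrete Sobolev algebra. -/
lemma hnorm_comp_sub_le (hK : ∑ k, S.w k ^ (-(2 * σ)) ≤ K) {s : ℝ} (hσ : 0 ≤ σ) (hs : σ ≤ s)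
    {F F' : ℂ → ℂ} (hd : ∀ z, HasDerivAt F (F' z) z) (hF' : ExpMajorized F') {R : ℝ}
    {f g : P → ℂ} (hf : S.hnorm s f ≤ R) (hg : S.hnorm s g ≤ R) :
    S.hnorm s ((fun p => F (f p)) - fun p => F (g p))
      ≤ algC K s * Real.exp (algC K s * R) * S.hnorm s (f - g) := by
  have hA := one_le_algC K s
  -- Mean value inequality along the segment from g to f, which stays in the ball of radius R by
  -- convexity of the norm.
  have hder : ∀ t : ℝ, HasDerivAt (fun (t : ℝ) p => F (g p + t * (f p - g p)))
      ((fun p => F' (g p + t * (f p - g p))) * (f - g)) t := fun t => by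
    rw [hasDerivAt_pi]
    intro p
    have h1 : HasDerivAt (fun t : ℝ => g p + (t : ℂ) * (f p - g p)) (f p - g p) t := by
      simpa using ((Complex.ofRealCLM.hasDerivAt (x := t)).mul_const (f p - g p)).const_add (g p)
    exact (hd _).comp t h1
  have h := wnorm_sub_le_of_deriv (W := S.w) (s := s) (x := 0) (y := 1) zero_le_one
    (F := fun t => S.anal (fun p => F (g p + t * (f p - g p))))
    (F' := fun t => S.anal ((fun p => F' (g p + t * (f p - g p))) * (f - g)))
    (C := algC K s * Real.exp (algC K s * R) * S.hnorm s (f - g))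
    (fun t _ => (S.hasDerivAt_anal (hder t)).continuousAt.continuousWithinAt)
    (fun t _ => S.hasDerivAt_anal (hder t)) (fun t ht => ?_)
  · simpa [hnorm, S.anal_sub] using h
  · refine (S.hnorm_mul_le' hK hσ hs _ _).trans ?_
    rw [mul_assoc]
    have hconv : S.hnorm s (fun p => g p + t * (f p - g p)) ≤ R := by
      have e : (fun p => g p + t * (f p - g p)) = ((1 - t : ℝ) : ℂ) • g + (t : ℂ) • f := by
        ext p; simp; ring
      rw [e]
      refine (S.hnorm_add_le s _ _).trans ((add_le_add (S.hnorm_smul s _ _)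
        (S.hnorm_smul s _ _)).trans ?_)
      rw [Complex.norm_real, Complex.norm_real, Real.norm_of_nonneg (by linarith [ht.2]),
        Real.norm_of_nonneg ht.1.le]
      nlinarith [ht.1, ht.2]
    have h0 := S.hnorm_nonneg s (f - g)
    have := S.hnorm_comp_le hK hσ hs hF' hconv
    gcongr

/-- Lipschitz bound for composition in the discrete `L²` norm, for bounded arguments. -/
lemma hnorm_zero_comp_sub_le {F F' : ℂ → ℂ} (hd : ∀ z, HasDerivAt F (F' z) z)
    (hF' : ExpMajorized F') {R : ℝ} {f g : P → ℂ} (hf : ∀ p, ‖f p‖ ≤ R) (hg : ∀ p, ‖g p‖ ≤ R) :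
    S.hnorm 0 ((fun p => F (f p)) - fun p => F (g p)) ≤ Real.exp R * S.hnorm 0 (f - g) :=
  S.hnorm_zero_le_of_le (Real.exp_pos _).le fun p =>
    norm_sub_le_of_expMajorized hd hF' (hf p) (hg p)

end GridSystem

end NSFSGE

namespace NSFSGE

namespace GridSystem

variable {G P : Type} [AddCommGroup G] [Fintype G] [Fintype P] {β : ℝ} (S : GridSystem G P β)
variable {K σ : ℝ}

/-! ### The twisted variables -/

/-- The sign of a component: `true` stands for `+`, `false` for `-`. -/
def sgn (b : Bool) : ℝ := cond b 1 (-1)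

/-- The signed frequencies `± δ`. -/
def lam (j : Bool × G) : ℝ := sgn j.1 * S.δ j.2

/-- The weight on pairs of coefficients. -/
def wJ (j : Bool × G) : ℝ := S.w j.2

/-- The Sobolev norm of a pair of coefficient vectors. -/
def pnorm (s : ℝ) (Ψ : Bool × G → ℂ) : ℝ := wnorm S.wJ s Ψ

/-- The phase `exp (i λ t)`. -/
def phase (t : ℝ) (j : Bool × G) : ℂ := Complex.exp (Complex.I * ((S.lam j * t : ℝ) : ℂ))

/-- The grid function `u = (φ₊ + φ₋) / 2` belonging to the twisted variables `Ψ` at time `t`. -/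
def uOf (t : ℝ) (Ψ : Bool × G → ℂ) : P → ℂ :=
  S.synth fun k => (S.phase t (true, k) * Ψ (true, k) + S.phase t (false, k) * Ψ (false, k)) / 2

/-- The twisted forcing `i exp (-i λ t) λ⁻¹ q̂`. -/
def force (t : ℝ) (q : P → ℂ) (j : Bool × G) : ℂ :=
  Complex.I * S.phase (-t) j / (S.lam j : ℂ) * S.anal q j.2

/-- Multiplication with `i λ`. -/
def lamMul (Ψ : Bool × G → ℂ) (j : Bool × G) : ℂ := Complex.I * (S.lam j : ℂ) * Ψ j

/-- The twisted nonlinearity. -/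
def nl (F : ℂ → ℂ) (t : ℝ) (Ψ : Bool × G → ℂ) : Bool × G → ℂ :=
  S.force t fun p => F (S.uOf t Ψ p)

lemma one_le_wJ (j : Bool × G) : 1 ≤ S.wJ j := S.one_le_w j.2

lemma one_le_δ (hβ : 0 ≤ β) (k : G) : 1 ≤ S.δ k :=
  (Real.one_le_rpow (S.one_le_w k) hβ).trans (S.le_δ k)

lemma abs_lam (hβ : 0 ≤ β) (j : Bool × G) : |S.lam j| = S.δ j.2 := by
  have := S.one_le_δ hβ j.2
  obtain ⟨b, k⟩ := j
  cases b <;> simp [lam, sgn] <;> exact (by linarith : (0:ℝ) ≤ S.δ k)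

lemma lam_ne_zero (hβ : 0 ≤ β) (j : Bool × G) : S.lam j ≠ 0 := by
  rw [← abs_pos, S.abs_lam hβ]; linarith [S.one_le_δ hβ j.2]

lemma norm_phase (t : ℝ) (j : Bool × G) : ‖S.phase t j‖ = 1 := by
  rw [phase, mul_comm]; exact Complex.norm_exp_ofReal_mul_I _

lemma phase_add (s t : ℝ) (j : Bool × G) : S.phase (s + t) j = S.phase s j * S.phase t j := by
  rw [phase, phase, phase, ← Complex.exp_add]; congr 1; push_cast; ring

lemma phase_zero (j : Bool × G) : S.phase 0 j = 1 := by simp [phase]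

lemma phase_mul_neg (t : ℝ) (j : Bool × G) : S.phase t j * S.phase (-t) j = 1 := by
  rw [← phase_add, add_neg_cancel, phase_zero]

lemma hasDerivAt_phase (t : ℝ) (j : Bool × G) :
    HasDerivAt (fun t => S.phase t j) (Complex.I * S.lam j * S.phase t j) t := by
  have h : HasDerivAt (fun t : ℝ => Complex.I * ((S.lam j * t : ℝ) : ℂ))
      (Complex.I * (S.lam j : ℂ)) t := by
    have := ((Complex.ofRealCLM.hasDerivAt (x := t)).const_mul (Complex.I * (S.lam j : ℂ)))
    simpa [mul_assoc] using this
  simpa [phase, mul_comm] using h.cexp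

lemma hasDerivAt_phase_neg (t : ℝ) (j : Bool × G) :
    HasDerivAt (fun t => S.phase (-t) j) (-(Complex.I * S.lam j * S.phase (-t) j)) t := by
  exact ((S.hasDerivAt_phase (-t) j).scomp t (hasDerivAt_neg t)).congr_deriv (by simp)

lemma pnorm_sq (s : ℝ) (Ψ : Bool × G → ℂ) :
    S.pnorm s Ψ ^ 2 = ∑ k, (S.w k ^ s) ^ 2 * (‖Ψ (true, k)‖ ^ 2 + ‖Ψ (false, k)‖ ^ 2) := by
  rw [pnorm, wnorm_sq S.one_le_wJ, Fintype.sum_prod_type, Finset.sum_comm]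
  refine Finset.sum_congr rfl fun k _ => ?_
  simp [wJ, mul_pow, mul_add]

lemma pnorm_nonneg (s : ℝ) (Ψ : Bool × G → ℂ) : 0 ≤ S.pnorm s Ψ := wnorm_nonneg _

lemma pnorm_mono {s t : ℝ} (h : s ≤ t) (Ψ : Bool × G → ℂ) : S.pnorm s Ψ ≤ S.pnorm t Ψ :=
  wnorm_mono S.one_le_wJ h _

lemma pnorm_add_le (s : ℝ) (Ψ Ψ' : Bool × G → ℂ) :
    S.pnorm s (Ψ + Ψ') ≤ S.pnorm s Ψ + S.pnorm s Ψ' := wnorm_add_le _ _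

lemma pnorm_sub_le (s : ℝ) (Ψ Ψ' : Bool × G → ℂ) :
    S.pnorm s (Ψ - Ψ') ≤ S.pnorm s Ψ + S.pnorm s Ψ' := wnorm_sub_le _ _

/-- The grid function `u` as a linear map of the twisted variables. -/
def uL (t : ℝ) : (Bool × G → ℂ) →ₗ[ℂ] (P → ℂ) where
  toFun := S.uOf t
  map_add' f g := by
    change S.synthL _ = S.synthL _ + S.synthL _
    rw [← map_add]; congr 1; ext k; simp; ring
  map_smul' r g := by
    change S.synthL _ = r • S.synthL _
    rw [← map_smul]; congr 1; ext k; simp; ring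

lemma uOf_add (t : ℝ) (Ψ Ψ' : Bool × G → ℂ) :
    S.uOf t (Ψ + Ψ') = S.uOf t Ψ + S.uOf t Ψ' := (S.uL t).map_add _ _

lemma uOf_sub (t : ℝ) (Ψ Ψ' : Bool × G → ℂ) :
    S.uOf t (Ψ - Ψ') = S.uOf t Ψ - S.uOf t Ψ' := (S.uL t).map_sub _ _

lemma uOf_smul (t : ℝ) (r : ℂ) (Ψ : Bool × G → ℂ) :
    S.uOf t (r • Ψ) = r • S.uOf t Ψ := (S.uL t).map_smul _ _

lemma force_add (t : ℝ) (q q' : P → ℂ) : S.force t (q + q') = S.force t q + S.force t q' := by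
  ext j; simp [force, S.anal_add, mul_add]

lemma force_sub (t : ℝ) (q q' : P → ℂ) : S.force t (q - q') = S.force t q - S.force t q' := by
  ext j; simp [force, S.anal_sub, mul_sub]

lemma force_smul (t : ℝ) (r : ℂ) (q : P → ℂ) : S.force t (r • q) = r • S.force t q := by
  ext j; simp [force, S.anal_smul]; ring

/-- The grid function `u` is controlled by the twisted variables. -/
lemma hnorm_uOf_le (s t : ℝ) (Ψ : Bool × G → ℂ) : S.hnorm s (S.uOf t Ψ) ≤ S.pnorm s Ψ := by
  refine abs_le_of_sq_le_sq' ?_ (S.pnorm_nonneg _ _) |>.2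
  rw [uOf, hnorm_synth, wnorm_sq S.one_le_w, pnorm_sq]
  refine Finset.sum_le_sum fun k _ => ?_
  rw [mul_pow]
  refine mul_le_mul_of_nonneg_left ?_ (by positivity)
  have h : ‖(S.phase t (true, k) * Ψ (true, k) + S.phase t (false, k) * Ψ (false, k)) / 2‖
      ≤ (‖Ψ (true, k)‖ + ‖Ψ (false, k)‖) / 2 := by
    rw [norm_div, Complex.norm_ofNat]
    gcongr
    refine (norm_add_le _ _).trans (le_of_eq ?_)
    simp [S.norm_phase]
  calc _ ≤ ((‖Ψ (true, k)‖ + ‖Ψ (false, k)‖) / 2) ^ 2 := by gcongr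
    _ ≤ _ := by nlinarith [sq_nonneg (‖Ψ (true, k)‖ - ‖Ψ (false, k)‖), sq_nonneg (‖Ψ (true, k)‖),
                  sq_nonneg (‖Ψ (false, k)‖)]

lemma hasDerivAt_uOf (t : ℝ) (Ψ : Bool × G → ℂ) :
    HasDerivAt (fun t => S.uOf t Ψ) (S.uOf t (S.lamMul Ψ)) t := by
  have h : HasDerivAt (fun t k => (S.phase t (true, k) * Ψ (true, k)
      + S.phase t (false, k) * Ψ (false, k)) / 2) (fun k =>
        (S.phase t (true, k) * S.lamMul Ψ (true, k)
          + S.phase t (false, k) * S.lamMul Ψ (false, k)) / 2) t := by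
    rw [hasDerivAt_pi]
    intro k
    refine ((((S.hasDerivAt_phase t (true, k)).mul_const _).add
      ((S.hasDerivAt_phase t (false, k)).mul_const _)).div_const 2).congr_deriv ?_
    simp only [lamMul]; ring
  exact (S.synthL.restrictScalars ℝ).toContinuousLinearMap.hasFDerivAt.comp_hasDerivAt t h

lemma hasDerivAt_uOf_right (t : ℝ) {Ψ : ℝ → Bool × G → ℂ} {Ψ' : Bool × G → ℂ} {r : ℝ}
    (h : HasDerivAt Ψ Ψ' r) : HasDerivAt (fun r => S.uOf t (Ψ r)) (S.uOf t Ψ') r :=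
  ((S.uL t).restrictScalars ℝ).toContinuousLinearMap.hasFDerivAt.comp_hasDerivAt r h

lemma pnorm_lamMul_le (hβ : 0 ≤ β) (s : ℝ) (Ψ : Bool × G → ℂ) :
    S.pnorm s (S.lamMul Ψ) ≤ 2 * S.pnorm (s + β) Ψ :=
  wnorm_le_of_le S.one_le_wJ (by norm_num) fun j => by
    rw [lamMul, norm_mul, norm_mul, Complex.norm_I, one_mul, Complex.norm_real, Real.norm_eq_abs,
      S.abs_lam hβ, ← mul_assoc]
    exact mul_le_mul_of_nonneg_right (S.δ_le j.2) (norm_nonneg _)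

/-- The forcing gains `β` derivatives. -/
lemma pnorm_force_le (hβ : 0 ≤ β) (s t : ℝ) (q : P → ℂ) :
    S.pnorm (s + β) (S.force t q) ≤ 2 * S.hnorm s q := by
  refine abs_le_of_sq_le_sq' ?_ (mul_nonneg (by norm_num) (S.hnorm_nonneg _ _)) |>.2
  rw [pnorm_sq, mul_pow, hnorm, wnorm_sq S.one_le_w, Finset.mul_sum]
  refine Finset.sum_le_sum fun k _ => ?_
  have hw := S.w_pos k
  have hwb : 0 < S.w k ^ β := Real.rpow_pos_of_pos hw _
  have key : ∀ b, S.w k ^ β * ‖S.force t q (b, k)‖ ≤ ‖S.anal q k‖ := fun b => by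
    have hδ : 0 < S.δ k := by linarith [S.one_le_δ hβ k]
    rw [force, norm_mul, norm_div, norm_mul, Complex.norm_I, norm_phase, Complex.norm_real,
      Real.norm_eq_abs, S.abs_lam hβ, one_mul, ← mul_assoc]
    refine mul_le_of_le_one_left (norm_nonneg _) ?_
    rw [mul_one_div, div_le_one hδ]
    exact S.le_δ k
  rw [Real.rpow_add hw]
  have h1 := pow_le_pow_left₀ (by positivity) (key true) 2
  have h2 := pow_le_pow_left₀ (by positivity) (key false) 2
  calc (S.w k ^ s * S.w k ^ β) ^ 2 * (‖S.force t q (true, k)‖ ^ 2 + ‖S.force t q (false, k)‖ ^ 2)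
      = (S.w k ^ s) ^ 2 * ((S.w k ^ β * ‖S.force t q (true, k)‖) ^ 2
          + (S.w k ^ β * ‖S.force t q (false, k)‖) ^ 2) := by ring
    _ ≤ (S.w k ^ s) ^ 2 * (‖S.anal q k‖ ^ 2 + ‖S.anal q k‖ ^ 2) := by gcongr
    _ ≤ _ := by nlinarith [mul_nonneg (sq_nonneg (S.w k ^ s)) (sq_nonneg ‖S.anal q k‖)]

lemma hasDerivAt_force {q : ℝ → P → ℂ} {q' : P → ℂ} {t : ℝ} (h : HasDerivAt q q' t) :
    HasDerivAt (fun t => S.force t (q t)) (S.force t q' - S.lamMul (S.force t (q t))) t := by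
  rw [hasDerivAt_pi]
  intro j
  have h1 := hasDerivAt_pi.1 (S.hasDerivAt_anal h) j.2
  refine ((((S.hasDerivAt_phase_neg t j).const_mul Complex.I).div_const _).mul h1).congr_deriv ?_
  simp only [Pi.sub_apply, force, lamMul]
  ring

/-- The forcing leaves `u` unchanged to first order. -/
lemma hnorm_uOf_force_le (hβ : 0 ≤ β) (t t' : ℝ) (q : P → ℂ) :
    S.hnorm 0 (S.uOf t (S.force t' q)) ≤ |t - t'| * S.hnorm 0 q := by
  rw [uOf, hnorm_synth]
  refine wnorm_le_of_le' S.one_le_w (abs_nonneg _) fun k => ?_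
  have hδ : 0 < S.δ k := by linarith [S.one_le_δ hβ k]
  have hδ' : (S.δ k : ℂ) ≠ 0 := by exact_mod_cast hδ.ne'
  -- With λ = ±δ the two components enter with opposite signs and conjugate phases. They combine to
  -- -sin(δ(t - t'))/δ, which is at most |t - t'| uniformly in the frequency.
  have e : (S.phase t (true, k) * S.force t' q (true, k)
      + S.phase t (false, k) * S.force t' q (false, k)) / 2
      = ((-(Real.sin (S.δ k * (t - t')) / S.δ k) : ℝ) : ℂ) * S.anal q k := by
    have h1 : S.phase t (true, k) * S.phase (-t') (true, k)
        = Complex.exp (Complex.I * ((S.δ k * (t - t') : ℝ) : ℂ)) := by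
      rw [← phase_add, phase]; simp [lam, sgn, sub_eq_add_neg]
    have h2 : S.phase t (false, k) * S.phase (-t') (false, k)
        = Complex.exp (-(Complex.I * ((S.δ k * (t - t') : ℝ) : ℂ))) := by
      rw [← phase_add, phase]; simp [lam, sgn, sub_eq_add_neg]
    have h3 : (Real.sin (S.δ k * (t - t')) : ℂ)
        = (Complex.exp (-(Complex.I * ((S.δ k * (t - t') : ℝ) : ℂ)))
          - Complex.exp (Complex.I * ((S.δ k * (t - t') : ℝ) : ℂ))) * Complex.I / 2 := by
      rw [Complex.ofReal_sin, Complex.sin]; ring_nf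
    rw [Complex.ofReal_neg, Complex.ofReal_div, h3, ← h1, ← h2]
    simp only [force, lam, sgn, cond_true, cond_false]
    push_cast
    field_simp
    ring
  rw [e, norm_mul, Complex.norm_real]
  refine mul_le_mul_of_nonneg_right ?_ (norm_nonneg _)
  rw [norm_neg, norm_div, Real.norm_eq_abs, Real.norm_eq_abs, abs_of_pos hδ, div_le_iff₀ hδ]
  refine (Real.abs_sin_le_abs).trans ?_
  rw [abs_mul, abs_of_pos hδ, mul_comm]

/-! ### Lipschitz and Taylor estimates for the twisted nonlinearity -/

lemma norm_uOf_le (hK : ∑ k, S.w k ^ (-(2 * σ)) ≤ K) (t : ℝ) (Ψ : Bool × G → ℂ) (p : P) :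
    ‖S.uOf t Ψ p‖ ≤ √K * S.pnorm σ Ψ :=
  (S.norm_le_hnorm hK _ p).trans
    (mul_le_mul_of_nonneg_left (S.hnorm_uOf_le _ _ _) (Real.sqrt_nonneg _))

lemma pnorm_force_le' (hβ : 0 ≤ β) (s t : ℝ) (q : P → ℂ) :
    S.pnorm s (S.force t q) ≤ 2 * S.hnorm s q :=
  (S.pnorm_mono (by linarith) _).trans (S.pnorm_force_le hβ s t q)

lemma pnorm_force_β_le (hβ : 0 ≤ β) (t : ℝ) (q : P → ℂ) :
    S.pnorm β (S.force t q) ≤ 2 * S.hnorm 0 q := by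
  simpa using S.pnorm_force_le hβ 0 t q

lemma pnorm_nl_le (hβ : 0 ≤ β) (hK : ∑ k, S.w k ^ (-(2 * σ)) ≤ K) (hσ : 0 ≤ σ) {s : ℝ}
    (hs : σ ≤ s) {F : ℂ → ℂ} (hF : ExpMajorized F) {R : ℝ} (t : ℝ) {Ψ : Bool × G → ℂ}
    (hΨ : S.pnorm s Ψ ≤ R) : S.pnorm s (S.nl F t Ψ) ≤ 2 * Real.exp (algC K s * R) :=
  (S.pnorm_force_le' hβ s t _).trans (mul_le_mul_of_nonneg_left
    (S.hnorm_comp_le hK hσ hs hF ((S.hnorm_uOf_le _ _ _).trans hΨ)) (by norm_num))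

lemma pnorm_nl_sub_le (hβ : 0 ≤ β) (hK : ∑ k, S.w k ^ (-(2 * σ)) ≤ K) (hσ : 0 ≤ σ) {s : ℝ}
    (hs : σ ≤ s) {F F' : ℂ → ℂ} (hd : ∀ z, HasDerivAt F (F' z) z) (hF' : ExpMajorized F')
    {R : ℝ} (t : ℝ) {Ψ Φ : Bool × G → ℂ} (hΨ : S.pnorm s Ψ ≤ R) (hΦ : S.pnorm s Φ ≤ R) :
    S.pnorm s (S.nl F t Ψ - S.nl F t Φ)
      ≤ 2 * (algC K s * Real.exp (algC K s * R)) * S.pnorm s (Ψ - Φ) := by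
  have hA := one_le_algC K s
  rw [nl, nl, ← S.force_sub]
  refine (S.pnorm_force_le' hβ s t _).trans ?_
  rw [mul_assoc]
  refine mul_le_mul_of_nonneg_left ?_ (by norm_num)
  refine (S.hnorm_comp_sub_le hK hσ hs hd hF' ((S.hnorm_uOf_le _ t _).trans hΨ)
    ((S.hnorm_uOf_le _ t _).trans hΦ)).trans ?_
  rw [← uOf_sub]
  gcongr
  exact S.hnorm_uOf_le _ _ _

/-- The nonlinearity sees Ψ only through u. Keeping the difference of the functions u on the right,
instead of the norm of Ψ - Φ, is what lets the second-order smallness of the drift of u be used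
inside a time step. -/
lemma pnorm_β_nl_sub_le_uOf (hβ : 0 ≤ β) (hK : ∑ k, S.w k ^ (-(2 * σ)) ≤ K) {F F' : ℂ → ℂ}
    (hd : ∀ z, HasDerivAt F (F' z) z) (hF' : ExpMajorized F') {R : ℝ} (t : ℝ)
    {Ψ Φ : Bool × G → ℂ} (hΨ : S.pnorm σ Ψ ≤ R) (hΦ : S.pnorm σ Φ ≤ R) :
    S.pnorm β (S.nl F t Ψ - S.nl F t Φ)
      ≤ 2 * Real.exp (√K * R) * S.hnorm 0 (S.uOf t (Ψ - Φ)) := by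
  rw [nl, nl, ← S.force_sub, mul_assoc, uOf_sub]
  refine (S.pnorm_force_β_le hβ t _).trans ?_
  refine mul_le_mul_of_nonneg_left ?_ (by norm_num)
  refine S.hnorm_zero_comp_sub_le hd hF' (fun p => ?_) (fun p => ?_)
  · exact (S.norm_uOf_le hK t Ψ p).trans (by gcongr)
  · exact (S.norm_uOf_le hK t Φ p).trans (by gcongr)

/-- The time derivative of the twisted nonlinearity with frozen `Ψ`. -/
def nlDeriv (F F' : ℂ → ℂ) (t : ℝ) (Ψ : Bool × G → ℂ) : Bool × G → ℂ :=
  S.force t ((fun p => F' (S.uOf t Ψ p)) * S.uOf t (S.lamMul Ψ)) - S.lamMul (S.nl F t Ψ)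

lemma hasDerivAt_comp_uOf {F F' : ℂ → ℂ} (hd : ∀ z, HasDerivAt F (F' z) z) (t : ℝ)
    (Ψ : Bool × G → ℂ) : HasDerivAt (fun t p => F (S.uOf t Ψ p))
      ((fun p => F' (S.uOf t Ψ p)) * S.uOf t (S.lamMul Ψ)) t := by
  rw [hasDerivAt_pi]
  intro p
  exact (hd _).comp t (hasDerivAt_pi.1 (S.hasDerivAt_uOf t Ψ) p)

lemma hasDerivAt_nl {F F' : ℂ → ℂ} (hd : ∀ z, HasDerivAt F (F' z) z) (t : ℝ)
    (Ψ : Bool × G → ℂ) : HasDerivAt (fun t => S.nl F t Ψ) (S.nlDeriv F F' t Ψ) t :=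
  S.hasDerivAt_force (S.hasDerivAt_comp_uOf hd t Ψ)

/-- A time derivative falls either on u, costing β derivatives that Ψ has to spare, or on the phase
of the forcing, where the gain of β from dividing by λ pays for it. -/
lemma pnorm_nlDeriv_le (hβ : 0 ≤ β) (hK : ∑ k, S.w k ^ (-(2 * σ)) ≤ K) (hσ : 0 ≤ σ) {s m : ℝ}
    (hs : σ ≤ s) (hsm : s ≤ m) {F F' : ℂ → ℂ} (hF : ExpMajorized F) (hF' : ExpMajorized F')
    {R : ℝ} (t : ℝ) {Ψ : Bool × G → ℂ} (hΨ : S.pnorm (m + β) Ψ ≤ R) :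
    S.pnorm s (S.nlDeriv F F' t Ψ)
      ≤ 2 * (algC K m * (Real.exp (algC K m * R) * (2 * R))) + 4 * Real.exp (algC K m * R) := by
  have hA := one_le_algC K m
  have hm : σ ≤ m := hs.trans hsm
  have hΨm : S.pnorm m Ψ ≤ R := (S.pnorm_mono (by linarith) _).trans hΨ
  have h1 : S.hnorm m (S.uOf t (S.lamMul Ψ)) ≤ 2 * R :=
    (S.hnorm_uOf_le _ _ _).trans ((S.pnorm_lamMul_le hβ m Ψ).trans (by gcongr))
  have h2 := S.hnorm_comp_le hK hσ hm hF' ((S.hnorm_uOf_le m t Ψ).trans hΨm)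
  have h3 := S.hnorm_comp_le hK hσ hm hF ((S.hnorm_uOf_le m t Ψ).trans hΨm)
  refine (S.pnorm_sub_le _ _ _).trans (add_le_add ?_ ?_)
  · refine (S.pnorm_mono hsm _).trans ((S.pnorm_force_le' hβ m t _).trans ?_)
    refine mul_le_mul_of_nonneg_left ((S.hnorm_mul_le' hK hσ hm _ _).trans ?_) (by norm_num)
    have := S.hnorm_nonneg m (S.uOf t (S.lamMul Ψ))
    gcongr
  · refine (S.pnorm_lamMul_le hβ s _).trans ?_
    have := S.pnorm_force_le hβ s t fun p => F (S.uOf t Ψ p)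
    have h4 := S.hnorm_mono hsm fun p => F (S.uOf t Ψ p)
    rw [nl]; linarith

/-- First-order variation in time. -/
lemma pnorm_nl_time_sub_le (hβ : 0 ≤ β) (hK : ∑ k, S.w k ^ (-(2 * σ)) ≤ K) (hσ : 0 ≤ σ)
    {s m : ℝ} (hs : σ ≤ s) (hsm : s ≤ m) {F F' : ℂ → ℂ} (hd : ∀ z, HasDerivAt F (F' z) z)
    (hF : ExpMajorized F) (hF' : ExpMajorized F') {R : ℝ} (t t' : ℝ) {Ψ : Bool × G → ℂ}
    (hΨ : S.pnorm (m + β) Ψ ≤ R) :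
    S.pnorm s (S.nl F t Ψ - S.nl F t' Ψ)
      ≤ (2 * (algC K m * (Real.exp (algC K m * R) * (2 * R))) + 4 * Real.exp (algC K m * R))
        * |t - t'| := by
  wlog h : t' ≤ t generalizing t t'
  · have := this t' t (le_of_not_ge h)
    rwa [pnorm, wnorm_sub_comm, abs_sub_comm] at this
  rw [abs_of_nonneg (sub_nonneg.2 h)]
  exact wnorm_sub_le_of_deriv (F := fun t => S.nl F t Ψ) h
    (fun r _ => (S.hasDerivAt_nl hd r Ψ).continuousAt.continuousWithinAt)
    (fun r _ => S.hasDerivAt_nl hd r Ψ)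
    (fun r _ => S.pnorm_nlDeriv_le hβ hK hσ hs hsm hF hF' r hΨ)

end GridSystem

end NSFSGE

/-! ### Second-order expansion in time of the twisted nonlinearity -/

namespace NSFSGE

lemma wnorm_sub_le_of_deriv_uIcc {ι : Type} [Fintype ι] {W : ι → ℝ} {s : ℝ}
    {F F' : ℝ → ι → ℂ} {x y C : ℝ} (hd : ∀ t, HasDerivAt F (F' t) t)
    (hb : ∀ t ∈ Set.uIcc x y, wnorm W s (F' t) ≤ C) :
    wnorm W s (F y - F x) ≤ C * |y - x| := by
  have hc : ∀ I, ContinuousOn F I := fun I t _ => (hd t).continuousAt.continuousWithinAt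
  rcases le_total x y with h | h
  · rw [abs_of_nonneg (sub_nonneg.2 h)]
    exact wnorm_sub_le_of_deriv h (hc _) (fun t _ => hd t) fun t ht =>
      hb t (Set.uIcc_of_le h ▸ Set.Ioo_subset_Icc_self ht)
  · rw [abs_sub_comm, abs_of_nonneg (sub_nonneg.2 h), wnorm_sub_comm]
    exact wnorm_sub_le_of_deriv h (hc _) (fun t _ => hd t) fun t ht =>
      hb t (Set.uIcc_of_ge h ▸ Set.Ioo_subset_Icc_self ht)

namespace GridSystem

variable {G P : Type} [AddCommGroup G] [Fintype G] [Fintype P] {β : ℝ} (S : GridSystem G P β)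
variable {K σ : ℝ}

lemma hnorm_zero_mul_le {f g : P → ℂ} {B : ℝ} (hB : 0 ≤ B) (h : ∀ p, ‖f p‖ ≤ B) :
    S.hnorm 0 (f * g) ≤ B * S.hnorm 0 g :=
  S.hnorm_zero_le_of_le hB fun p => by
    rw [Pi.mul_apply, norm_mul]; exact mul_le_mul_of_nonneg_right (h p) (norm_nonneg _)

/-- `lamMul` as a linear map. -/
def lamMulL : (Bool × G → ℂ) →ₗ[ℂ] (Bool × G → ℂ) where
  toFun := S.lamMul
  map_add' f g := by ext j; simp [lamMul, mul_add]
  map_smul' r g := by ext j; simp [lamMul]; ring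

lemma hasDerivAt_lamMul {f : ℝ → Bool × G → ℂ} {f' : Bool × G → ℂ} {t : ℝ}
    (h : HasDerivAt f f' t) : HasDerivAt (fun t => S.lamMul (f t)) (S.lamMul f') t :=
  (S.lamMulL.restrictScalars ℝ).toContinuousLinearMap.hasFDerivAt.comp_hasDerivAt t h

/-- The second time derivative of `t ↦ F(u)` with frozen twisted variables. -/
def compDeriv2 (F' F'' : ℂ → ℂ) (t : ℝ) (Ψ : Bool × G → ℂ) : P → ℂ :=
  (fun p => F'' (S.uOf t Ψ p)) * S.uOf t (S.lamMul Ψ) * S.uOf t (S.lamMul Ψ)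
    + (fun p => F' (S.uOf t Ψ p)) * S.uOf t (S.lamMul (S.lamMul Ψ))

/-- The second time derivative of the twisted nonlinearity. -/
def nlDeriv2 (F F' F'' : ℂ → ℂ) (t : ℝ) (Ψ : Bool × G → ℂ) : Bool × G → ℂ :=
  let q₁ := (fun p => F' (S.uOf t Ψ p)) * S.uOf t (S.lamMul Ψ)
  (S.force t (S.compDeriv2 F' F'' t Ψ) - S.lamMul (S.force t q₁))
    - S.lamMul (S.force t q₁ - S.lamMul (S.nl F t Ψ))

lemma hasDerivAt_nlDeriv {F F' F'' : ℂ → ℂ} (hd : ∀ z, HasDerivAt F (F' z) z)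
    (hd' : ∀ z, HasDerivAt F' (F'' z) z) (t : ℝ) (Ψ : Bool × G → ℂ) :
    HasDerivAt (fun t => S.nlDeriv F F' t Ψ) (S.nlDeriv2 F F' F'' t Ψ) t :=
  (S.hasDerivAt_force ((S.hasDerivAt_comp_uOf hd' t Ψ).mul (S.hasDerivAt_uOf t (S.lamMul Ψ)))).sub
    (S.hasDerivAt_lamMul (S.hasDerivAt_nl hd t Ψ))

/-- The bound for the second time derivative of the twisted nonlinearity. -/
def taylorC (β K m R : ℝ) : ℝ :=
  2 * (Real.exp (√K * R) * (√K * (2 * R)) * (2 * R) + Real.exp (√K * R) * (4 * R))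
    + 8 * (algC K m * (Real.exp (algC K m * R) * (2 * R)))
    + 8 * Real.exp (algC K (m + β) * R)

/-- Derivative count in the norm of index β: the second derivative of F(u) is needed only in L²,
since the forcing supplies β. There two factors λ on Ψ cost 2β ≤ m + β. The mixed term needs an H^β
bound, read off in the algebra H^m, and the term with both derivatives on the phase needs F(u) in
H^{2β}, read off in H^{m+β}. -/
lemma pnorm_nlDeriv2_le (hβ : 0 ≤ β) (hK : ∑ k, S.w k ^ (-(2 * σ)) ≤ K) (hσ : 0 ≤ σ) {m : ℝ}
    (hm : σ ≤ m) (hβm : β ≤ m) {F F' F'' : ℂ → ℂ} (hF : ExpMajorized F) (hF' : ExpMajorized F')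
    (hF'' : ExpMajorized F'') {R : ℝ} (t : ℝ) {Ψ : Bool × G → ℂ}
    (hΨ : S.pnorm (m + β) Ψ ≤ R) :
    S.pnorm β (S.nlDeriv2 F F' F'' t Ψ) ≤ taylorC β K m R := by
  have hA := one_le_algC K m
  have hR : 0 ≤ R := (S.pnorm_nonneg _ _).trans hΨ
  have hmono : ∀ r ≤ m + β, S.pnorm r Ψ ≤ R := fun r hr => (S.pnorm_mono hr _).trans hΨ
  have hmono1 : ∀ r ≤ m, S.pnorm r (S.lamMul Ψ) ≤ 2 * R := fun r hr =>
    (S.pnorm_lamMul_le hβ r Ψ).trans (by have := hmono (r + β) (by linarith); linarith)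
  have hU2 : S.hnorm 0 (S.uOf t (S.lamMul (S.lamMul Ψ))) ≤ 4 * R := by
    refine (S.hnorm_uOf_le _ _ _).trans ((S.pnorm_lamMul_le hβ _ _).trans ?_)
    have := hmono1 (0 + β) (by linarith)
    linarith
  have hU1 : S.hnorm 0 (S.uOf t (S.lamMul Ψ)) ≤ 2 * R :=
    (S.hnorm_uOf_le _ _ _).trans (hmono1 0 (by linarith))
  have hU1m : S.hnorm m (S.uOf t (S.lamMul Ψ)) ≤ 2 * R :=
    (S.hnorm_uOf_le _ _ _).trans (hmono1 m le_rfl)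
  have hsK := Real.sqrt_nonneg K
  have hU0p : ∀ p, ‖S.uOf t Ψ p‖ ≤ √K * R := fun p =>
    (S.norm_uOf_le hK t Ψ p).trans (by have := hmono σ (by linarith); gcongr)
  have hU1p : ∀ p, ‖S.uOf t (S.lamMul Ψ) p‖ ≤ √K * (2 * R) := fun p =>
    (S.norm_uOf_le hK t _ p).trans (by have := hmono1 σ hm; gcongr)
  have hF'p : ∀ p, ‖F' (S.uOf t Ψ p)‖ ≤ Real.exp (√K * R) := fun p =>
    (hF'.norm_le_exp _).trans (Real.exp_le_exp.2 (hU0p p))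
  have hF''p : ∀ p, ‖F'' (S.uOf t Ψ p)‖ ≤ Real.exp (√K * R) := fun p =>
    (hF''.norm_le_exp _).trans (Real.exp_le_exp.2 (hU0p p))
  have hq2 : S.hnorm 0 (S.compDeriv2 F' F'' t Ψ)
      ≤ Real.exp (√K * R) * (√K * (2 * R)) * (2 * R) + Real.exp (√K * R) * (4 * R) := by
    refine (S.hnorm_add_le _ _ _).trans (add_le_add ?_ ?_)
    · refine (S.hnorm_zero_mul_le (B := Real.exp (√K * R) * (√K * (2 * R))) (by positivity)
        fun p => ?_).trans (by gcongr)
      rw [Pi.mul_apply, norm_mul]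
      exact mul_le_mul (hF''p p) (hU1p p) (norm_nonneg _) (by positivity)
    · exact (S.hnorm_zero_mul_le (Real.exp_pos _).le hF'p).trans (by gcongr)
  have hq1 : S.hnorm β ((fun p => F' (S.uOf t Ψ p)) * S.uOf t (S.lamMul Ψ))
      ≤ algC K m * (Real.exp (algC K m * R) * (2 * R)) := by
    refine (S.hnorm_mono hβm _).trans ((S.hnorm_mul_le' hK hσ hm _ _).trans ?_)
    have h := S.hnorm_comp_le hK hσ hm hF' ((S.hnorm_uOf_le m t Ψ).trans (hmono m (by linarith)))
    have := S.hnorm_nonneg m (S.uOf t (S.lamMul Ψ))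
    gcongr
  have hq0 : S.hnorm (β + β) (fun p => F (S.uOf t Ψ p)) ≤ Real.exp (algC K (m + β) * R) :=
    (S.hnorm_mono (by linarith) _).trans
      (S.hnorm_comp_le hK hσ (by linarith) hF ((S.hnorm_uOf_le _ t Ψ).trans hΨ))
  have h1 := S.pnorm_force_β_le hβ t (S.compDeriv2 F' F'' t Ψ)
  have h2 := (S.pnorm_lamMul_le hβ β (S.force t
    ((fun p => F' (S.uOf t Ψ p)) * S.uOf t (S.lamMul Ψ)))).trans
    (mul_le_mul_of_nonneg_left (S.pnorm_force_le hβ β t _) (by norm_num))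
  have h3 := (S.pnorm_lamMul_le hβ (β + β) (S.nl F t Ψ)).trans
    (mul_le_mul_of_nonneg_left (S.pnorm_force_le hβ (β + β) t _) (by norm_num))
  have h4 := S.pnorm_lamMul_le hβ β (S.lamMul (S.nl F t Ψ))
  have e : S.lamMul (S.force t ((fun p => F' (S.uOf t Ψ p)) * S.uOf t (S.lamMul Ψ))
      - S.lamMul (S.nl F t Ψ)) = S.lamMul (S.force t ((fun p => F' (S.uOf t Ψ p))
        * S.uOf t (S.lamMul Ψ))) - S.lamMul (S.lamMul (S.nl F t Ψ)) :=
    S.lamMulL.map_sub _ _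
  have h5 := S.pnorm_sub_le β (S.force t (S.compDeriv2 F' F'' t Ψ))
    (S.lamMul (S.force t ((fun p => F' (S.uOf t Ψ p)) * S.uOf t (S.lamMul Ψ))))
  have h6 := S.pnorm_sub_le β (S.lamMul (S.force t ((fun p => F' (S.uOf t Ψ p))
    * S.uOf t (S.lamMul Ψ)))) (S.lamMul (S.lamMul (S.nl F t Ψ)))
  rw [nlDeriv2]
  refine (S.pnorm_sub_le _ _ _).trans ?_
  rw [e, taylorC]
  linarith

/-- Second-order Taylor expansion in time of the twisted nonlinearity. -/
lemma pnorm_nl_taylor_le (hβ : 0 ≤ β) (hK : ∑ k, S.w k ^ (-(2 * σ)) ≤ K) (hσ : 0 ≤ σ) {m : ℝ}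
    (hm : σ ≤ m) (hβm : β ≤ m) {F F' F'' : ℂ → ℂ} (hd : ∀ z, HasDerivAt F (F' z) z)
    (hd' : ∀ z, HasDerivAt F' (F'' z) z) (hF : ExpMajorized F) (hF' : ExpMajorized F')
    (hF'' : ExpMajorized F'') {R : ℝ} (t t₀ : ℝ) {Ψ : Bool × G → ℂ}
    (hΨ : S.pnorm (m + β) Ψ ≤ R) :
    S.pnorm β (S.nl F t Ψ - S.nl F t₀ Ψ - (t - t₀) • S.nlDeriv F F' t₀ Ψ)
      ≤ taylorC β K m R * |t - t₀| ^ 2 := by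
  have h1 : ∀ r, S.pnorm β (S.nlDeriv F F' r Ψ - S.nlDeriv F F' t₀ Ψ)
      ≤ taylorC β K m R * |r - t₀| := fun r =>
    wnorm_sub_le_of_deriv_uIcc (F := fun r => S.nlDeriv F F' r Ψ)
      (F' := fun r => S.nlDeriv2 F F' F'' r Ψ) (fun r => S.hasDerivAt_nlDeriv hd hd' r Ψ)
      fun r _ => S.pnorm_nlDeriv2_le hβ hK hσ hm hβm hF hF' hF'' r hΨ
  have hC : 0 ≤ taylorC β K m R :=
    (S.pnorm_nonneg _ _).trans (S.pnorm_nlDeriv2_le hβ hK hσ hm hβm hF hF' hF'' t hΨ)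
  obtain ⟨D, hD⟩ : ∃ D, D = S.nlDeriv F F' t₀ Ψ := ⟨_, rfl⟩
  rw [← hD] at h1 ⊢
  have h3 : ∀ r, HasDerivAt (fun r : ℝ => (r - t₀) • D) D r := fun r => by
    have h := ((hasDerivAt_id' r).sub_const t₀).smul_const D
    rwa [one_smul] at h
  -- The mean value inequality is applied a second time, after subtraction of the linear part. The
  -- derivative is at most C|t - t₀| on the whole segment, which is why no factor 1/2 appears.
  have h4 : ∀ r, HasDerivAt (fun r => S.nl F r Ψ - (r - t₀) • D) (S.nlDeriv F F' r Ψ - D) r :=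
    fun r => (S.hasDerivAt_nl hd r Ψ).fun_sub (h3 r)
  have h2 := wnorm_sub_le_of_deriv_uIcc (W := S.wJ) (s := β) (x := t₀) (y := t)
    (C := taylorC β K m R * |t - t₀|) h4
    (fun r hr => (h1 r).trans (mul_le_mul_of_nonneg_left (Set.abs_sub_left_of_mem_uIcc hr) hC))
  rw [pow_two, ← mul_assoc]
  refine le_trans (le_of_eq ?_) h2
  rw [pnorm]; congr 1; simp; abel

end GridSystem

end NSFSGE

namespace NSFSGE

/-! ### The error kernel of the midpoint rule for exponentials -/

/-- The integral `∫₀ˢ exp (i θ r) dr`. -/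
def expInt (s θ : ℝ) : ℂ :=
  if θ = 0 then (s : ℂ) else (Complex.exp (Complex.I * ((θ * s : ℝ) : ℂ)) - 1) / (Complex.I * θ)

/-- The midpoint error for `exp (i θ s)` over one step, divided by the increment of the
exponential. -/
def midKer (τ θ : ℝ) : ℂ :=
  ((τ * (1 - Real.sinc (θ * τ / 2)) / (2 * Real.sin (θ * τ / 2)) : ℝ) : ℂ) / Complex.I

lemma hasDerivAt_exp_mul_I (θ t : ℝ) :
    HasDerivAt (fun t : ℝ => Complex.exp (Complex.I * ((θ * t : ℝ) : ℂ)))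
      (Complex.I * θ * Complex.exp (Complex.I * ((θ * t : ℝ) : ℂ))) t := by
  have h : HasDerivAt (fun t : ℝ => Complex.I * ((θ * t : ℝ) : ℂ)) (Complex.I * (θ : ℂ)) t := by
    have := ((Complex.ofRealCLM.hasDerivAt (x := t)).const_mul (Complex.I * (θ : ℂ)))
    simpa [mul_assoc] using this
  simpa [mul_comm] using h.cexp

lemma hasDerivAt_expInt (s θ : ℝ) :
    HasDerivAt (fun s => expInt s θ) (Complex.exp (Complex.I * ((θ * s : ℝ) : ℂ))) s := by
  unfold expInt
  split_ifs with h
  · subst h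
    exact (Complex.ofRealCLM.hasDerivAt (x := s)).congr_deriv (by simp)
  · have h0 : (θ : ℂ) ≠ 0 := by exact_mod_cast h
    refine (((hasDerivAt_exp_mul_I θ s).sub_const 1).div_const _).congr_deriv ?_
    field_simp [Complex.I_ne_zero]

/-- Both bounds come from y - y³/4 < sin y < y for 0 < y ≤ 1 and parity. -/
lemma sin_bounds {y : ℝ} (h0 : y ≠ 0) (h1 : |y| ≤ 1) :
    |1 - Real.sinc y| ≤ y ^ 2 / 4 ∧ 3 / 4 * |y| ≤ |Real.sin y| := by
  wlog hy : 0 < y generalizing y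
  · have := this (y := -y) (by simpa using h0) (by simpa using h1)
      (by rcases lt_or_gt_of_ne h0 with h | h <;> [linarith; exact absurd h hy])
    simpa [Real.sinc_neg] using this
  rw [abs_of_pos hy] at h1
  have h2 := Real.sin_gt_sub_cube hy
  have h3 := Real.sin_lt hy
  have h4 : 0 < Real.sin y := by nlinarith [pow_le_one₀ (n := 2) hy.le h1]
  rw [Real.sinc_of_ne_zero h0, abs_of_pos hy, abs_of_pos h4]
  refine ⟨?_, by nlinarith [pow_le_one₀ (n := 2) hy.le h1]⟩
  have h5 : Real.sin y / y ≤ 1 := (div_le_one hy).2 h3.le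
  rw [abs_of_nonneg (by linarith)]
  have h6 : 1 - y ^ 2 / 4 ≤ Real.sin y / y := by rw [le_div_iff₀ hy]; nlinarith
  linarith

/-- With y = θτ/2 the numerator 1 - sinc y is quadratic in y and the denominator sin y is linear, so
the quotient is O(y) and vanishes with θ. The condition |y| ≤ 1 keeps the sine away from its other
zeros. -/
lemma norm_midKer_le {τ θ : ℝ} (hτ : 0 ≤ τ) (h : |θ| * τ ≤ 2) :
    ‖midKer τ θ‖ ≤ τ ^ 2 * |θ| := by
  rw [midKer, norm_div, Complex.norm_I, div_one, Complex.norm_real, Real.norm_eq_abs]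
  -- Here the quotient is 0/0, which has the value 0; this agrees with the limit as θ → 0.
  by_cases hy : θ * τ / 2 = 0
  · simp [hy]; positivity
  have hy1 : |θ * τ / 2| ≤ 1 := by
    rw [abs_div, abs_mul, abs_of_nonneg hτ]; norm_num; linarith
  obtain ⟨h1, h2⟩ := sin_bounds hy hy1
  have hpos : 0 < |θ * τ / 2| := abs_pos.2 hy
  have hs : 0 < |Real.sin (θ * τ / 2)| := by linarith [mul_pos (by norm_num : (0:ℝ) < 3/4) hpos]
  rw [abs_div, abs_mul, abs_mul, abs_of_nonneg hτ, abs_two, div_le_iff₀ (by positivity)]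
  have h3 : τ ^ 2 * |θ| = τ * (2 * |θ * τ / 2|) := by
    rw [abs_div, abs_mul, abs_of_nonneg hτ, abs_two]; ring
  rw [h3, mul_assoc]
  refine mul_le_mul_of_nonneg_left ?_ hτ
  rw [← sq_abs] at h1
  nlinarith

/-- Relative to the midpoint phase e^{iθ(t+τ/2)}, the midpoint error is τ(1 - sinc(θτ/2)) and the
increment of the exponential is 2i sin(θτ/2). `midKer` is the quotient of the two, so a quadrature
error becomes a discrete derivative. -/
lemma midKer_spec {τ θ : ℝ} (t : ℝ) (hτ : 0 < τ) (h : |θ| * τ ≤ 2) :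
    (τ : ℂ) * Complex.exp (Complex.I * ((θ * (t + τ / 2) : ℝ) : ℂ))
        - expInt τ θ * Complex.exp (Complex.I * ((θ * t : ℝ) : ℂ))
      = midKer τ θ * Complex.exp (Complex.I * ((θ * (t + τ) : ℝ) : ℂ))
        - midKer τ θ * Complex.exp (Complex.I * ((θ * t : ℝ) : ℂ)) := by
  by_cases hθ : θ = 0
  · subst hθ; simp [expInt]
  have hy : θ * τ / 2 ≠ 0 := by positivity
  have hy1 : |θ * τ / 2| ≤ 1 := by
    rw [abs_div, abs_mul, abs_of_pos hτ]; norm_num; linarith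
  have hs : Real.sin (θ * τ / 2) ≠ 0 := by
    have := (sin_bounds hy hy1).2
    have hpos : 0 < |θ * τ / 2| := abs_pos.2 hy
    rw [← abs_pos]; linarith [mul_pos (by norm_num : (0:ℝ) < 3/4) hpos]
  have hs' : (Real.sin (θ * τ / 2) : ℂ) ≠ 0 := by exact_mod_cast hs
  have hθ' : (θ : ℂ) ≠ 0 := by exact_mod_cast hθ
  have hτ' : (τ : ℂ) ≠ 0 := by exact_mod_cast hτ.ne'
  set E := Complex.exp (Complex.I * ((θ * τ / 2 : ℝ) : ℂ)) with hE
  have e1 : Complex.exp (Complex.I * ((θ * (t + τ / 2) : ℝ) : ℂ))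
      = Complex.exp (Complex.I * ((θ * t : ℝ) : ℂ)) * E := by
    rw [hE, ← Complex.exp_add]; congr 1; push_cast; ring
  have e2 : Complex.exp (Complex.I * ((θ * τ : ℝ) : ℂ)) = E * E := by
    rw [hE, ← Complex.exp_add]; congr 1; push_cast; ring
  have e3 : Complex.exp (Complex.I * ((θ * (t + τ) : ℝ) : ℂ))
      = Complex.exp (Complex.I * ((θ * t : ℝ) : ℂ)) * (E * E) := by
    rw [← e2, ← Complex.exp_add]; congr 1; push_cast; ring
  have hinv : E * Complex.exp (-(Complex.I * ((θ * τ / 2 : ℝ) : ℂ))) = 1 := by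
    rw [hE, ← Complex.exp_add, add_neg_cancel, Complex.exp_zero]
  have e4 : E * E - 1 = 2 * Complex.I * (Real.sin (θ * τ / 2) : ℂ) * E := by
    have h3 : (Real.sin (θ * τ / 2) : ℂ)
        = (Complex.exp (-(Complex.I * ((θ * τ / 2 : ℝ) : ℂ))) - E) * Complex.I / 2 := by
      rw [Complex.ofReal_sin, Complex.sin, hE]; ring_nf
    rw [h3]
    linear_combination hinv - (E * Complex.exp (-(Complex.I * ((θ * τ / 2 : ℝ) : ℂ)))
      - E * E) * Complex.I_sq
  rw [expInt, if_neg hθ, e1, e3, e2, e4, midKer, Real.sinc_of_ne_zero hy]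
  have e5 : Complex.exp (Complex.I * ((θ * t : ℝ) : ℂ)) * (E * E)
      = Complex.exp (Complex.I * ((θ * t : ℝ) : ℂ))
        + Complex.exp (Complex.I * ((θ * t : ℝ) : ℂ))
          * (2 * Complex.I * (Real.sin (θ * τ / 2) : ℂ) * E) := by
    rw [← e4]; ring
  rw [e5]
  generalize Real.sin (θ * τ / 2) = sn at hs hs' ⊢
  push_cast
  field_simp
  ring

namespace GridSystem

variable {G P : Type} [AddCommGroup G] [Fintype G] [Fintype P] {β : ℝ} (S : GridSystem G P β)
variable {K σ : ℝ}

/-! ### Trilinear operators with resonance phases -/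

/-- The grid function `∑ a_j e_j` over both components. -/
def jsynth (a : Bool × G → ℂ) (p : P) : ℂ := ∑ j, a j * S.e j.2 p

lemma jsynth_eq (a : Bool × G → ℂ) : S.jsynth a = (2 : ℂ) • S.uOf 0 a := by
  ext p
  simp only [jsynth, Pi.smul_apply, uOf, synth, phase_zero, Fintype.sum_prod_type, smul_eq_mul,
    Finset.mul_sum]
  simp only [Fintype.sum_bool, ← Finset.sum_add_distrib]
  refine Finset.sum_congr rfl fun k _ => by ring

lemma uOf_eq_jsynth (t : ℝ) (Ψ : Bool × G → ℂ) :
    S.uOf t Ψ = S.jsynth fun j => S.phase t j * Ψ j / 2 := by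
  rw [jsynth_eq]; ext p
  simp only [Pi.smul_apply, uOf, synth, phase_zero, smul_eq_mul, Finset.mul_sum]
  refine Finset.sum_congr rfl fun k _ => by ring

lemma hnorm_jsynth_le (s : ℝ) (a : Bool × G → ℂ) : S.hnorm s (S.jsynth a) ≤ 2 * S.pnorm s a := by
  rw [jsynth_eq]
  refine (S.hnorm_smul s _ _).trans ?_
  rw [Complex.norm_ofNat]
  exact mul_le_mul_of_nonneg_left (S.hnorm_uOf_le _ _ _) (by norm_num)

lemma norm_jsynth_le (hK : ∑ k, S.w k ^ (-(2 * σ)) ≤ K) (a : Bool × G → ℂ) (p : P) :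
    ‖S.jsynth a p‖ ≤ 2 * (√K * S.pnorm σ a) := by
  rw [jsynth_eq, Pi.smul_apply, norm_smul, Complex.norm_ofNat]
  exact mul_le_mul_of_nonneg_left (S.norm_uOf_le hK _ _ _) (by norm_num)

lemma anal_jsynth_mul [DecidableEq G] (a b c : Bool × G → ℂ) (k : G) :
    S.anal (S.jsynth a * S.jsynth b * S.jsynth c) k
      = ∑ j₁, ∑ j₂, ∑ j₃, if j₁.2 + j₂.2 + j₃.2 = k then a j₁ * b j₂ * c j₃ else 0 := by
  have : S.jsynth a * S.jsynth b * S.jsynth c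
      = ∑ j₁, ∑ j₂, ∑ j₃, (a j₁ * b j₂ * c j₃) • S.e (j₁.2 + j₂.2 + j₃.2) := by
    ext p
    simp only [Pi.mul_apply, jsynth, Finset.sum_apply, Pi.smul_apply, smul_eq_mul, S.e_add]
    rw [Finset.sum_mul_sum, Finset.sum_mul]
    refine Finset.sum_congr rfl fun j₁ _ => ?_
    rw [Finset.sum_mul_sum]
    refine Finset.sum_congr rfl fun j₂ _ => Finset.sum_congr rfl fun j₃ _ => by ring
  rw [this]
  simp [anal_sum, anal_smul, S.anal_e]

/-- The resonance phase. -/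
def res (j₀ j₁ j₂ j₃ : Bool × G) : ℝ := S.lam j₁ + S.lam j₂ + S.lam j₃ - S.lam j₀

open Classical in
/-- The trilinear operator obtained from the twisted cubic nonlinearity by replacing the
exponential of the resonance phase by a function `χ` of it. -/
def tri (χ : ℝ → ℂ) (a b c : Bool × G → ℂ) (j₀ : Bool × G) : ℂ :=
  -(Complex.I / (48 * S.lam j₀)) * ∑ j₁, ∑ j₂, ∑ j₃, if j₁.2 + j₂.2 + j₃.2 = j₀.2 then
    χ (S.res j₀ j₁ j₂ j₃) * (a j₁ * b j₂ * c j₃) else 0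

/-- The three phases of the factors and the phase of the forcing multiply to e^{iθt}, where θ is the
resonance phase. The 48 in `tri` is 6·2³: the cubic coefficient 1/6 and one factor 1/2 from each u =
(φ₊ + φ₋)/2. -/
lemma nl_cube_eq_tri (t : ℝ) (Ψ : Bool × G → ℂ) :
    S.nl (fun z => -(1 / 6) * z ^ 3) t Ψ
      = S.tri (fun θ => Complex.exp (Complex.I * ((θ * t : ℝ) : ℂ))) Ψ Ψ Ψ := by
  classical
  ext j₀
  have e : (fun p => -(1 / 6) * (S.uOf t Ψ p) ^ 3)
      = (-(1 / 6) : ℂ) • (S.uOf t Ψ * S.uOf t Ψ * S.uOf t Ψ) := by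
    ext p; simp; ring
  rw [nl, force, e, S.anal_smul, uOf_eq_jsynth, Pi.smul_apply, S.anal_jsynth_mul, tri]
  simp only [smul_eq_mul, Finset.mul_sum]
  refine Finset.sum_congr rfl fun j₁ _ => Finset.sum_congr rfl fun j₂ _ =>
    Finset.sum_congr rfl fun j₃ _ => ?_
  split_ifs
  · have : Complex.exp (Complex.I * ((S.res j₀ j₁ j₂ j₃ * t : ℝ) : ℂ))
        = S.phase t j₁ * S.phase t j₂ * S.phase t j₃ * S.phase (-t) j₀ := by
      simp only [phase, ← Complex.exp_add, res]; congr 1; push_cast; ring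
    rw [this]; ring
  · simp

lemma tri_sub (χ : ℝ → ℂ) (a b : Bool × G → ℂ) :
    S.tri χ a a a - S.tri χ b b b
      = S.tri χ (a - b) a a + S.tri χ b (a - b) a + S.tri χ b b (a - b) := by
  ext j₀
  simp only [tri, Pi.sub_apply, Pi.add_apply, ← mul_sub, ← mul_add, ← Finset.sum_sub_distrib,
    ← Finset.sum_add_distrib]
  congr 1
  refine Finset.sum_congr rfl fun j₁ _ => Finset.sum_congr rfl fun j₂ _ =>
    Finset.sum_congr rfl fun j₃ _ => ?_
  split_ifs
  · ring
  · simp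

/-- Vectors supported on frequencies with `δ ≤ Λ`. -/
def IsLow (Λ : ℝ) (a : Bool × G → ℂ) : Prop := ∀ j, Λ < S.δ j.2 → a j = 0

/-- For β ≤ 1 the power w^β inherits subadditivity from w; the comparison of δ with w^β costs the
factor 2. -/
lemma δ_add_le (hβ : 0 ≤ β) (hβ1 : β ≤ 1) (k l j : G) :
    S.δ (k + l + j) ≤ 2 * (S.δ k + S.δ l + S.δ j) := by
  have h1 : S.w (k + l + j) ≤ S.w k + S.w l + S.w j := by
    linarith [S.w_add_le (k + l) j, S.w_add_le k l]
  have h2 : S.w (k + l + j) ^ β ≤ S.w k ^ β + S.w l ^ β + S.w j ^ β := by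
    refine (Real.rpow_le_rpow (S.w_pos _).le h1 hβ).trans ?_
    have := S.w_pos k
    have := S.w_pos l
    have := S.w_pos j
    refine (Real.rpow_add_le_add_rpow (by positivity) (by positivity) hβ hβ1).trans ?_
    have := Real.rpow_add_le_add_rpow (S.w_pos k).le (S.w_pos l).le hβ hβ1
    linarith
  linarith [S.δ_le (k + l + j), S.le_δ k, S.le_δ l, S.le_δ j]

lemma abs_res_le (hβ : 0 ≤ β) (hβ1 : β ≤ 1) {j₀ j₁ j₂ j₃ : Bool × G}
    (h : j₁.2 + j₂.2 + j₃.2 = j₀.2) :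
    |S.res j₀ j₁ j₂ j₃| ≤ 3 * (S.δ j₁.2 + S.δ j₂.2 + S.δ j₃.2) := by
  have h0 := S.δ_add_le hβ hβ1 j₁.2 j₂.2 j₃.2
  rw [h] at h0
  rw [res]
  have h1 := S.abs_lam hβ j₁
  have h2 := S.abs_lam hβ j₂
  have h3 := S.abs_lam hβ j₃
  have h4 := S.abs_lam hβ j₀
  calc _ ≤ |S.lam j₁ + S.lam j₂ + S.lam j₃| + |S.lam j₀| := abs_sub _ _
    _ ≤ |S.lam j₁| + |S.lam j₂| + |S.lam j₃| + |S.lam j₀| := by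
        gcongr; exact abs_add_three _ _ _
    _ ≤ _ := by linarith

/-- On inputs with δ ≤ Λ the resonance phases that occur are bounded by 3·3Λ, whatever the output
frequency is. -/
lemma tri_congr {χ χ' : ℝ → ℂ} {Λ : ℝ} (hβ : 0 ≤ β) (hβ1 : β ≤ 1)
    (h : ∀ θ, |θ| ≤ 9 * Λ → χ θ = χ' θ) {a b c : Bool × G → ℂ} (ha : S.IsLow Λ a)
    (hb : S.IsLow Λ b) (hc : S.IsLow Λ c) : S.tri χ a b c = S.tri χ' a b c := by
  ext j₀
  rw [tri, tri]
  congr 1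
  refine Finset.sum_congr rfl fun j₁ _ => Finset.sum_congr rfl fun j₂ _ =>
    Finset.sum_congr rfl fun j₃ _ => ?_
  split_ifs with hj
  · by_cases h1 : Λ < S.δ j₁.2
    · simp [ha j₁ h1]
    by_cases h2 : Λ < S.δ j₂.2
    · simp [hb j₂ h2]
    by_cases h3 : Λ < S.δ j₃.2
    · simp [hc j₃ h3]
    rw [h]
    linarith [S.abs_res_le hβ hβ1 hj]
  · rfl

/-- A trilinear operator losing one power of the resonance phase is bounded. -/
lemma pnorm_tri_le (hβ : 0 ≤ β) (hβ1 : β ≤ 1) (hK : ∑ k, S.w k ^ (-(2 * σ)) ≤ K)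
    (hβσ : β ≤ σ) {χ : ℝ → ℂ} {Λ L : ℝ} (hL : 0 ≤ L) (h : ∀ θ, |θ| ≤ 9 * Λ → ‖χ θ‖ ≤ L * |θ|)
    {a b c : Bool × G → ℂ} (ha : S.IsLow Λ a) (hb : S.IsLow Λ b) (hc : S.IsLow Λ c) :
    S.pnorm β (S.tri χ a b c)
      ≤ 6 * K * L * (S.pnorm σ a * S.pnorm σ b * S.pnorm σ c) := by
  classical
  have hK0 : 0 ≤ K := (Finset.sum_nonneg fun k _ => Real.rpow_nonneg (S.w_pos k).le _).trans hK
  -- The phase bound |θ| ≤ 3(δ₁ + δ₂ + δ₃) puts one δ on a single factor. That factor is measured in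
  -- L² and the two others in the sup norm; absolute values of coefficients make the products
  -- dominate.
  let A : (Bool × G → ℂ) → Bool × G → ℂ := fun x j => ((‖x j‖ : ℝ) : ℂ)
  let D : (Bool × G → ℂ) → Bool × G → ℂ := fun x j => ((S.δ j.2 * ‖x j‖ : ℝ) : ℂ)
  have hA : ∀ x, S.pnorm σ (A x) = S.pnorm σ x := fun x =>
    wnorm_congr_norm S.one_le_wJ fun j => by simp [A]
  have hD : ∀ x, S.pnorm 0 (D x) ≤ 2 * S.pnorm σ x := fun x => by
    refine (wnorm_le_of_le (r := β) (d := x) S.one_le_wJ zero_le_two fun j => ?_).trans ?_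
    · have hδ := S.one_le_δ hβ j.2
      simp only [D, Complex.norm_real, norm_mul, norm_norm]
      rw [Real.norm_of_nonneg (by linarith), ← mul_assoc]
      exact mul_le_mul_of_nonneg_right (S.δ_le j.2) (norm_nonneg _)
    · exact mul_le_mul_of_nonneg_left (S.pnorm_mono (by linarith) x) (by norm_num)
  have hprod : ∀ x y z, S.hnorm 0 (S.jsynth (A x) * S.jsynth (A y) * S.jsynth (D z))
      ≤ 16 * K * (S.pnorm σ x * S.pnorm σ y * S.pnorm σ z) := fun x y z => by
    have hx := S.pnorm_nonneg σ x
    have hy := S.pnorm_nonneg σ y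
    have hz := S.pnorm_nonneg σ z
    have hs := Real.sqrt_nonneg K
    refine (S.hnorm_zero_mul_le (B := 2 * (√K * S.pnorm σ x) * (2 * (√K * S.pnorm σ y)))
      (by positivity) fun p => ?_).trans ?_
    · rw [Pi.mul_apply, norm_mul]
      have h1 := S.norm_jsynth_le hK (A x) p
      have h2 := S.norm_jsynth_le hK (A y) p
      rw [hA] at h1 h2
      gcongr
    · have h3 := (S.hnorm_jsynth_le 0 (D z)).trans
        (mul_le_mul_of_nonneg_left (hD z) (by norm_num))
      calc _ ≤ 2 * (√K * S.pnorm σ x) * (2 * (√K * S.pnorm σ y)) * (2 * (2 * S.pnorm σ z)) := by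
            gcongr
        _ = 16 * (√K * √K) * (S.pnorm σ x * S.pnorm σ y * S.pnorm σ z) := by ring
        _ = _ := by rw [Real.mul_self_sqrt hK0]
  set q : P → ℂ := S.jsynth (D a) * S.jsynth (A b) * S.jsynth (A c)
    + S.jsynth (A a) * S.jsynth (D b) * S.jsynth (A c)
    + S.jsynth (A a) * S.jsynth (A b) * S.jsynth (D c) with hq
  have hqn : S.hnorm 0 q ≤ 48 * K * (S.pnorm σ a * S.pnorm σ b * S.pnorm σ c) := by
    have h1 := hprod b c a
    have h2 := hprod a c b
    have h3 := hprod a b c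
    rw [show S.jsynth (A b) * S.jsynth (A c) * S.jsynth (D a)
      = S.jsynth (D a) * S.jsynth (A b) * S.jsynth (A c) by ring] at h1
    rw [show S.jsynth (A a) * S.jsynth (A c) * S.jsynth (D b)
      = S.jsynth (A a) * S.jsynth (D b) * S.jsynth (A c) by ring] at h2
    have h4 := S.hnorm_add_le 0 (S.jsynth (D a) * S.jsynth (A b) * S.jsynth (A c)
      + S.jsynth (A a) * S.jsynth (D b) * S.jsynth (A c))
      (S.jsynth (A a) * S.jsynth (A b) * S.jsynth (D c))
    have h5 := S.hnorm_add_le 0 (S.jsynth (D a) * S.jsynth (A b) * S.jsynth (A c))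
      (S.jsynth (A a) * S.jsynth (D b) * S.jsynth (A c))
    rw [← hq] at h4
    linarith
  have hqa : ∀ k, S.anal q k = ((∑ j₁ : Bool × G, ∑ j₂ : Bool × G, ∑ j₃ : Bool × G,
      if j₁.2 + j₂.2 + j₃.2 = k then
        (S.δ j₁.2 + S.δ j₂.2 + S.δ j₃.2) * (‖a j₁‖ * ‖b j₂‖ * ‖c j₃‖) else 0 : ℝ) : ℂ) := by
    intro k
    rw [hq, S.anal_add, S.anal_add, Pi.add_apply, Pi.add_apply, S.anal_jsynth_mul,
      S.anal_jsynth_mul, S.anal_jsynth_mul]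
    simp only [← Finset.sum_add_distrib, Complex.ofReal_sum]
    refine Finset.sum_congr rfl fun j₁ _ => Finset.sum_congr rfl fun j₂ _ =>
      Finset.sum_congr rfl fun j₃ _ => ?_
    split_ifs
    · simp only [A, D]; push_cast; ring
    · simp
  -- The constant is 3L/48, from the 3 in `abs_res_le` and the 48 in `tri`.
  have hpt : ∀ j₀, ‖S.tri χ a b c j₀‖ ≤ L / 16 * ‖S.force 0 q j₀‖ := by
    intro j₀
    have hδ := S.one_le_δ hβ j₀.2
    have hnn : 0 ≤ ∑ j₁ : Bool × G, ∑ j₂ : Bool × G, ∑ j₃ : Bool × G,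
      if j₁.2 + j₂.2 + j₃.2 = j₀.2 then
        (S.δ j₁.2 + S.δ j₂.2 + S.δ j₃.2) * (‖a j₁‖ * ‖b j₂‖ * ‖c j₃‖) else 0 := by
      refine Finset.sum_nonneg fun j₁ _ => Finset.sum_nonneg fun j₂ _ =>
        Finset.sum_nonneg fun j₃ _ => ?_
      have h1 := S.one_le_δ hβ j₁.2
      have h2 := S.one_le_δ hβ j₂.2
      have h3 := S.one_le_δ hβ j₃.2
      split_ifs <;> positivity
    rw [tri, norm_mul, norm_neg, norm_div, Complex.norm_I, norm_mul, Complex.norm_real,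
      Real.norm_eq_abs, S.abs_lam hβ, Complex.norm_ofNat]
    rw [force, norm_mul, norm_div, norm_mul, Complex.norm_I, norm_phase, Complex.norm_real,
      Real.norm_eq_abs, S.abs_lam hβ, hqa, Complex.norm_real, Real.norm_of_nonneg hnn]
    have key : ‖∑ j₁ : Bool × G, ∑ j₂ : Bool × G, ∑ j₃ : Bool × G,
        if j₁.2 + j₂.2 + j₃.2 = j₀.2 then
          χ (S.res j₀ j₁ j₂ j₃) * (a j₁ * b j₂ * c j₃) else 0‖
        ≤ 3 * L * ∑ j₁ : Bool × G, ∑ j₂ : Bool × G, ∑ j₃ : Bool × G,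
          if j₁.2 + j₂.2 + j₃.2 = j₀.2 then
          (S.δ j₁.2 + S.δ j₂.2 + S.δ j₃.2) * (‖a j₁‖ * ‖b j₂‖ * ‖c j₃‖) else 0 := by
      simp only [Finset.mul_sum]
      refine (norm_sum_le _ _).trans (Finset.sum_le_sum fun j₁ _ => ?_)
      refine (norm_sum_le _ _).trans (Finset.sum_le_sum fun j₂ _ => ?_)
      refine (norm_sum_le _ _).trans (Finset.sum_le_sum fun j₃ _ => ?_)
      split_ifs with hj
      · have h1 := S.one_le_δ hβ j₁.2
        have h2 := S.one_le_δ hβ j₂.2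
        have h3 := S.one_le_δ hβ j₃.2
        have hres := S.abs_res_le hβ hβ1 hj
        by_cases hl1 : Λ < S.δ j₁.2
        · simp [ha j₁ hl1]
        by_cases hl2 : Λ < S.δ j₂.2
        · simp [hb j₂ hl2]
        by_cases hl3 : Λ < S.δ j₃.2
        · simp [hc j₃ hl3]
        have hχ := h (S.res j₀ j₁ j₂ j₃) (by linarith)
        rw [norm_mul, norm_mul, norm_mul]
        calc _ ≤ L * (3 * (S.δ j₁.2 + S.δ j₂.2 + S.δ j₃.2)) * (‖a j₁‖ * ‖b j₂‖ * ‖c j₃‖) := by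
              refine mul_le_mul_of_nonneg_right (hχ.trans ?_) (by positivity)
              gcongr
          _ = _ := by ring
      · simp
    have hδ0 : 0 < S.δ j₀.2 := by linarith
    calc _ ≤ 1 / (48 * S.δ j₀.2) * _ := mul_le_mul_of_nonneg_left key (by positivity)
      _ = _ := by
        generalize (∑ j₁ : Bool × G, ∑ j₂ : Bool × G, ∑ j₃ : Bool × G,
          if j₁.2 + j₂.2 + j₃.2 = j₀.2 then
          (S.δ j₁.2 + S.δ j₂.2 + S.δ j₃.2) * (‖a j₁‖ * ‖b j₂‖ * ‖c j₃‖) else 0) = Q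
        field_simp; ring
  refine (wnorm_le_of_le' S.one_le_wJ (by positivity) hpt).trans ?_
  have h1 := S.pnorm_force_β_le hβ 0 q
  have h2 : S.pnorm β (S.force 0 q)
      ≤ 2 * (48 * K * (S.pnorm σ a * S.pnorm σ b * S.pnorm σ c)) := by linarith
  calc _ ≤ L / 16 * (2 * (48 * K * (S.pnorm σ a * S.pnorm σ b * S.pnorm σ c))) :=
        mul_le_mul_of_nonneg_left h2 (by positivity)
    _ = _ := by ring

/-! ### The low-frequency cutoff -/

open Classical in
/-- The cutoff to `δ ≤ Λ`. -/
def low (Λ : ℝ) (Ψ : Bool × G → ℂ) (j : Bool × G) : ℂ := if S.δ j.2 ≤ Λ then Ψ j else 0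

lemma isLow_low (Λ : ℝ) (Ψ : Bool × G → ℂ) : S.IsLow Λ (S.low Λ Ψ) := fun j h => by
  simp [low, not_le.2 h]

lemma pnorm_low_le (Λ s : ℝ) (Ψ : Bool × G → ℂ) : S.pnorm s (S.low Λ Ψ) ≤ S.pnorm s Ψ := by
  have := wnorm_le_of_le' (s := s) S.one_le_wJ zero_le_one (c := S.low Λ Ψ) (d := Ψ)
    fun j => by rw [low]; split_ifs <;> simp
  rwa [one_mul] at this

lemma low_sub (Λ : ℝ) (Ψ Φ : Bool × G → ℂ) : S.low Λ (Ψ - Φ) = S.low Λ Ψ - S.low Λ Φ := by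
  ext j; simp only [low, Pi.sub_apply]; split_ifs <;> simp

lemma isLow_sub {Λ : ℝ} {a b : Bool × G → ℂ} (ha : S.IsLow Λ a) (hb : S.IsLow Λ b) :
    S.IsLow Λ (a - b) := fun j h => by simp [ha j h, hb j h]

/-- Spectral decay of the high frequencies. -/
lemma pnorm_sub_low_le (hβ : 0 < β) (hβ1 : β ≤ 1) {τ m : ℝ} (hτ : 0 < τ) (hτ1 : 9 * τ ≤ 1)
    (hm : 0 ≤ m) (Ψ : Bool × G → ℂ) :
    S.pnorm 0 (Ψ - S.low (2 / (9 * τ)) Ψ) ≤ (9 * τ) ^ (m + β) * S.pnorm (m + β) Ψ := by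
  have := wnorm_le_of_le (s := 0) (r := m + β) (κ := (9 * τ) ^ (m + β)) S.one_le_wJ
    (by positivity) (c := Ψ - S.low (2 / (9 * τ)) Ψ) (d := Ψ) fun j => by
      have hw := S.w_pos j.2
      rw [Pi.sub_apply, low]
      split_ifs with h
      · simp only [sub_self, norm_zero, wJ]; positivity
      · rw [sub_zero, ← mul_assoc]
        refine le_mul_of_one_le_left (norm_nonneg _) ?_
        -- The discarded frequencies have 2/(9τ) < δ ≤ 2w^β, so this base may be raised to the power
        -- that produces w^{m+β}.
        have h1 : 1 ≤ 9 * τ * S.w j.2 ^ β := by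
          have h2 := S.δ_le j.2
          have h3 : 2 / (9 * τ) < 2 * S.w j.2 ^ β := lt_of_lt_of_le (not_le.1 h) h2
          rw [div_lt_iff₀ (by positivity)] at h3
          nlinarith
        have h2 : 1 ≤ (9 * τ * S.w j.2 ^ β) ^ ((m + β) / β) :=
          Real.one_le_rpow h1 (by positivity)
        rw [Real.mul_rpow (by positivity) (by positivity), ← Real.rpow_mul hw.le,
          mul_div_cancel₀ _ hβ.ne'] at h2
        refine h2.trans (mul_le_mul_of_nonneg_right ?_ (Real.rpow_nonneg hw.le _))
        -- The decay obtained is (9τ)^{(m+β)/β}; as β ≤ 1 and 9τ ≤ 1, the weaker power m + β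
        -- suffices.
        refine Real.rpow_le_rpow_of_exponent_ge (by positivity) hτ1 ?_
        rw [le_div_iff₀ hβ]
        nlinarith
  rwa [zero_add] at this

end GridSystem

end NSFSGE

/-! ### Approximate flows, their slow motion, and first-order local errors -/

namespace NSFSGE

lemma discrete_gronwall {a : ℕ → ℝ} {A B : ℝ} (hA : 0 ≤ A) (hB : 0 ≤ B) {n : ℕ}
    (h : ∀ k ≤ n, a k ≤ A + B * ∑ j ∈ Finset.range k, a j) : a n ≤ A * Real.exp (B * n) := by
  have key : ∀ k ≤ n, A + B * ∑ j ∈ Finset.range k, a j ≤ A * (1 + B) ^ k := by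
    intro k
    induction k with
    | zero => simp
    | succ k ih =>
      intro hk
      have h1 := ih (by omega)
      have h2 := h k (by omega)
      rw [Finset.sum_range_succ]
      calc A + B * (∑ j ∈ Finset.range k, a j + a k)
          = (A + B * ∑ j ∈ Finset.range k, a j) + B * a k := by ring
        _ ≤ A * (1 + B) ^ k + B * (A * (1 + B) ^ k) :=
            add_le_add h1 (mul_le_mul_of_nonneg_left (h2.trans h1) hB)
        _ = _ := by ring
  have h3 := (h n le_rfl).trans (key n le_rfl)
  have h4 : (1 + B) ^ n ≤ Real.exp (B * n) := by
    rw [mul_comm, Real.exp_nat_mul]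
    exact pow_le_pow_left₀ (by linarith) (by linarith [Real.add_one_le_exp B]) n
  exact h3.trans (mul_le_mul_of_nonneg_left h4 hA)

/-- The cubic part of `gfun`. -/
def cubeFun (z : ℂ) : ℂ := -(1 / 6) * z ^ 3

lemma hasDerivAt_cubeFun (z : ℂ) : HasDerivAt cubeFun (-(1 / 2) * z ^ 2) z := by
  refine ((hasDerivAt_pow 3 z).const_mul (-(1 / 6) : ℂ)).congr_deriv ?_
  push_cast; ring

lemma expMajorized_cubeFun_deriv : ExpMajorized fun z => -(1 / 2) * z ^ 2 := by
  refine ⟨fun j => if j = 0 then -(1 / 2) else 0, fun j => j + 1, fun i j h => by simpa using h,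
    fun j => ?_, fun z => ?_⟩
  · dsimp only
    split_ifs with h
    · subst h; norm_num [Nat.factorial]
    · simp
  · convert hasSum_ite_eq (0 : ℕ) (-(1 / 2) * z ^ 2) using 2 with j
    split_ifs with h
    · subst h; rfl
    · simp [h]

namespace GridSystem

variable {G P : Type} [AddCommGroup G] [Fintype G] [Fintype P] {β : ℝ} (S : GridSystem G P β)
variable {K σ : ℝ}

lemma pnorm_real_smul (s r : ℝ) (Ψ : Bool × G → ℂ) : S.pnorm s (r • Ψ) = |r| * S.pnorm s Ψ :=
  wnorm_real_smul r Ψ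

lemma pnorm_sum_le (s : ℝ) {κ : Type*} (t : Finset κ) (c : κ → Bool × G → ℂ) :
    S.pnorm s (∑ i ∈ t, c i) ≤ ∑ i ∈ t, S.pnorm s (c i) := wnorm_sum_le t c

lemma nl_gfun {ε : ℝ} (hε : 0 < ε) (t : ℝ) (Ψ : Bool × G → ℂ) :
    S.nl (gfun ε) t Ψ = S.nl cubeFun t Ψ + (ε ^ 2 : ℝ) • S.nl (rfun ε) t Ψ := by
  have e : (fun p => gfun ε (S.uOf t Ψ p)) = (fun p => cubeFun (S.uOf t Ψ p))
      + ((ε : ℂ) ^ 2) • fun p => rfun ε (S.uOf t Ψ p) := by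
    ext p; simp [gfun_eq hε, cubeFun]
  rw [nl, e, S.force_add, S.force_smul, nl, nl]
  ext j; simp

lemma hasDerivAt_tri {χ : ℝ → ℝ → ℂ} {χ' : ℝ → ℂ} {r : ℝ}
    (h : ∀ θ, HasDerivAt (fun r => χ r θ) (χ' θ) r) (a b c : Bool × G → ℂ) :
    HasDerivAt (fun r => S.tri (χ r) a b c) (S.tri χ' a b c) r := by
  rw [hasDerivAt_pi]
  intro j₀
  refine HasDerivAt.const_mul _ (HasDerivAt.fun_sum fun j₁ _ => HasDerivAt.fun_sum fun j₂ _ =>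
    HasDerivAt.fun_sum fun j₃ _ => ?_)
  split_ifs
  · exact (h _).mul_const _
  · exact hasDerivAt_const _ _

/-- A solution of the twisted semidiscrete system up to a defect `ρ`. -/
structure IsApproxFlow (K σ m R T ε η η' : ℝ) (Ψ ρ : ℝ → Bool × G → ℂ) : Prop where
  β_pos : 0 < β
  β_le_one : β ≤ 1
  β_le_σ : β ≤ σ
  σ_le_m : σ ≤ m
  hK : ∑ k, S.w k ^ (-(2 * σ)) ≤ K
  T_pos : 0 < T
  ε_pos : 0 < ε
  ε_le_one : ε ≤ 1
  cont : ContinuousOn Ψ (Set.Icc 0 (T / ε ^ 2))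
  deriv : ∀ t ∈ Set.Ioo 0 (T / ε ^ 2),
    HasDerivAt Ψ ((ε ^ 2 : ℝ) • (S.nl (gfun ε) t (Ψ t) + ρ t)) t
  bound : ∀ t ∈ Set.Icc 0 (T / ε ^ 2), S.pnorm (m + β) (Ψ t) ≤ R
  -- Two sizes of the defect are recorded: η in the norm of the final estimate, and η' in the
  -- algebra norm, where only smallness is needed.
  defect : ∀ t ∈ Set.Ioo 0 (T / ε ^ 2), S.pnorm β (ρ t) ≤ η
  defect' : ∀ t ∈ Set.Ioo 0 (T / ε ^ 2), S.pnorm σ (ρ t) ≤ η'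
  η'_le_one : η' ≤ 1

namespace IsApproxFlow

variable {S}
variable {m R T ε η η' : ℝ} {Ψ ρ : ℝ → Bool × G → ℂ}
  (h : S.IsApproxFlow K σ m R T ε η η' Ψ ρ)
include h

lemma σ_nonneg : 0 ≤ σ := h.β_pos.le.trans h.β_le_σ

lemma K_nonneg : 0 ≤ K :=
  (Finset.sum_nonneg fun k _ => Real.rpow_nonneg (S.w_pos k).le _).trans h.hK

lemma S_pos : 0 < T / ε ^ 2 := div_pos h.T_pos (pow_pos h.ε_pos 2)

lemma η'_nonneg : 0 ≤ η' :=
  (S.pnorm_nonneg _ _).trans (h.defect' (T / ε ^ 2 / 2) ⟨by linarith [h.S_pos], by linarith [h.S_pos]⟩)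

lemma η_nonneg : 0 ≤ η :=
  (S.pnorm_nonneg _ _).trans (h.defect (T / ε ^ 2 / 2) ⟨by linarith [h.S_pos], by linarith [h.S_pos]⟩)

lemma R_nonneg : 0 ≤ R :=
  (S.pnorm_nonneg _ _).trans (h.bound 0 ⟨le_rfl, h.S_pos.le⟩)

lemma bound_le {s : ℝ} (hs : s ≤ m + β) {t : ℝ} (ht : t ∈ Set.Icc 0 (T / ε ^ 2)) :
    S.pnorm s (Ψ t) ≤ R := (S.pnorm_mono hs _).trans (h.bound t ht)

lemma ε_sq_le_one : ε ^ 2 ≤ 1 := pow_le_one₀ h.ε_pos.le h.ε_le_one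

/-- The twisted variables have speed ε² in the strong norm, since the free flow has been removed.
Summation by parts uses this once per step. -/
lemma pnorm_sub_le {s t : ℝ} (hs : 0 ≤ s) (hst : s ≤ t) (ht : t ≤ T / ε ^ 2) :
    S.pnorm σ (Ψ t - Ψ s) ≤ ε ^ 2 * (2 * Real.exp (algC K σ * R) + 1) * (t - s) := by
  have hβ := h.β_pos
  have hσm := h.σ_le_m
  refine wnorm_sub_le_of_deriv hst (h.cont.mono (Set.Icc_subset_Icc hs ht))
    (fun r hr => h.deriv r ⟨hs.trans_lt hr.1, hr.2.trans_le ht⟩) fun r hr => ?_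
  have hr' : r ∈ Set.Ioo 0 (T / ε ^ 2) := ⟨hs.trans_lt hr.1, hr.2.trans_le ht⟩
  refine (S.pnorm_real_smul σ _ _).trans_le ?_
  rw [abs_of_nonneg (by positivity)]
  refine mul_le_mul_of_nonneg_left ((S.pnorm_add_le _ _ _).trans (add_le_add ?_ ?_))
    (by positivity)
  · exact S.pnorm_nl_le hβ.le h.hK h.σ_nonneg le_rfl (expMajorized_gfun h.ε_pos h.ε_le_one) r
      (h.bound_le (by linarith) (Set.Ioo_subset_Icc_self hr'))
  · exact (h.defect' r hr').trans h.η'_le_one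

/-- A kick given at time r changes u at time t only by ε²(t - r), by `hnorm_uOf_force_le`.
Integrating over r gains a second power of t - s, up to the defect. -/
lemma hnorm_uOf_sub_le {s t : ℝ} (hs : 0 ≤ s) (hst : s ≤ t) (ht : t ≤ T / ε ^ 2) :
    S.hnorm 0 (S.uOf t (Ψ t - Ψ s))
      ≤ ε ^ 2 * ((t - s) * Real.exp (algC K σ * R) + η) * (t - s) := by
  have hβ := h.β_pos
  have hσm := h.σ_le_m
  rw [uOf_sub, hnorm, anal_sub]
  refine wnorm_sub_le_of_deriv (F := fun r => S.anal (S.uOf t (Ψ r)))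
    (F' := fun r => S.anal (S.uOf t ((ε ^ 2 : ℝ) • (S.nl (gfun ε) r (Ψ r) + ρ r)))) hst ?_
    (fun r hr => S.hasDerivAt_anal (S.hasDerivAt_uOf_right t
      (h.deriv r ⟨hs.trans_lt hr.1, hr.2.trans_le ht⟩))) fun r hr => ?_
  · have hL : Continuous fun Φ => S.anal (S.uOf t Φ) :=
      (S.analL.comp (S.uL t)).continuous_of_finiteDimensional
    exact hL.comp_continuousOn (h.cont.mono (Set.Icc_subset_Icc hs ht))
  have hr' : r ∈ Set.Ioo 0 (T / ε ^ 2) := ⟨hs.trans_lt hr.1, hr.2.trans_le ht⟩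
  change S.hnorm 0 (S.uOf t ((ε ^ 2 : ℝ) • (S.nl (gfun ε) r (Ψ r) + ρ r))) ≤ _
  have e : ((ε ^ 2 : ℝ) • (S.nl (gfun ε) r (Ψ r) + ρ r))
      = ((ε ^ 2 : ℝ) : ℂ) • (S.nl (gfun ε) r (Ψ r) + ρ r) := by
    ext j; simp [mul_add]
  rw [e, uOf_smul, uOf_add]
  refine (S.hnorm_smul _ _ _).trans ?_
  rw [Complex.norm_real, Real.norm_of_nonneg (by positivity)]
  refine mul_le_mul_of_nonneg_left ((S.hnorm_add_le _ _ _).trans (add_le_add ?_ ?_))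
    (by positivity)
  · refine (S.hnorm_uOf_force_le hβ.le t r _).trans ?_
    have h1 := S.hnorm_comp_le h.hK h.σ_nonneg le_rfl (expMajorized_gfun h.ε_pos h.ε_le_one)
      ((S.hnorm_uOf_le σ r (Ψ r)).trans (h.bound_le (by linarith) (Set.Ioo_subset_Icc_self hr')))
    have h2 := (S.hnorm_mono h.σ_nonneg _).trans h1
    rw [abs_of_nonneg (by linarith [hr.2])]
    exact mul_le_mul (by linarith [hr.1]) h2 (S.hnorm_nonneg _ _) (by linarith)
  · exact (S.hnorm_uOf_le _ _ _).trans ((S.pnorm_mono hβ.le _).trans (h.defect r hr'))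

/-- The local error of one step. -/
def _root_.NSFSGE.GridSystem.localErr (S : GridSystem G P β) (ε τ : ℝ) (Ψ : ℝ → Bool × G → ℂ)
    (s : ℝ) : Bool × G → ℂ :=
  (ε ^ 2 * τ) • S.nl (gfun ε) (s + τ / 2) (Ψ s) - (Ψ (s + τ) - Ψ s)

/-- First-order bound of the local error in a strong norm. -/
lemma pnorm_localErr_le {s τ : ℝ} (hs : 0 ≤ s) (hτ : 0 < τ) (hsτ : s + τ ≤ T / ε ^ 2) :
    S.pnorm σ (S.localErr ε τ Ψ s) ≤ ε ^ 2 * τ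
      * ((2 * (algC K m * (Real.exp (algC K m * R) * (2 * R))) + 4 * Real.exp (algC K m * R)
        + 2 * (algC K σ * Real.exp (algC K σ * R)) * (2 * Real.exp (algC K σ * R) + 1)) * τ
        + η') := by
  have hβ := h.β_pos
  have hσm := h.σ_le_m
  have hσ := h.σ_nonneg
  have hε := h.ε_pos
  have hR := h.R_nonneg
  have hA := one_le_algC K σ
  have hAm := one_le_algC K m
  have hg := expMajorized_gfun h.ε_pos h.ε_le_one
  have hg' := expMajorized_gfun' h.ε_pos h.ε_le_one
  have hd := hasDerivAt_gfun h.ε_pos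
  have hsI : s ∈ Set.Icc 0 (T / ε ^ 2) := ⟨hs, by linarith⟩
  obtain ⟨N, hN⟩ : ∃ N, N = S.nl (gfun ε) (s + τ / 2) (Ψ s) := ⟨_, rfl⟩
  have hder : ∀ r ∈ Set.Ioo s (s + τ), HasDerivAt (fun r => ((r - s) * ε ^ 2) • N - Ψ r)
      ((ε ^ 2 : ℝ) • (N - (S.nl (gfun ε) r (Ψ r) + ρ r))) r := fun r hr => by
    have h1 := (((hasDerivAt_id' r).sub_const s).mul_const (ε ^ 2)).smul_const N
    refine (h1.fun_sub (h.deriv r ⟨hs.trans_lt hr.1, hr.2.trans_le hsτ⟩)).congr_deriv ?_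
    rw [one_mul, smul_sub]
  have hcont : ContinuousOn (fun r => ((r - s) * ε ^ 2) • N - Ψ r) (Set.Icc s (s + τ)) := by
    refine ContinuousOn.sub (by fun_prop) (h.cont.mono (Set.Icc_subset_Icc hs hsτ))
  have h1 := wnorm_sub_le_of_deriv (W := S.wJ) (s := σ) (x := s) (y := s + τ)
    (C := ε ^ 2 * ((2 * (algC K m * (Real.exp (algC K m * R) * (2 * R)))
      + 4 * Real.exp (algC K m * R) + 2 * (algC K σ * Real.exp (algC K σ * R))
        * (2 * Real.exp (algC K σ * R) + 1)) * τ + η')) (by linarith) hcont hder fun r hr => by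
    have hr' : r ∈ Set.Ioo 0 (T / ε ^ 2) := ⟨hs.trans_lt hr.1, hr.2.trans_le hsτ⟩
    refine (S.pnorm_real_smul σ _ _).trans_le ?_
    rw [abs_of_nonneg (by positivity)]
    refine mul_le_mul_of_nonneg_left ?_ (by positivity)
    -- Three sources of error: the time at which the phases are taken, the drift of Ψ within the
    -- step, and the defect.
    have e : N - (S.nl (gfun ε) r (Ψ r) + ρ r) = (N - S.nl (gfun ε) r (Ψ s))
        - (S.nl (gfun ε) r (Ψ r) - S.nl (gfun ε) r (Ψ s)) - ρ r := by abel
    rw [e]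
    have h2 := S.pnorm_nl_time_sub_le hβ.le h.hK hσ le_rfl hσm hd hg hg' (s + τ / 2) r
      (h.bound s hsI)
    have h3 := S.pnorm_nl_sub_le hβ.le h.hK hσ le_rfl hd hg' r
      (h.bound_le (by linarith) (Set.Ioo_subset_Icc_self hr')) (h.bound_le (by linarith) hsI)
    have h4 := h.pnorm_sub_le hs hr.1.le hr'.2.le
    have h5 := h.defect' r hr'
    have h6 : |s + τ / 2 - r| ≤ τ := by rw [abs_le]; constructor <;> linarith [hr.1, hr.2]
    have h7 : S.pnorm σ (Ψ r - Ψ s) ≤ (2 * Real.exp (algC K σ * R) + 1) * τ := by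
      refine h4.trans ?_
      have h8 : r - s ≤ τ := by linarith [hr.2]
      have h9 : 0 ≤ r - s := by linarith [hr.1]
      have h10 := h.ε_sq_le_one
      calc _ ≤ 1 * (2 * Real.exp (algC K σ * R) + 1) * τ := by gcongr
        _ = _ := by ring
    rw [← hN] at h2
    refine (S.pnorm_sub_le _ _ _).trans (add_le_add ((S.pnorm_sub_le _ _ _).trans ?_) h5)
    rw [add_mul]
    refine add_le_add (h2.trans (mul_le_mul_of_nonneg_left h6 (by positivity))) (h3.trans ?_)
    rw [mul_assoc _ _ τ]
    exact mul_le_mul_of_nonneg_left h7 (by positivity)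
  have e : S.localErr ε τ Ψ s = (((s + τ) - s) * ε ^ 2) • N - Ψ (s + τ)
      - (((s - s) * ε ^ 2) • N - Ψ s) := by
    rw [localErr, ← hN, sub_self, zero_mul, zero_smul, add_sub_cancel_left, mul_comm τ]; abel
  rw [e]
  refine h1.trans (le_of_eq ?_)
  ring

end IsApproxFlow

end GridSystem

end NSFSGE

/-! ### The resonance correction and the corrected local error -/

namespace NSFSGE

namespace GridSystem

variable {G P : Type} [AddCommGroup G] [Fintype G] [Fintype P] {β : ℝ} {S : GridSystem G P β}
variable {K σ : ℝ}

/-- The constant in the bound of the corrected local error. -/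
def localC (β K σ m R : ℝ) : ℝ :=
  4 * Real.exp (√K * R) * (9 ^ (m + β) * R) + taylorC β K m R
    + 2 * Real.exp (√K * R) * (Real.exp (algC K σ * R) + 1) + 1

lemma taylorC_nonneg {β K m R : ℝ} (hR : 0 ≤ R) : 0 ≤ taylorC β K m R := by
  have := one_le_algC K m
  unfold taylorC; positivity

lemma localC_nonneg {β K σ m R : ℝ} (hR : 0 ≤ R) : 0 ≤ localC β K σ m R := by
  have := taylorC_nonneg (β := β) (K := K) (m := m) hR
  unfold localC; positivity

/-- The resonance correction at time `t` of the twisted variables `Φ`. -/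
def corr (S : GridSystem G P β) (τ t : ℝ) (Φ : Bool × G → ℂ) : Bool × G → ℂ :=
  S.tri (fun θ => midKer τ θ * Complex.exp (Complex.I * ((θ * t : ℝ) : ℂ)))
    (S.low (2 / (9 * τ)) Φ) (S.low (2 / (9 * τ)) Φ) (S.low (2 / (9 * τ)) Φ)

lemma norm_corr_kernel_le {τ : ℝ} (hτ : 0 < τ) (t θ : ℝ) (hθ : |θ| ≤ 9 * (2 / (9 * τ))) :
    ‖midKer τ θ * Complex.exp (Complex.I * ((θ * t : ℝ) : ℂ))‖ ≤ τ ^ 2 * |θ| := by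
  rw [norm_mul, mul_comm Complex.I, Complex.norm_exp_ofReal_mul_I, mul_one]
  refine norm_midKer_le hτ.le ?_
  calc |θ| * τ ≤ 9 * (2 / (9 * τ)) * τ := by gcongr
    _ = 2 := by field_simp

lemma pnorm_corr_le (hβ : 0 ≤ β) (hβ1 : β ≤ 1) (hK : ∑ k, S.w k ^ (-(2 * σ)) ≤ K)
    (hβσ : β ≤ σ) {τ : ℝ} (hτ : 0 < τ) {R : ℝ} (t : ℝ) {Φ : Bool × G → ℂ}
    (hΦ : S.pnorm σ Φ ≤ R) : S.pnorm β (S.corr τ t Φ) ≤ 6 * K * τ ^ 2 * (R * R * R) := by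
  have hK0 : 0 ≤ K := (Finset.sum_nonneg fun k _ => Real.rpow_nonneg (S.w_pos k).le _).trans hK
  have h1 := S.isLow_low (2 / (9 * τ)) Φ
  refine (S.pnorm_tri_le hβ hβ1 hK hβσ (sq_nonneg τ) (norm_corr_kernel_le hτ t) h1 h1 h1).trans ?_
  have h2 := (S.pnorm_low_le (2 / (9 * τ)) σ Φ).trans hΦ
  have h3 := S.pnorm_nonneg σ (S.low (2 / (9 * τ)) Φ)
  have hR : 0 ≤ R := h3.trans h2
  gcongr

/-- The correction is trilinear, so its difference is a sum of three terms, each with one factor Φ -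
Φ'. Together with the slow motion of Ψ this bounds the interior terms of the summation by parts. -/
lemma pnorm_corr_sub_le (hβ : 0 ≤ β) (hβ1 : β ≤ 1) (hK : ∑ k, S.w k ^ (-(2 * σ)) ≤ K)
    (hβσ : β ≤ σ) {τ : ℝ} (hτ : 0 < τ) {R : ℝ} (t : ℝ) {Φ Φ' : Bool × G → ℂ}
    (hΦ : S.pnorm σ Φ ≤ R) (hΦ' : S.pnorm σ Φ' ≤ R) :
    S.pnorm β (S.corr τ t Φ - S.corr τ t Φ')
      ≤ 18 * K * τ ^ 2 * (R * R) * S.pnorm σ (Φ - Φ') := by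
  have hK0 : 0 ≤ K := (Finset.sum_nonneg fun k _ => Real.rpow_nonneg (S.w_pos k).le _).trans hK
  have hR : 0 ≤ R := (S.pnorm_nonneg _ _).trans hΦ
  have h1 := S.isLow_low (2 / (9 * τ)) Φ
  have h1' := S.isLow_low (2 / (9 * τ)) Φ'
  have hd := S.isLow_sub h1 h1'
  have h2 := (S.pnorm_low_le (2 / (9 * τ)) σ Φ).trans hΦ
  have h2' := (S.pnorm_low_le (2 / (9 * τ)) σ Φ').trans hΦ'
  have h3 := S.pnorm_nonneg σ (S.low (2 / (9 * τ)) Φ)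
  have h3' := S.pnorm_nonneg σ (S.low (2 / (9 * τ)) Φ')
  have h4 : S.pnorm σ (S.low (2 / (9 * τ)) Φ - S.low (2 / (9 * τ)) Φ') ≤ S.pnorm σ (Φ - Φ') := by
    rw [← low_sub]; exact S.pnorm_low_le _ _ _
  have h5 := S.pnorm_nonneg σ (S.low (2 / (9 * τ)) Φ - S.low (2 / (9 * τ)) Φ')
  have h6 := S.pnorm_nonneg σ (Φ - Φ')
  have hk := norm_corr_kernel_le hτ t
  rw [corr, corr, tri_sub]
  refine (S.pnorm_add_le _ _ _).trans ((add_le_add_left (S.pnorm_add_le _ _ _) _).trans ?_)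
  have b1 := S.pnorm_tri_le hβ hβ1 hK hβσ (sq_nonneg τ) hk hd h1 h1
  have b2 := S.pnorm_tri_le hβ hβ1 hK hβσ (sq_nonneg τ) hk h1' hd h1
  have b3 := S.pnorm_tri_le hβ hβ1 hK hβσ (sq_nonneg τ) hk h1' h1' hd
  have c1 : S.pnorm σ (S.low (2 / (9 * τ)) Φ - S.low (2 / (9 * τ)) Φ')
      * S.pnorm σ (S.low (2 / (9 * τ)) Φ) * S.pnorm σ (S.low (2 / (9 * τ)) Φ)
      ≤ S.pnorm σ (Φ - Φ') * R * R := by gcongr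
  have c2 : S.pnorm σ (S.low (2 / (9 * τ)) Φ')
      * S.pnorm σ (S.low (2 / (9 * τ)) Φ - S.low (2 / (9 * τ)) Φ')
      * S.pnorm σ (S.low (2 / (9 * τ)) Φ) ≤ R * S.pnorm σ (Φ - Φ') * R := by gcongr
  have c3 : S.pnorm σ (S.low (2 / (9 * τ)) Φ') * S.pnorm σ (S.low (2 / (9 * τ)) Φ')
      * S.pnorm σ (S.low (2 / (9 * τ)) Φ - S.low (2 / (9 * τ)) Φ')
      ≤ R * R * S.pnorm σ (Φ - Φ') := by gcongr
  have hk0 : 0 ≤ 6 * K * τ ^ 2 := by positivity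
  have d1 := b1.trans (mul_le_mul_of_nonneg_left c1 hk0)
  have d2 := b2.trans (mul_le_mul_of_nonneg_left c2 hk0)
  have d3 := b3.trans (mul_le_mul_of_nonneg_left c3 hk0)
  linarith

/-- The midpoint error of the low-frequency cubic part is an increment of the correction. -/
lemma midpoint_cube_eq (hβ : 0 ≤ β) (hβ1 : β ≤ 1) {τ : ℝ} (hτ : 0 < τ) (s : ℝ)
    (Φ : Bool × G → ℂ) :
    τ • S.nl cubeFun (s + τ / 2) (S.low (2 / (9 * τ)) Φ)
      - S.tri (fun θ => expInt τ θ * Complex.exp (Complex.I * ((θ * s : ℝ) : ℂ)))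
        (S.low (2 / (9 * τ)) Φ) (S.low (2 / (9 * τ)) Φ) (S.low (2 / (9 * τ)) Φ)
      = S.corr τ (s + τ) Φ - S.corr τ s Φ := by
  have hl := S.isLow_low (2 / (9 * τ)) Φ
  obtain ⟨L, hL⟩ : ∃ L, L = S.low (2 / (9 * τ)) Φ := ⟨_, rfl⟩
  have hlin : ∀ χ χ' : ℝ → ℂ, S.tri χ L L L - S.tri χ' L L L
      = S.tri (fun θ => χ θ - χ' θ) L L L := fun χ χ' => by
    ext j₀
    simp only [tri, Pi.sub_apply, ← mul_sub, ← Finset.sum_sub_distrib]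
    congr 1
    refine Finset.sum_congr rfl fun j₁ _ => Finset.sum_congr rfl fun j₂ _ =>
      Finset.sum_congr rfl fun j₃ _ => ?_
    split_ifs
    · ring
    · simp
  have hsm : ∀ χ : ℝ → ℂ, τ • S.tri χ L L L = S.tri (fun θ => (τ : ℂ) * χ θ) L L L := fun χ => by
    ext j₀
    simp only [tri, Pi.smul_apply, Complex.real_smul]
    rw [mul_left_comm]
    congr 1
    simp only [Finset.mul_sum]
    refine Finset.sum_congr rfl fun j₁ _ => Finset.sum_congr rfl fun j₂ _ =>
      Finset.sum_congr rfl fun j₃ _ => ?_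
    split_ifs
    · ring
    · simp
  have hc : S.nl cubeFun (s + τ / 2) L = _ := S.nl_cube_eq_tri (s + τ / 2) L
  rw [corr, corr, ← hL, hc, hsm, hlin, hlin]
  rw [← hL] at hl
  -- The cutoff Λ = 2/(9τ) is chosen so that 9Λτ = 2, the limit of validity of `midKer_spec`.
  refine S.tri_congr hβ hβ1 (fun θ hθ => midKer_spec s hτ ?_) hl hl hl
  calc |θ| * τ ≤ 9 * (2 / (9 * τ)) * τ := by gcongr
    _ = 2 := by field_simp

namespace IsApproxFlow

variable {m R T ε η η' : ℝ} {Ψ ρ : ℝ → Bool × G → ℂ}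
  (h : S.IsApproxFlow K σ m R T ε η η' Ψ ρ)
include h

/-- The forcing supplies β derivatives, so the truncation error of u is needed only in L², where all
m + β derivatives of Ψ are turned into powers of τ. -/
lemma pnorm_cube_sub_low_le {τ : ℝ} (hτ : 0 < τ) (hτ1 : 9 * τ ≤ 1) (t : ℝ) {s : ℝ}
    (hs : s ∈ Set.Icc 0 (T / ε ^ 2)) :
    S.pnorm β (S.nl cubeFun t (Ψ s) - S.nl cubeFun t (S.low (2 / (9 * τ)) (Ψ s)))
      ≤ 2 * Real.exp (√K * R) * ((9 * τ) ^ (m + β) * R) := by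
  have hβ := h.β_pos
  have hσm := h.σ_le_m
  have hσ := h.σ_nonneg
  have h1 := h.bound_le (s := σ) (by linarith) hs
  refine (S.pnorm_β_nl_sub_le_uOf hβ.le h.hK hasDerivAt_cubeFun expMajorized_cubeFun_deriv t h1
    ((S.pnorm_low_le _ _ _).trans h1)).trans ?_
  refine mul_le_mul_of_nonneg_left ((S.hnorm_uOf_le _ _ _).trans ?_) (by positivity)
  refine (S.pnorm_sub_low_le hβ h.β_le_one (m := m) hτ hτ1 (by linarith) (Ψ s)).trans ?_
  exact mul_le_mul_of_nonneg_left (h.bound s hs) (by positivity)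

/-- The local error is an increment of the correction up to terms of the final order. -/
lemma pnorm_localErr_sub_corr_le {s τ : ℝ} (hs : 0 ≤ s) (hτ : 0 < τ) (hτ1 : 9 * τ ≤ 1)
    (hsτ : s + τ ≤ T / ε ^ 2) :
    S.pnorm β (S.localErr ε τ Ψ s
        - (ε ^ 2 : ℝ) • (S.corr τ (s + τ) (Ψ s) - S.corr τ s (Ψ s)))
      ≤ ε ^ 2 * τ * (localC β K σ m R * (ε ^ 2 * τ ^ 2 + η + τ ^ (m + β))) := by
  have hβ := h.β_pos
  have hσm := h.σ_le_m
  have hβσ := h.β_le_σ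
  have hσ := h.σ_nonneg
  have hε := h.ε_pos
  have hR := h.R_nonneg
  have hη := h.η_nonneg
  have hg := expMajorized_gfun h.ε_pos h.ε_le_one
  have hg' := expMajorized_gfun' h.ε_pos h.ε_le_one
  have hr0 := expMajorized_rfun h.ε_pos h.ε_le_one
  have hr1 := expMajorized_rfun' h.ε_pos h.ε_le_one
  have hsI : s ∈ Set.Icc 0 (T / ε ^ 2) := ⟨hs, by linarith⟩
  rw [← midpoint_cube_eq hβ.le h.β_le_one hτ]
  obtain ⟨L, hL⟩ : ∃ L, L = S.low (2 / (9 * τ)) (Ψ s) := ⟨_, rfl⟩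
  obtain ⟨A, hA⟩ : ∃ A, A = S.nl cubeFun (s + τ / 2) (Ψ s) - S.nl cubeFun (s + τ / 2) L :=
    ⟨_, rfl⟩
  obtain ⟨N₅, hN₅⟩ : ∃ N, N = S.nl (rfun ε) (s + τ / 2) (Ψ s) := ⟨_, rfl⟩
  obtain ⟨D₅, hD₅⟩ : ∃ N, N = S.nlDeriv (rfun ε) (rfun' ε) (s + τ / 2) (Ψ s) := ⟨_, rfl⟩
  obtain ⟨W, hW⟩ : ∃ W : ℝ → Bool × G → ℂ, W = fun r => S.tri (fun θ => expInt (r - s) θ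
    * Complex.exp (Complex.I * ((θ * s : ℝ) : ℂ))) L L L := ⟨_, rfl⟩
  have hWd : ∀ r, HasDerivAt W (S.nl cubeFun r L) r := fun r => by
    have hc : S.nl cubeFun r L = _ := S.nl_cube_eq_tri r L
    rw [hW, hc]
    refine S.hasDerivAt_tri (fun θ => ?_) L L L
    have h1 := ((hasDerivAt_expInt (r - s) θ).scomp r ((hasDerivAt_id' r).sub_const s)).mul_const
      (Complex.exp (Complex.I * ((θ * s : ℝ) : ℂ)))
    refine h1.congr_deriv ?_
    rw [one_smul, ← Complex.exp_add]; congr 1; push_cast; ring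
  -- A primitive, up to constants, of the integrand of the corrected local error. The coefficient of
  -- `D₅` is the primitive of ε²(r - s - τ/2) that vanishes at both ends of the step: by the
  -- symmetry of the midpoint the linear Taylor term of the quintic part drops out. `W` is the exact
  -- integral of the low-frequency cubic part.
  let H : ℝ → Bool × G → ℂ := fun r => (ε ^ 2 : ℝ) • ((r - s) • (A + (ε ^ 2 : ℝ) • N₅)
    + (ε ^ 2 * (((r - s - τ / 2) ^ 2 - (τ / 2) ^ 2) / 2)) • D₅ + W r) - Ψ r
  have hHd : ∀ r ∈ Set.Ioo s (s + τ), HasDerivAt H ((ε ^ 2 : ℝ) • ((A + (ε ^ 2 : ℝ) • N₅)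
      + (ε ^ 2 * (r - s - τ / 2)) • D₅ + S.nl cubeFun r L
      - (S.nl (gfun ε) r (Ψ r) + ρ r))) r := fun r hr => by
    have h1 := ((hasDerivAt_id' r).sub_const s).smul_const (A + (ε ^ 2 : ℝ) • N₅)
    have h2 := ((((((hasDerivAt_id' r).sub_const s).sub_const (τ / 2)).pow 2).sub_const
      ((τ / 2) ^ 2)).div_const 2).const_mul (ε ^ 2)
    have h3 := h2.smul_const D₅
    have h4 := (((h1.fun_add h3).fun_add (hWd r)).const_smul (ε ^ 2 : ℝ)).fun_sub
      (h.deriv r ⟨hs.trans_lt hr.1, hr.2.trans_le hsτ⟩)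
    refine h4.congr_deriv ?_
    rw [one_smul, ← smul_sub]
    congr 4
    push_cast; ring
  have hHc : ContinuousOn H (Set.Icc s (s + τ)) := by
    have hWc : Continuous W := continuous_iff_continuousAt.2 fun r => (hWd r).continuousAt
    exact ContinuousOn.sub (by fun_prop) (h.cont.mono (Set.Icc_subset_Icc hs hsτ))
  have key := wnorm_sub_le_of_deriv (W := S.wJ) (s := β) (x := s) (y := s + τ)
    (C := ε ^ 2 * (localC β K σ m R * (ε ^ 2 * τ ^ 2 + η + τ ^ (m + β)))) (by linarith) hHc hHd
    fun r hr => by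
    have hr' : r ∈ Set.Ioo 0 (T / ε ^ 2) := ⟨hs.trans_lt hr.1, hr.2.trans_le hsτ⟩
    have hrI := Set.Ioo_subset_Icc_self hr'
    refine (S.pnorm_real_smul β _ _).trans_le ?_
    rw [abs_of_nonneg (by positivity)]
    refine mul_le_mul_of_nonneg_left ?_ (by positivity)
    -- Terms in order: high frequencies of the cubic part at the midpoint and at time r, the Taylor
    -- remainder of the quintic part, the drift of Ψ inside the step, and the defect.
    have e : (A + (ε ^ 2 : ℝ) • N₅) + (ε ^ 2 * (r - s - τ / 2)) • D₅ + S.nl cubeFun r L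
        - (S.nl (gfun ε) r (Ψ r) + ρ r)
        = A - (S.nl cubeFun r (Ψ s) - S.nl cubeFun r L)
          - (ε ^ 2 : ℝ) • (S.nl (rfun ε) r (Ψ s) - N₅ - (r - (s + τ / 2)) • D₅)
          - (S.nl (gfun ε) r (Ψ r) - S.nl (gfun ε) r (Ψ s)) - ρ r := by
      rw [S.nl_gfun hε r (Ψ s)]
      module
    rw [e]
    have b1 := h.pnorm_cube_sub_low_le hτ hτ1 (s + τ / 2) hsI
    have b2 := h.pnorm_cube_sub_low_le hτ hτ1 r hsI
    rw [← hL] at b1 b2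
    rw [← hA] at b1
    have b3 := S.pnorm_nl_taylor_le hβ.le h.hK hσ hσm (by linarith) (hasDerivAt_rfun hε)
      (hasDerivAt_rfun' hε) hr0 hr1 hg.neg r (s + τ / 2) (h.bound s hsI)
    rw [← hN₅, ← hD₅] at b3
    have b4 := S.pnorm_β_nl_sub_le_uOf hβ.le h.hK (hasDerivAt_gfun hε) hg' r
      (h.bound_le (by linarith) hrI) (h.bound_le (by linarith) hsI)
    have b5 := h.hnorm_uOf_sub_le hs hr.1.le hrI.2
    have b6 := h.defect r hr'
    have c3 : S.pnorm β ((ε ^ 2 : ℝ) • (S.nl (rfun ε) r (Ψ s) - N₅ - (r - (s + τ / 2)) • D₅))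
        ≤ taylorC β K m R * (ε ^ 2 * τ ^ 2) := by
      rw [pnorm_real_smul, abs_of_nonneg (by positivity)]
      have h6 : |r - (s + τ / 2)| ≤ τ := by rw [abs_le]; constructor <;> linarith [hr.1, hr.2]
      have := taylorC_nonneg (β := β) (K := K) (m := m) hR
      calc _ ≤ ε ^ 2 * (taylorC β K m R * τ ^ 2) := by
            refine mul_le_mul_of_nonneg_left (b3.trans ?_) (by positivity)
            gcongr
        _ = _ := by ring
    have hτ' : τ ≤ 1 := by linarith
    have c5 : S.hnorm 0 (S.uOf r (Ψ r - Ψ s))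
        ≤ (Real.exp (algC K σ * R) + 1) * (ε ^ 2 * τ ^ 2 + η) := by
      have h8 : r - s ≤ τ := by linarith [hr.2]
      have h9 : 0 ≤ r - s := by linarith [hr.1]
      calc _ ≤ ε ^ 2 * (τ * Real.exp (algC K σ * R) + η) * τ := by
            refine b5.trans ?_; gcongr
        _ = Real.exp (algC K σ * R) * (ε ^ 2 * τ ^ 2) + ε ^ 2 * τ * η := by ring
        _ ≤ Real.exp (algC K σ * R) * (ε ^ 2 * τ ^ 2) + 1 * η := by
            have := mul_le_one₀ h.ε_sq_le_one hτ.le hτ'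
            gcongr
        _ ≤ _ := by
            have : 0 ≤ ε ^ 2 * τ ^ 2 := by positivity
            nlinarith [mul_nonneg (Real.exp_pos (algC K σ * R)).le hη]
    have c4 := b4.trans (mul_le_mul_of_nonneg_left c5 (by positivity))
    rw [Real.mul_rpow (by norm_num) hτ.le] at b1 b2
    have t1 := S.pnorm_sub_le β (A - (S.nl cubeFun r (Ψ s) - S.nl cubeFun r L)
          - (ε ^ 2 : ℝ) • (S.nl (rfun ε) r (Ψ s) - N₅ - (r - (s + τ / 2)) • D₅)
          - (S.nl (gfun ε) r (Ψ r) - S.nl (gfun ε) r (Ψ s))) (ρ r)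
    have t2 := S.pnorm_sub_le β (A - (S.nl cubeFun r (Ψ s) - S.nl cubeFun r L)
          - (ε ^ 2 : ℝ) • (S.nl (rfun ε) r (Ψ s) - N₅ - (r - (s + τ / 2)) • D₅))
          (S.nl (gfun ε) r (Ψ r) - S.nl (gfun ε) r (Ψ s))
    have t3 := S.pnorm_sub_le β (A - (S.nl cubeFun r (Ψ s) - S.nl cubeFun r L))
      ((ε ^ 2 : ℝ) • (S.nl (rfun ε) r (Ψ s) - N₅ - (r - (s + τ / 2)) • D₅))
    have t4 := S.pnorm_sub_le β A (S.nl cubeFun r (Ψ s) - S.nl cubeFun r L)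
    have p1 : 0 ≤ ε ^ 2 * τ ^ 2 := by positivity
    have p2 : 0 ≤ τ ^ (m + β) := by positivity
    have p3 := taylorC_nonneg (β := β) (K := K) (m := m) hR
    have p4 : 0 ≤ 4 * Real.exp (√K * R) * (9 ^ (m + β) * R) := by positivity
    have p5 : 0 ≤ 2 * Real.exp (√K * R) * (Real.exp (algC K σ * R) + 1) := by positivity
    have q1 := mul_nonneg p4 p1
    have q2 := mul_nonneg p4 hη
    have q3 := mul_nonneg p3 hη
    have q4 := mul_nonneg p3 p2
    have q5 := mul_nonneg p5 p2
    unfold localC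
    linarith
  have eH : H (s + τ) - H s = S.localErr ε τ Ψ s
      - (ε ^ 2 : ℝ) • (τ • S.nl cubeFun (s + τ / 2) L - S.tri (fun θ => expInt τ θ
        * Complex.exp (Complex.I * ((θ * s : ℝ) : ℂ))) L L L) := by
    have hW0 : W s = 0 := by
      rw [hW]; ext j; simp [tri, expInt]
    have hWτ : W (s + τ) = S.tri (fun θ => expInt τ θ
        * Complex.exp (Complex.I * ((θ * s : ℝ) : ℂ))) L L L := by
      rw [hW]; simp
    rw [← hWτ, localErr, S.nl_gfun hε, ← hN₅]
    have hA' : S.nl cubeFun (s + τ / 2) (Ψ s) = A + S.nl cubeFun (s + τ / 2) L := by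
      rw [hA]; abel
    rw [hA']
    simp only [H, hW0]
    rw [show s + τ - s = τ by ring, show s - s = 0 by ring]
    module
  rw [← hL, ← eH]
  refine key.trans (le_of_eq ?_)
  ring

end IsApproxFlow

end GridSystem

end NSFSGE

/-! ### Global error: summation by parts and Gronwall -/

namespace NSFSGE

namespace GridSystem

variable {G P : Type} [AddCommGroup G] [Fintype G] [Fintype P] {β : ℝ} {S : GridSystem G P β}
variable {K σ : ℝ}

/-- The local errors are kept as one sum, outside the norm, because their cancellation between
different steps is what gives the factor ε². -/
lemma error_eq_sum {ε τ : ℝ} {Z : ℕ → Bool × G → ℂ} (Ψ : ℝ → Bool × G → ℂ)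
    (hZ : ∀ n, Z (n + 1) = Z n + (ε ^ 2 * τ) • S.nl (gfun ε) (n * τ + τ / 2) (Z n)) (n : ℕ) :
    Z n - Ψ (n * τ) = (Z 0 - Ψ 0) + ∑ j ∈ Finset.range n, (ε ^ 2 * τ) •
      (S.nl (gfun ε) (j * τ + τ / 2) (Z j) - S.nl (gfun ε) (j * τ + τ / 2) (Ψ (j * τ)))
      + ∑ j ∈ Finset.range n, S.localErr ε τ Ψ (j * τ) := by
  induction n with
  | zero => simp
  | succ n ih =>
    rw [Finset.sum_range_succ, Finset.sum_range_succ]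
    have e : Z (n + 1) - Ψ ((n + 1 : ℕ) * τ) = (Z n - Ψ (n * τ)) + (ε ^ 2 * τ) •
        (S.nl (gfun ε) (n * τ + τ / 2) (Z n) - S.nl (gfun ε) (n * τ + τ / 2) (Ψ (n * τ)))
        + S.localErr ε τ Ψ (n * τ) := by
      rw [hZ, localErr, show ((n + 1 : ℕ) : ℝ) * τ = n * τ + τ by push_cast; ring]
      module
    rw [e, ih]; abel

namespace IsApproxFlow

variable {m R T ε η η' : ℝ} {Ψ ρ : ℝ → Bool × G → ℂ}
  (h : S.IsApproxFlow K σ m R T ε η η' Ψ ρ)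
include h

lemma grid_mem {τ : ℝ} (hτ : 0 < τ) {n j : ℕ} (hn : (n : ℝ) * τ ≤ T / ε ^ 2) (hj : j ≤ n) :
    (j : ℝ) * τ ∈ Set.Icc 0 (T / ε ^ 2) := by
  refine ⟨by positivity, le_trans ?_ hn⟩
  gcongr

lemma steps_le {τ : ℝ} {n : ℕ} (hn : (n : ℝ) * τ ≤ T / ε ^ 2) : (n : ℝ) * (ε ^ 2 * τ) ≤ T := by
  have := h.ε_pos
  rw [le_div_iff₀ (by positivity)] at hn
  linarith

/-- Summation by parts: the increments of the correction sum up to `O(τ²)`. -/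
lemma pnorm_sum_corr_le {τ : ℝ} (hτ : 0 < τ) {n : ℕ} (hn : (n : ℝ) * τ ≤ T / ε ^ 2) :
    S.pnorm β (∑ j ∈ Finset.range n,
      (S.corr τ (j * τ + τ) (Ψ (j * τ)) - S.corr τ (j * τ) (Ψ (j * τ))))
      ≤ K * (12 * (R * R * R) + 18 * (R * R) * (2 * Real.exp (algC K σ * R) + 1) * T) * τ ^ 2 := by
  have hβ := h.β_pos
  have hσm := h.σ_le_m
  have hK0 := h.K_nonneg
  have hR := h.R_nonneg
  have hb : ∀ j ≤ n, S.pnorm σ (Ψ (j * τ)) ≤ R := fun j hj =>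
    h.bound_le (by linarith) (h.grid_mem hτ hn hj)
  have hcast : ∀ j : ℕ, (j : ℝ) * τ + τ = ((j + 1 : ℕ) : ℝ) * τ := fun j => by push_cast; ring
  -- Abel summation: the increments in time with Ψ frozen at the left end of the step are
  -- telescoping increments plus the change caused by moving Ψ to the right end.
  have e : ∑ j ∈ Finset.range n,
      (S.corr τ (j * τ + τ) (Ψ (j * τ)) - S.corr τ (j * τ) (Ψ (j * τ)))
      = (S.corr τ (n * τ) (Ψ (n * τ)) - S.corr τ ((0 : ℕ) * τ) (Ψ ((0 : ℕ) * τ)))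
        + ∑ j ∈ Finset.range n, (S.corr τ ((j + 1 : ℕ) * τ) (Ψ (j * τ))
          - S.corr τ ((j + 1 : ℕ) * τ) (Ψ ((j + 1 : ℕ) * τ))) := by
    rw [← Finset.sum_range_sub (fun j : ℕ => S.corr τ (j * τ) (Ψ (j * τ))) n,
      ← Finset.sum_add_distrib]
    refine Finset.sum_congr rfl fun j _ => ?_
    rw [hcast]; abel
  rw [e]
  have h1 := S.pnorm_corr_le hβ.le h.β_le_one h.hK h.β_le_σ hτ (n * τ) (hb n le_rfl)
  have h2 := S.pnorm_corr_le hβ.le h.β_le_one h.hK h.β_le_σ hτ ((0 : ℕ) * τ) (hb 0 (Nat.zero_le _))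
  have h3 : ∀ j ∈ Finset.range n, S.pnorm β (S.corr τ ((j + 1 : ℕ) * τ) (Ψ (j * τ))
      - S.corr τ ((j + 1 : ℕ) * τ) (Ψ ((j + 1 : ℕ) * τ)))
      ≤ 18 * K * τ ^ 2 * (R * R) * ((2 * Real.exp (algC K σ * R) + 1) * (ε ^ 2 * τ)) := by
    intro j hj
    have hj' := Finset.mem_range.1 hj
    refine (S.pnorm_corr_sub_le hβ.le h.β_le_one h.hK h.β_le_σ hτ _ (hb j hj'.le)
      (hb (j + 1) hj')).trans ?_
    refine mul_le_mul_of_nonneg_left ?_ (by positivity)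
    have h4 := h.pnorm_sub_le (s := j * τ) (t := (j + 1 : ℕ) * τ) (by positivity)
      (by push_cast; nlinarith) (h.grid_mem hτ hn hj').2
    rw [pnorm, wnorm_sub_comm]
    refine h4.trans (le_of_eq ?_)
    push_cast; ring
  have h5 := (S.pnorm_sum_le β (Finset.range n) _).trans (Finset.sum_le_sum h3)
  rw [Finset.sum_const, Finset.card_range, nsmul_eq_mul] at h5
  have h6 := h.steps_le hn
  -- Each interior term has the factor ε²τ and n·ε²τ ≤ T, so the number of steps does not enter.
  have h7 : (n : ℝ) * (18 * K * τ ^ 2 * (R * R)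
      * ((2 * Real.exp (algC K σ * R) + 1) * (ε ^ 2 * τ)))
      ≤ 18 * K * τ ^ 2 * (R * R) * (2 * Real.exp (algC K σ * R) + 1) * T := by
    calc _ = 18 * K * τ ^ 2 * (R * R) * (2 * Real.exp (algC K σ * R) + 1)
          * ((n : ℝ) * (ε ^ 2 * τ)) := by ring
      _ ≤ _ := by gcongr
  have h8 := S.pnorm_sub_le β (S.corr τ (n * τ) (Ψ (n * τ)))
    (S.corr τ ((0 : ℕ) * τ) (Ψ ((0 : ℕ) * τ)))
  refine (S.pnorm_add_le _ _ _).trans ?_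
  linarith

lemma pnorm_sum_localErr_le {τ : ℝ} (hτ : 0 < τ) (hτ1 : 9 * τ ≤ 1) {n : ℕ}
    (hn : (n : ℝ) * τ ≤ T / ε ^ 2) :
    S.pnorm β (∑ j ∈ Finset.range n, S.localErr ε τ Ψ (j * τ))
      ≤ T * (localC β K σ m R * (ε ^ 2 * τ ^ 2 + η + τ ^ (m + β)))
        + K * (12 * (R * R * R) + 18 * (R * R) * (2 * Real.exp (algC K σ * R) + 1) * T)
          * (ε ^ 2 * τ ^ 2) := by
  have hR := h.R_nonneg
  have hη := h.η_nonneg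
  have hC := localC_nonneg (β := β) (K := K) (σ := σ) (m := m) hR
  have e : ∑ j ∈ Finset.range n, S.localErr ε τ Ψ (j * τ)
      = ∑ j ∈ Finset.range n, (S.localErr ε τ Ψ (j * τ) - (ε ^ 2 : ℝ) •
        (S.corr τ (j * τ + τ) (Ψ (j * τ)) - S.corr τ (j * τ) (Ψ (j * τ))))
        + (ε ^ 2 : ℝ) • ∑ j ∈ Finset.range n,
          (S.corr τ (j * τ + τ) (Ψ (j * τ)) - S.corr τ (j * τ) (Ψ (j * τ))) := by
    rw [Finset.smul_sum, ← Finset.sum_add_distrib]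
    refine Finset.sum_congr rfl fun j _ => by abel
  rw [e]
  refine (S.pnorm_add_le _ _ _).trans (add_le_add ?_ ?_)
  · refine (S.pnorm_sum_le β (Finset.range n) _).trans ((Finset.sum_le_sum fun (j : ℕ) hj =>
      h.pnorm_localErr_sub_corr_le (s := (j:ℝ) * τ) (by positivity) hτ hτ1 ?_).trans ?_)
    · have := (h.grid_mem hτ hn (Finset.mem_range.1 hj)).2
      push_cast at this; linarith
    · rw [Finset.sum_const, Finset.card_range, nsmul_eq_mul, ← mul_assoc]
      refine mul_le_mul_of_nonneg_right (h.steps_le hn) (mul_nonneg hC ?_)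
      positivity
  · rw [pnorm_real_smul, abs_of_nonneg (sq_nonneg ε)]
    refine (mul_le_mul_of_nonneg_left (h.pnorm_sum_corr_le hτ hn) (sq_nonneg ε)).trans
      (le_of_eq ?_)
    ring

/-- The constant of the first-order local error. -/
def _root_.NSFSGE.GridSystem.firstC (K σ m R : ℝ) : ℝ :=
  2 * (algC K m * (Real.exp (algC K m * R) * (2 * R))) + 4 * Real.exp (algC K m * R)
    + 2 * (algC K σ * Real.exp (algC K σ * R)) * (2 * Real.exp (algC K σ * R) + 1)

/-- The Lipschitz constant of the twisted nonlinearity in the strong norm. -/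
def _root_.NSFSGE.GridSystem.lipC (K σ R : ℝ) : ℝ :=
  2 * (algC K σ * Real.exp (algC K σ * (R + 1)))

/-- A priori bound of the error in a strong norm. -/
lemma pnorm_error_le_one {τ : ℝ} (hτ : 0 < τ) {Z : ℕ → Bool × G → ℂ}
    (hZ : ∀ n, Z (n + 1) = Z n + (ε ^ 2 * τ) • S.nl (gfun ε) (n * τ + τ / 2) (Z n))
    (hZ0 : S.pnorm σ (Z 0 - Ψ 0) ≤ η')
    (hsmall : (η' + T * (firstC K σ m R * τ + η')) * Real.exp (T * lipC K σ R) ≤ 1)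
    {n : ℕ} (hn : (n : ℝ) * τ ≤ T / ε ^ 2) : S.pnorm σ (Z n - Ψ (n * τ)) ≤ 1 := by
  have hβ := h.β_pos
  have hσm := h.σ_le_m
  have hR := h.R_nonneg
  have hη' := h.η'_nonneg
  have hT := h.T_pos
  have hε := h.ε_pos
  have hA := one_le_algC K σ
  have hAm := one_le_algC K m
  have hC : 0 ≤ firstC K σ m R := by unfold firstC; positivity
  have hL : 0 ≤ lipC K σ R := by unfold lipC; positivity
  -- Bootstrap: if all earlier errors are at most 1, the earlier iterates lie in the ball of radius
  -- R + 1, where the Lipschitz constant `lipC` is valid, and Gronwall with `hsmall` gives the bound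
  -- at n.
  induction n using Nat.strong_induction_on with
  | _ n ih =>
  have hle : ∀ j ≤ n, (j : ℝ) * τ ≤ T / ε ^ 2 := fun j hj => (h.grid_mem hτ hn hj).2
  have key : S.pnorm σ (Z n - Ψ (n * τ))
      ≤ (η' + T * (firstC K σ m R * τ + η')) * Real.exp (ε ^ 2 * τ * lipC K σ R * n) := by
    refine discrete_gronwall (a := fun k => S.pnorm σ (Z k - Ψ (k * τ))) (by positivity)
      (by positivity) fun k hk => ?_
    rw [error_eq_sum Ψ hZ k, Finset.mul_sum]
    have h1 : S.pnorm σ (∑ j ∈ Finset.range k, (ε ^ 2 * τ) •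
        (S.nl (gfun ε) (j * τ + τ / 2) (Z j) - S.nl (gfun ε) (j * τ + τ / 2) (Ψ (j * τ))))
        ≤ ∑ j ∈ Finset.range k, ε ^ 2 * τ * lipC K σ R * S.pnorm σ (Z j - Ψ (j * τ)) := by
      refine (S.pnorm_sum_le σ _ _).trans (Finset.sum_le_sum fun j hj => ?_)
      have hjk := Finset.mem_range.1 hj
      have hΨ := h.bound_le (s := σ) (by linarith) (h.grid_mem hτ hn (hjk.le.trans hk))
      have hE := ih j (by omega) (hle j (by omega))
      have hZj : S.pnorm σ (Z j) ≤ R + 1 := by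
        have := S.pnorm_add_le σ (Ψ (j * τ)) (Z j - Ψ (j * τ))
        rw [add_sub_cancel] at this; linarith
      rw [pnorm_real_smul, abs_of_nonneg (by positivity), mul_assoc (ε ^ 2 * τ)]
      exact mul_le_mul_of_nonneg_left (S.pnorm_nl_sub_le hβ.le h.hK h.σ_nonneg le_rfl
        (hasDerivAt_gfun hε) (expMajorized_gfun' hε h.ε_le_one) _ hZj (by linarith))
        (by positivity)
    have h2 : S.pnorm σ (∑ j ∈ Finset.range k, S.localErr ε τ Ψ (j * τ))
        ≤ T * (firstC K σ m R * τ + η') := by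
      refine (S.pnorm_sum_le σ _ _).trans ((Finset.sum_le_sum fun (j : ℕ) hj =>
        h.pnorm_localErr_le (s := (j:ℝ) * τ) (mul_nonneg j.cast_nonneg hτ.le) hτ ?_).trans ?_)
      · have := hle (j + 1) (by have := Finset.mem_range.1 hj; omega)
        push_cast at this; linarith
      · rw [Finset.sum_const, Finset.card_range, nsmul_eq_mul, ← mul_assoc]
        exact mul_le_mul_of_nonneg_right (h.steps_le (hle k hk)) (by positivity)
    have h3 := S.pnorm_add_le σ ((Z 0 - Ψ 0) + ∑ j ∈ Finset.range k, (ε ^ 2 * τ) •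
      (S.nl (gfun ε) (j * τ + τ / 2) (Z j) - S.nl (gfun ε) (j * τ + τ / 2) (Ψ (j * τ))))
      (∑ j ∈ Finset.range k, S.localErr ε τ Ψ (j * τ))
    have h4 := S.pnorm_add_le σ (Z 0 - Ψ 0) (∑ j ∈ Finset.range k, (ε ^ 2 * τ) •
      (S.nl (gfun ε) (j * τ + τ / 2) (Z j) - S.nl (gfun ε) (j * τ + τ / 2) (Ψ (j * τ))))
    linarith
  refine key.trans (le_trans ?_ hsmall)
  refine mul_le_mul_of_nonneg_left (Real.exp_le_exp.2 ?_) (by positivity)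
  calc ε ^ 2 * τ * lipC K σ R * n = (n * (ε ^ 2 * τ)) * lipC K σ R := by ring
    _ ≤ T * lipC K σ R := mul_le_mul_of_nonneg_right (h.steps_le hn) hL

/-- The constant of the final error bound. -/
def _root_.NSFSGE.GridSystem.errC (β K σ m R T : ℝ) : ℝ :=
  (1 + T * localC β K σ m R
    + K * (12 * (R * R * R) + 18 * (R * R) * (2 * Real.exp (algC K σ * R) + 1) * T))
    * Real.exp (T * (2 * Real.exp (√K * (R + 1))))

/-- Error bound of the splitting scheme. -/
lemma pnorm_error_le {τ : ℝ} (hτ : 0 < τ) (hτ1 : 9 * τ ≤ 1) {Z : ℕ → Bool × G → ℂ}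
    (hZ : ∀ n, Z (n + 1) = Z n + (ε ^ 2 * τ) • S.nl (gfun ε) (n * τ + τ / 2) (Z n))
    (hZ0 : S.pnorm β (Z 0 - Ψ 0) ≤ η) (hZ0' : S.pnorm σ (Z 0 - Ψ 0) ≤ η')
    (hsmall : (η' + T * (firstC K σ m R * τ + η')) * Real.exp (T * lipC K σ R) ≤ 1)
    {n : ℕ} (hn : (n : ℝ) * τ ≤ T / ε ^ 2) :
    S.pnorm β (Z n - Ψ (n * τ)) ≤ errC β K σ m R T * (η + ε ^ 2 * τ ^ 2 + τ ^ (m + β)) := by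
  have hβ := h.β_pos
  have hσm := h.σ_le_m
  have hR := h.R_nonneg
  have hη := h.η_nonneg
  have hT := h.T_pos
  have hε := h.ε_pos
  have hK0 := h.K_nonneg
  have hC := localC_nonneg (β := β) (K := K) (σ := σ) (m := m) hR
  have hle : ∀ j ≤ n, (j : ℝ) * τ ≤ T / ε ^ 2 := fun j hj => (h.grid_mem hτ hn hj).2
  have p2 : 0 ≤ τ ^ (m + β) := by positivity
  obtain ⟨Y, hY⟩ : ∃ Y, Y = 1 + T * localC β K σ m R
    + K * (12 * (R * R * R) + 18 * (R * R) * (2 * Real.exp (algC K σ * R) + 1) * T) := ⟨_, rfl⟩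
  have hY0 : 0 ≤ Y := by rw [hY]; positivity
  have key : S.pnorm β (Z n - Ψ (n * τ)) ≤ (Y * (η + ε ^ 2 * τ ^ 2 + τ ^ (m + β)))
      * Real.exp (ε ^ 2 * τ * (2 * Real.exp (√K * (R + 1))) * n) := by
    refine discrete_gronwall (a := fun k => S.pnorm β (Z k - Ψ (k * τ))) (by positivity)
      (by positivity) fun k hk => ?_
    rw [error_eq_sum Ψ hZ k, Finset.mul_sum]
    have h1 : S.pnorm β (∑ j ∈ Finset.range k, (ε ^ 2 * τ) •
        (S.nl (gfun ε) (j * τ + τ / 2) (Z j) - S.nl (gfun ε) (j * τ + τ / 2) (Ψ (j * τ))))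
        ≤ ∑ j ∈ Finset.range k,
          ε ^ 2 * τ * (2 * Real.exp (√K * (R + 1))) * S.pnorm β (Z j - Ψ (j * τ)) := by
      refine (S.pnorm_sum_le β _ _).trans (Finset.sum_le_sum fun j hj => ?_)
      have hjk := Finset.mem_range.1 hj
      have hΨ := h.bound_le (s := σ) (by linarith) (h.grid_mem hτ hn (hjk.le.trans hk))
      -- The a priori bound in H^σ gives sup bounds on the iterates. With these the nonlinearity is
      -- Lipschitz in the weak norm, although that norm need not be an algebra norm.
      have hE := h.pnorm_error_le_one hτ hZ hZ0' hsmall (hle j (by omega))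
      have hZj : S.pnorm σ (Z j) ≤ R + 1 := by
        have := S.pnorm_add_le σ (Ψ (j * τ)) (Z j - Ψ (j * τ))
        rw [add_sub_cancel] at this; linarith
      rw [pnorm_real_smul, abs_of_nonneg (by positivity), mul_assoc (ε ^ 2 * τ)]
      refine mul_le_mul_of_nonneg_left ((S.pnorm_β_nl_sub_le_uOf hβ.le h.hK
        (hasDerivAt_gfun hε) (expMajorized_gfun' hε h.ε_le_one) _ hZj (by linarith)).trans ?_)
        (by positivity)
      exact mul_le_mul_of_nonneg_left ((S.hnorm_uOf_le _ _ _).trans (S.pnorm_mono hβ.le _))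
        (by positivity)
    have h2 := h.pnorm_sum_localErr_le hτ hτ1 (hle k hk)
    have h3 := S.pnorm_add_le β ((Z 0 - Ψ 0) + ∑ j ∈ Finset.range k, (ε ^ 2 * τ) •
      (S.nl (gfun ε) (j * τ + τ / 2) (Z j) - S.nl (gfun ε) (j * τ + τ / 2) (Ψ (j * τ))))
      (∑ j ∈ Finset.range k, S.localErr ε τ Ψ (j * τ))
    have h4 := S.pnorm_add_le β (Z 0 - Ψ 0) (∑ j ∈ Finset.range k, (ε ^ 2 * τ) •
      (S.nl (gfun ε) (j * τ + τ / 2) (Z j) - S.nl (gfun ε) (j * τ + τ / 2) (Ψ (j * τ))))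
    have p1 : 0 ≤ ε ^ 2 * τ ^ 2 := by positivity
    obtain ⟨X, hX⟩ : ∃ X, X = K * (12 * (R * R * R)
      + 18 * (R * R) * (2 * Real.exp (algC K σ * R) + 1) * T) := ⟨_, rfl⟩
    have hX0 : 0 ≤ X := by rw [hX]; positivity
    rw [← hX] at h2 hY
    have q1 := mul_nonneg hX0 hη
    have q2 := mul_nonneg hX0 p2
    rw [hY]
    linarith
  refine key.trans ?_
  have hexp : ε ^ 2 * τ * (2 * Real.exp (√K * (R + 1))) * n
      ≤ T * (2 * Real.exp (√K * (R + 1))) := by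
    calc _ = (n * (ε ^ 2 * τ)) * (2 * Real.exp (√K * (R + 1))) := by ring
      _ ≤ _ := mul_le_mul_of_nonneg_right (h.steps_le hn) (by positivity)
  calc _ ≤ (Y * (η + ε ^ 2 * τ ^ 2 + τ ^ (m + β)))
        * Real.exp (T * (2 * Real.exp (√K * (R + 1)))) :=
        mul_le_mul_of_nonneg_left (Real.exp_le_exp.2 hexp) (by positivity)
    _ = _ := by rw [errC, ← hY]; ring

end IsApproxFlow

end GridSystem

end NSFSGE

namespace NSFSGE

/-! ### The weight on the frequency lattice -/

/-- The weight `(1 + |μ_k|² + |μ_l|²)^{1/2}`. -/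
def wt (a b : ℝ) (k : ℤ × ℤ) : ℝ := √(1 + freqSq a b k)

lemma freqSq_nonneg (a b : ℝ) (k : ℤ × ℤ) : 0 ≤ freqSq a b k := by
  unfold freqSq; positivity

lemma wt_sq (a b : ℝ) (k : ℤ × ℤ) : wt a b k ^ 2 = 1 + freqSq a b k :=
  Real.sq_sqrt (by linarith [freqSq_nonneg a b k])

lemma one_le_wt (a b : ℝ) (k : ℤ × ℤ) : 1 ≤ wt a b k := by
  rw [wt, Real.one_le_sqrt]; linarith [freqSq_nonneg a b k]

lemma wt_pos (a b : ℝ) (k : ℤ × ℤ) : 0 < wt a b k := by linarith [one_le_wt a b k]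

lemma rpow_wt (a b s : ℝ) (k : ℤ × ℤ) : (1 + freqSq a b k) ^ s = (wt a b k ^ s) ^ 2 := by
  rw [← wt_sq, ← Real.rpow_natCast, ← Real.rpow_natCast, ← Real.rpow_mul (wt_pos a b k).le,
    ← Real.rpow_mul (wt_pos a b k).le]
  congr 1; ring

lemma freqSq_eq (a b : ℝ) (k : ℤ × ℤ) :
    freqSq a b k = (2 * Real.pi / (b - a)) ^ 2 * ((k.1 : ℝ) ^ 2 + (k.2 : ℝ) ^ 2) := by
  unfold freqSq freq; ring

lemma freqSq_mono (a b : ℝ) {k l : ℤ × ℤ} (h1 : k.1.natAbs ≤ l.1.natAbs)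
    (h2 : k.2.natAbs ≤ l.2.natAbs) : freqSq a b k ≤ freqSq a b l := by
  rw [freqSq_eq, freqSq_eq]
  have e1 : (k.1 : ℝ) ^ 2 ≤ (l.1 : ℝ) ^ 2 := by exact_mod_cast Int.natAbs_le_iff_sq_le.1 h1
  have e2 : (k.2 : ℝ) ^ 2 ≤ (l.2 : ℝ) ^ 2 := by exact_mod_cast Int.natAbs_le_iff_sq_le.1 h2
  gcongr

lemma wt_mono (a b : ℝ) {k l : ℤ × ℤ} (h1 : k.1.natAbs ≤ l.1.natAbs)
    (h2 : k.2.natAbs ≤ l.2.natAbs) : wt a b k ≤ wt a b l :=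
  Real.sqrt_le_sqrt (by linarith [freqSq_mono a b h1 h2])

lemma wt_add_le (a b : ℝ) (k l : ℤ × ℤ) : wt a b (k + l) ≤ wt a b k + wt a b l := by
  have hk := wt_pos a b k
  have hl := wt_pos a b l
  refine Real.sqrt_le_iff.2 ⟨by linarith, ?_⟩
  have e1 := wt_sq a b k
  have e2 := wt_sq a b l
  have e3 : freqSq a b (k + l) = freqSq a b k + freqSq a b l
      + 2 * (freq a b k.1 * freq a b l.1 + freq a b k.2 * freq a b l.2) := by
    simp only [freqSq, freq, Prod.fst_add, Prod.snd_add, Int.cast_add]; ring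
  have e4 : freq a b k.1 * freq a b l.1 + freq a b k.2 * freq a b l.2 ≤ wt a b k * wt a b l := by
    refine (abs_le_of_sq_le_sq' ?_ (by positivity)).2
    rw [mul_pow, e1, e2]
    unfold freqSq
    nlinarith [sq_nonneg (freq a b k.1 * freq a b l.2 - freq a b k.2 * freq a b l.1),
      sq_nonneg (freq a b k.1), sq_nonneg (freq a b l.1), sq_nonneg (freq a b k.2),
      sq_nonneg (freq a b l.2)]
  nlinarith

lemma wt_rpow_le_delta (a b : ℝ) {α : ℝ} (h0 : 0 ≤ α) (h2 : α ≤ 2) (k : ℤ × ℤ) :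
    wt a b k ^ (α / 2) ≤ delta a b α k := by
  have hf := freqSq_nonneg a b k
  refine Real.le_sqrt_of_sq_le ?_
  rw [← rpow_wt, fracSymbol]
  have := Real.rpow_add_le_add_rpow (p := α / 2) zero_le_one hf (by linarith) (by linarith)
  simpa using this

lemma delta_le (a b : ℝ) {α : ℝ} (h0 : 0 ≤ α) (k : ℤ × ℤ) :
    delta a b α k ≤ 2 * wt a b k ^ (α / 2) := by
  have hf := freqSq_nonneg a b k
  refine Real.sqrt_le_iff.2 ⟨by have := wt_pos a b k; positivity, ?_⟩
  rw [mul_pow, ← rpow_wt, fracSymbol]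
  have h1 : freqSq a b k ^ (α / 2) ≤ (1 + freqSq a b k) ^ (α / 2) :=
    Real.rpow_le_rpow hf (by linarith) (by linarith)
  have h2 : 1 ≤ (1 + freqSq a b k) ^ (α / 2) :=
    Real.one_le_rpow (by linarith) (by linarith)
  linarith

lemma delta_sq (a b α : ℝ) (k : ℤ × ℤ) : delta a b α k ^ 2 = 1 + fracSymbol a b α k :=
  Real.sq_sqrt (by
    have := Real.rpow_nonneg (freqSq_nonneg a b k) (α / 2)
    unfold fracSymbol; linarith)

/-! ### Fourier modes -/

lemma mode_add (a b : ℝ) (k l : ℤ × ℤ) (z : ℝ × ℝ) :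
    mode a b (k + l) z = mode a b k z * mode a b l z := by
  unfold mode
  rw [← Complex.exp_add]
  congr 1
  simp only [freq, Prod.fst_add, Prod.snd_add]
  push_cast; ring

lemma norm_mode (a b : ℝ) (k : ℤ × ℤ) (z : ℝ × ℝ) : ‖mode a b k z‖ = 1 := by
  rw [mode, mul_comm]; exact Complex.norm_exp_ofReal_mul_I _

lemma mode_zero (a b : ℝ) (z : ℝ × ℝ) : mode a b 0 z = 1 := by simp [mode, freq]

lemma continuous_mode (a b : ℝ) (k : ℤ × ℤ) : Continuous (mode a b k) := by
  unfold mode; fun_prop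

/-- The root of unity `exp (2πi j / N)`. -/
def rootN (N : ℕ) (j : ℤ) : ℂ := Complex.exp (2 * Real.pi * Complex.I * (j / N))

lemma rootN_pow (N : ℕ) [NeZero N] (j : ℤ) : rootN N j ^ N = 1 := by
  rw [rootN, ← Complex.exp_nat_mul, Complex.exp_eq_one_iff]
  refine ⟨j, ?_⟩
  have : (N : ℂ) ≠ 0 := Nat.cast_ne_zero.2 (NeZero.ne N)
  field_simp

lemma rootN_eq_one_iff (N : ℕ) [NeZero N] (j : ℤ) : rootN N j = 1 ↔ ((j : ℤ) : ZMod N) = 0 := by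
  have hN : (N : ℂ) ≠ 0 := Nat.cast_ne_zero.2 (NeZero.ne N)
  rw [rootN, Complex.exp_eq_one_iff, ZMod.intCast_zmod_eq_zero_iff_dvd]
  have h2 : (2 * Real.pi * Complex.I : ℂ) ≠ 0 := Complex.two_pi_I_ne_zero
  constructor
  · rintro ⟨n, hn⟩
    refine ⟨n, ?_⟩
    rw [mul_comm (n : ℂ)] at hn
    have := mul_left_cancel₀ h2 hn
    field_simp at this
    exact_mod_cast this
  · rintro ⟨n, rfl⟩
    refine ⟨n, ?_⟩
    push_cast; field_simp

lemma mode_gridPoint {a b : ℝ} (hab : a < b) {N : ℕ} [NeZero N] (k : ℤ × ℤ)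
    (p : Fin N × Fin N) :
    mode a b k (gridPoint a b N p) = rootN N k.1 ^ (p.1 : ℕ) * rootN N k.2 ^ (p.2 : ℕ) := by
  have hN : (N : ℂ) ≠ 0 := Nat.cast_ne_zero.2 (NeZero.ne N)
  have hb : ((b : ℂ) - a) ≠ 0 := by
    rw [← Complex.ofReal_sub, Complex.ofReal_ne_zero]; linarith
  rw [rootN, rootN, ← Complex.exp_nat_mul, ← Complex.exp_nat_mul, ← Complex.exp_add, mode]
  congr 1
  simp only [freq, gridPoint, meshSize]
  push_cast
  field_simp
  ring

lemma sum_mode_gridPoint {a b : ℝ} (hab : a < b) {N : ℕ} [NeZero N] {k : ℤ × ℤ}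
    (hk : ((k.1 : ZMod N), (k.2 : ZMod N)) ≠ 0) :
    ∑ p, mode a b k (gridPoint a b N p) = 0 := by
  have hg : ∀ j : ℤ, (j : ZMod N) ≠ 0 → ∑ i : Fin N, rootN N j ^ (i : ℕ) = 0 := fun j hj => by
    rw [Fin.sum_univ_eq_sum_range (fun i => rootN N j ^ i) N]
    have h1 := mul_geom_sum (rootN N j) N
    rw [rootN_pow, sub_self] at h1
    exact (mul_eq_zero.1 h1).resolve_left (sub_ne_zero.2 fun h => hj ((rootN_eq_one_iff N j).1 h))
  simp only [mode_gridPoint hab, Fintype.sum_prod_type, ← Finset.mul_sum, ← Finset.sum_mul]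
  by_cases h1 : (k.1 : ZMod N) = 0
  · rw [hg k.2 fun h2 => hk (Prod.ext h1 h2), mul_zero]
  · rw [hg k.1 h1, zero_mul]

lemma mode_gridPoint_eq_one {a b : ℝ} (hab : a < b) {N : ℕ} [NeZero N] {k : ℤ × ℤ}
    (h1 : (k.1 : ZMod N) = 0) (h2 : (k.2 : ZMod N) = 0) (p : Fin N × Fin N) :
    mode a b k (gridPoint a b N p) = 1 := by
  rw [mode_gridPoint hab, (rootN_eq_one_iff N _).2 h1, (rootN_eq_one_iff N _).2 h2]; simp

/-! ### The grid as a finite group -/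

/-- The residue classes of a lattice point. -/
def toGrp (N : ℕ) (k : ℤ × ℤ) : ZMod N × ZMod N := (k.1, k.2)

/-- The representative in `[-N/2, N/2)`. -/
def repInt {N : ℕ} (x : ZMod N) : ℤ := -(-x).valMinAbs

/-- The representative in `T_N` of a pair of residue classes. -/
def rep {N : ℕ} (x : ZMod N × ZMod N) : ℤ × ℤ := (repInt x.1, repInt x.2)

lemma coe_repInt {N : ℕ} (x : ZMod N) : ((repInt x : ℤ) : ZMod N) = x := by
  simp [repInt]

/-- The balanced representative of a class has the least absolute value in it, so reduction modulo N
never increases it. This makes the weight subadditive on the group of frequencies. -/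
lemma natAbs_repInt_add_le {N : ℕ} (x y : ZMod N) :
    (repInt (x + y)).natAbs ≤ (repInt x + repInt y).natAbs := by
  rw [repInt, repInt, repInt, ← neg_add, Int.natAbs_neg, Int.natAbs_neg, neg_add]
  exact ZMod.natAbs_valMinAbs_add_le (-x) (-y)

@[simp] lemma toGrp_rep {N : ℕ} (x : ZMod N × ZMod N) : toGrp N (rep x) = x :=
  Prod.ext (coe_repInt x.1) (coe_repInt x.2)

lemma toGrp_add (N : ℕ) (k l : ℤ × ℤ) : toGrp N (k + l) = toGrp N k + toGrp N l :=
  Prod.ext (by simp [toGrp]) (by simp [toGrp])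

lemma toGrp_sub (N : ℕ) (k l : ℤ × ℤ) : toGrp N (k - l) = toGrp N k - toGrp N l :=
  Prod.ext (by simp [toGrp]) (by simp [toGrp])

lemma toGrp_neg (N : ℕ) (k : ℤ × ℤ) : toGrp N (-k) = -toGrp N k :=
  Prod.ext (by simp [toGrp]) (by simp [toGrp])

lemma mode_congr {a b : ℝ} (hab : a < b) {N : ℕ} [NeZero N] {k l : ℤ × ℤ}
    (h : toGrp N k = toGrp N l) (p : Fin N × Fin N) :
    mode a b k (gridPoint a b N p) = mode a b l (gridPoint a b N p) := by
  have e : k = (k - l) + l := by abel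
  have h0 : toGrp N (k - l) = 0 := by rw [toGrp_sub, h, sub_self]
  rw [e, mode_add, mode_gridPoint_eq_one hab (congrArg Prod.fst h0) (congrArg Prod.snd h0),
    one_mul]

/-- `valMinAbs` takes values in (-N/2, N/2]; the two negations in `repInt` move the closed end to
-N/2, as T_N requires. -/
lemma repInt_mem {N : ℕ} [NeZero N] (hN : Even N) (x : ZMod N) :
    repInt x ∈ Finset.Ico (-((N : ℤ) / 2)) ((N : ℤ) / 2) := by
  have h := ZMod.valMinAbs_mem_Ioc (-x)
  obtain ⟨n, hn⟩ := hN
  rw [Set.mem_Ioc] at h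
  rw [Finset.mem_Ico, repInt]
  omega

lemma rep_mem {N : ℕ} [NeZero N] (hN : Even N) (x : ZMod N × ZMod N) : rep x ∈ indexSet N :=
  Finset.mem_product.2 ⟨repInt_mem hN x.1, repInt_mem hN x.2⟩

lemma rep_toGrp {N : ℕ} [NeZero N] (hN : Even N) {k : ℤ × ℤ} (hk : k ∈ indexSet N) :
    rep (toGrp N k) = k := by
  have key : ∀ j ∈ Finset.Ico (-((N : ℤ) / 2)) ((N : ℤ) / 2), repInt (j : ZMod N) = j := by
    intro j hj
    have h1 := repInt_mem hN (j : ZMod N)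
    have h2 : ((repInt (j : ZMod N) : ℤ) : ZMod N) = (j : ZMod N) := coe_repInt _
    rw [ZMod.intCast_eq_intCast_iff_dvd_sub] at h2
    rw [Finset.mem_Ico] at hj h1
    obtain ⟨n, hn⟩ := hN
    have h3 : |j - repInt (j : ZMod N)| < N := by rw [abs_lt]; omega
    have := Int.eq_zero_of_abs_lt_dvd h2 h3
    omega
  obtain ⟨h1, h2⟩ := Finset.mem_product.1 hk
  exact Prod.ext (key _ h1) (key _ h2)

/-- Sums over `T_N` are sums over the finite group. -/
lemma sum_indexSet {N : ℕ} [NeZero N] (hN : Even N) {E : Type*} [AddCommMonoid E]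
    (f : ℤ × ℤ → E) : ∑ k ∈ indexSet N, f k = ∑ x : ZMod N × ZMod N, f (rep x) :=
  (Finset.sum_bij' (fun x _ => rep x) (fun k _ => toGrp N k) (fun x _ => rep_mem hN x)
    (fun _ _ => Finset.mem_univ _) (fun x _ => toGrp_rep x) (fun _ hk => rep_toGrp hN hk)
    (fun _ _ => rfl)).symm

/-- The grid of the pseudo-spectral scheme. -/
def gridSystem {a b α : ℝ} (hab : a < b) (h0 : 0 ≤ α) (h2 : α ≤ 2) (N : ℕ) [NeZero N] :
    GridSystem (ZMod N × ZMod N) (Fin N × Fin N) (α / 2) where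
  e x p := mode a b (rep x) (gridPoint a b N p)
  e_add x y p := by
    rw [← mode_add]
    exact mode_congr hab (by rw [toGrp_add]; simp) p
  norm_e x p := norm_mode a b _ _
  sum_e x hx := sum_mode_gridPoint hab (by
    change toGrp N (rep x) ≠ 0
    rwa [toGrp_rep])
  card_eq := by simp [ZMod.card]
  w x := wt a b (rep x)
  one_le_w x := one_le_wt a b _
  w_add_le x y := by
    refine le_trans (wt_mono a b ?_ ?_) (wt_add_le a b (rep x) (rep y))
    · exact natAbs_repInt_add_le x.1 y.1
    · exact natAbs_repInt_add_le x.2 y.2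
  δ x := delta a b α (rep x)
  le_δ x := wt_rpow_le_delta a b h0 h2 _
  δ_le x := delta_le a b h0 _

section Grid

variable {a b α : ℝ} (hab : a < b) (h0 : 0 ≤ α) (h2 : α ≤ 2) {N : ℕ} [NeZero N]

lemma anal_gridSystem (g : Grid N) (x : ZMod N × ZMod N) :
    (gridSystem hab h0 h2 N).anal g x = discreteCoeff a b g (rep x) := by
  unfold GridSystem.anal discreteCoeff
  congr 1
  · simp [Fintype.card_prod, sq]
  · refine Finset.sum_congr rfl fun p _ => ?_
    congr 1
    exact mode_congr hab (by rw [toGrp_neg]; simp) p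

lemma multiplier_eq_synth (hN : Even N) (s : ℤ × ℤ → ℂ) (g : Grid N) :
    multiplier a b s g = (gridSystem hab h0 h2 N).synth
      fun x => s (rep x) * (gridSystem hab h0 h2 N).anal g x := by
  funext p
  simp only [multiplier, GridSystem.synth, sum_indexSet hN, anal_gridSystem]
  rfl

lemma anal_multiplier (hN : Even N) (s : ℤ × ℤ → ℂ) (g : Grid N) (x : ZMod N × ZMod N) :
    (gridSystem hab h0 h2 N).anal (multiplier a b s g) x
      = s (rep x) * (gridSystem hab h0 h2 N).anal g x := by
  rw [multiplier_eq_synth hab h0 h2 hN, GridSystem.anal_synth]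

/-- Discrete Fourier coefficients of a mode. -/
lemma anal_mode (k : ℤ × ℤ) (x : ZMod N × ZMod N) :
    (gridSystem hab h0 h2 N).anal (fun p => mode a b k (gridPoint a b N p)) x
      = if toGrp N k = x then 1 else 0 := by
  have e : (fun p => mode a b k (gridPoint a b N p))
      = (gridSystem hab h0 h2 N).synth fun y => if toGrp N k = y then 1 else 0 := by
    funext p
    simp only [GridSystem.synth, ite_mul, one_mul, zero_mul, Finset.sum_ite_eq,
      Finset.mem_univ, if_true]
    exact mode_congr hab (by simp) p
  rw [e, GridSystem.anal_synth]

end Grid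

/-! ### Lattice sums -/

lemma summable_one_add_sq_rpow {s : ℝ} (hs : 1 < s) :
    Summable fun n : ℤ => (1 + (n : ℝ) ^ 2) ^ (-(s / 2)) := by
  refine Summable.of_norm_bounded_eventually (Real.summable_abs_int_rpow hs) ?_
  have : ∀ᶠ n : ℤ in Filter.cofinite, n ≠ 0 := by
    simpa using (Set.finite_singleton (0 : ℤ)).compl_mem_cofinite
  filter_upwards [this] with n hn
  have hn' : 0 < |(n : ℝ)| := by positivity
  rw [Real.norm_of_nonneg (by positivity)]
  have : |(n : ℝ)| ^ (-s) = (|(n : ℝ)| ^ 2) ^ (-(s / 2)) := by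
    rw [← Real.rpow_natCast, ← Real.rpow_mul hn'.le]; congr 1; push_cast; ring
  rw [this, sq_abs]
  exact Real.rpow_le_rpow_of_nonpos (by positivity) (by linarith) (by linarith)

/-- From (1 + x²)(1 + y²) ≤ (1 + x² + y²)² the terms are dominated by a product of two
one-dimensional series with exponent s > 1. This is where the dimension two enters. -/
lemma summable_lattice {s : ℝ} (hs : 1 < s) :
    Summable fun k : ℤ × ℤ => (1 + (k.1 : ℝ) ^ 2 + (k.2 : ℝ) ^ 2) ^ (-s) := by
  have h := (summable_one_add_sq_rpow hs).mul_of_nonneg (summable_one_add_sq_rpow hs)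
    (fun n => by positivity) (fun n => by positivity)
  refine Summable.of_nonneg_of_le (fun k => by positivity) (fun k => ?_) h
  have e : (1 + (k.1 : ℝ) ^ 2 + (k.2 : ℝ) ^ 2) ^ (-s)
      = ((1 + (k.1 : ℝ) ^ 2 + (k.2 : ℝ) ^ 2) ^ 2) ^ (-(s / 2)) := by
    rw [← Real.rpow_natCast (_ + _), ← Real.rpow_mul (by positivity)]; congr 1; push_cast; ring
  rw [e, ← Real.mul_rpow (by positivity) (by positivity)]
  refine Real.rpow_le_rpow_of_nonpos (by positivity) ?_ (by linarith)
  nlinarith [sq_nonneg (k.1 : ℝ), sq_nonneg (k.2 : ℝ)]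

/-- The lattice sum `∑ (1 + |j|²)^{-s}`. -/
def latticeSum (s : ℝ) : ℝ := ∑' k : ℤ × ℤ, (1 + (k.1 : ℝ) ^ 2 + (k.2 : ℝ) ^ 2) ^ (-s)

lemma sum_lattice_le {s : ℝ} (hs : 1 < s) (F : Finset (ℤ × ℤ)) :
    ∑ k ∈ F, (1 + (k.1 : ℝ) ^ 2 + (k.2 : ℝ) ^ 2) ^ (-s) ≤ latticeSum s :=
  (summable_lattice hs).sum_le_tsum _ fun k _ => by positivity

lemma latticeSum_nonneg (s : ℝ) : 0 ≤ latticeSum s := tsum_nonneg fun k => by positivity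

/-- The constant bounding `∑ w^{-2s}`. -/
def weightSum (a b s : ℝ) : ℝ := min 1 ((2 * Real.pi / (b - a)) ^ 2) ^ (-s) * latticeSum s

lemma wt_rpow_neg_le {a b : ℝ} (hab : a < b) {s : ℝ} (hs : 0 ≤ s) (k : ℤ × ℤ) :
    wt a b k ^ (-(2 * s)) ≤ min 1 ((2 * Real.pi / (b - a)) ^ 2) ^ (-s)
      * (1 + (k.1 : ℝ) ^ 2 + (k.2 : ℝ) ^ 2) ^ (-s) := by
  have hba : 0 < b - a := by linarith
  have hc : 0 < min 1 ((2 * Real.pi / (b - a)) ^ 2) := by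
    have := Real.pi_pos
    exact lt_min one_pos (by positivity)
  have e : wt a b k ^ (-(2 * s)) = (wt a b k ^ 2) ^ (-s) := by
    rw [← Real.rpow_natCast, ← Real.rpow_mul (wt_pos a b k).le]; congr 1; push_cast; ring
  rw [e, ← Real.mul_rpow hc.le (by positivity), wt_sq, freqSq_eq]
  refine Real.rpow_le_rpow_of_nonpos (by positivity) ?_ (by linarith)
  have h1 := min_le_left 1 ((2 * Real.pi / (b - a)) ^ 2)
  have h2 := min_le_right 1 ((2 * Real.pi / (b - a)) ^ 2)
  have h3 : 0 ≤ (k.1 : ℝ) ^ 2 + (k.2 : ℝ) ^ 2 := by positivity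
  nlinarith

lemma sum_wt_le {a b : ℝ} (hab : a < b) {s : ℝ} (hs : 1 < s) (F : Finset (ℤ × ℤ)) :
    ∑ k ∈ F, wt a b k ^ (-(2 * s)) ≤ weightSum a b s := by
  refine (Finset.sum_le_sum fun k _ => wt_rpow_neg_le hab (by linarith) k).trans ?_
  rw [← Finset.mul_sum, weightSum]
  refine mul_le_mul_of_nonneg_left (sum_lattice_le hs F) ?_
  have := Real.pi_pos
  have hba : 0 < b - a := by linarith
  positivity

lemma sum_w_gridSystem_le {a b α : ℝ} (hab : a < b) (h0 : 0 ≤ α) (h2 : α ≤ 2) {N : ℕ} [NeZero N]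
    {s : ℝ} (hs : 1 < s) :
    ∑ x, (gridSystem hab h0 h2 N).w x ^ (-(2 * s)) ≤ weightSum a b s := by
  have hinj : Function.Injective (rep : ZMod N × ZMod N → ℤ × ℤ) :=
    Function.LeftInverse.injective (g := toGrp N) toGrp_rep
  have := sum_wt_le hab hs (Finset.univ.map ⟨_, hinj⟩)
  rwa [Finset.sum_map] at this

end NSFSGE

namespace NSFSGE

/-! ### The square and the torus -/

/-- The two-dimensional torus. -/
abbrev Torus : Type := UnitAddTorus (Fin 2)

/-- The quotient map from the plane to the torus. -/
def toTorus (a b : ℝ) (z : ℝ × ℝ) : Torus :=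
  ![(((z.1 - a) / (b - a) : ℝ) : UnitAddCircle), (((z.2 - a) / (b - a) : ℝ) : UnitAddCircle)]

lemma continuous_toTorus (a b : ℝ) : Continuous (toTorus a b) := by
  refine continuous_pi fun i => ?_
  fin_cases i
  · exact (AddCircle.continuous_mk' 1).comp (by fun_prop)
  · exact (AddCircle.continuous_mk' 1).comp (by fun_prop)

/-- The characters of the torus. -/
def chr (k : ℤ × ℤ) : C(Torus, ℂ) := UnitAddTorus.mFourier ![k.1, k.2]

lemma chr_toTorus (a b : ℝ) (k : ℤ × ℤ) (z : ℝ × ℝ) : chr k (toTorus a b z) = mode a b k z := by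
  simp only [chr, UnitAddTorus.mFourier, ContinuousMap.coe_mk, Fin.prod_univ_two, toTorus,
    Matrix.cons_val_zero, Matrix.cons_val_one, fourier_coe_apply]
  rw [← Complex.exp_add, mode]
  congr 1
  simp only [freq]
  push_cast
  simp only [div_one]
  ring

lemma norm_chr (k : ℤ × ℤ) : ‖chr k‖ = 1 := UnitAddTorus.mFourier_norm

lemma span_chr_closure : (Submodule.span ℂ (Set.range chr)).topologicalClosure = ⊤ := by
  rw [← UnitAddTorus.span_mFourier_closure_eq_top (d := Fin 2)]
  congr 2
  ext f
  constructor
  · rintro ⟨k, rfl⟩; exact ⟨_, rfl⟩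
  · rintro ⟨n, rfl⟩
    refine ⟨(n 0, n 1), ?_⟩
    unfold chr
    congr 1
    ext i; fin_cases i <;> rfl

lemma isOpen_square (a b : ℝ) : IsOpen (square a b) := isOpen_Ioo.prod isOpen_Ioo

lemma closure_square {a b : ℝ} (hab : a < b) :
    closure (square a b) = Set.Icc a b ×ˢ Set.Icc a b := by
  rw [square, closure_prod_eq, closure_Ioo hab.ne]

lemma volume_square {a b : ℝ} (hab : a < b) :
    (volume (square a b)).toReal = (b - a) ^ 2 := by
  have : 0 ≤ b - a := by linarith
  rw [square, Measure.volume_eq_prod, Measure.prod_prod, Real.volume_Ioo, ENNReal.toReal_mul,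
    ENNReal.toReal_ofReal this]; ring

lemma volume_square_lt_top (a b : ℝ) : volume (square a b) < ⊤ := by
  rw [square, Measure.volume_eq_prod, Measure.prod_prod, Real.volume_Ioo]
  exact ENNReal.mul_lt_top ENNReal.ofReal_lt_top ENNReal.ofReal_lt_top

instance (a b : ℝ) : IsFiniteMeasure (volume.restrict (square a b)) :=
  ⟨by rw [Measure.restrict_apply_univ]; exact volume_square_lt_top a b⟩

lemma integrableOn_of_continuous (a b : ℝ) {f : ℝ × ℝ → ℂ} (hf : Continuous f) :
    IntegrableOn f (square a b) := by
  have h : IntegrableOn f (Set.Icc a b ×ˢ Set.Icc a b) :=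
    hf.continuousOn.integrableOn_compact (isCompact_Icc.prod isCompact_Icc)
  exact h.mono_set (Set.prod_mono Set.Ioo_subset_Icc_self Set.Ioo_subset_Icc_self)

section Pairing

variable (a b : ℝ) {w : ℝ × ℝ → ℂ} (hw : IntegrableOn w (square a b))
include hw

lemma integrableOn_mul_torus (F : C(Torus, ℂ)) :
    IntegrableOn (fun z => w z * F (toTorus a b z)) (square a b) :=
  Integrable.mul_bdd (c := ‖F‖) hw
    (F.continuous.comp (continuous_toTorus a b)).aestronglyMeasurable
    (Filter.Eventually.of_forall fun _ => F.norm_coe_le_norm _)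

/-- Integration against functions on the torus. -/
def pairing : C(Torus, ℂ) →L[ℂ] ℂ :=
  LinearMap.mkContinuous
    { toFun := fun F => ∫ z in square a b, w z * F (toTorus a b z)
      map_add' := fun F H => by
        rw [← integral_add (integrableOn_mul_torus a b hw F) (integrableOn_mul_torus a b hw H)]
        simp [mul_add]
      map_smul' := fun r F => by
        rw [RingHom.id_apply, smul_eq_mul, ← integral_const_mul]
        refine integral_congr_ae (Filter.Eventually.of_forall fun z => ?_)
        simp only [ContinuousMap.smul_apply, smul_eq_mul]; ring }
    (∫ z in square a b, ‖w z‖) fun F => by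
      change ‖∫ z in square a b, w z * F (toTorus a b z)‖ ≤ _
      rw [← integral_mul_const]
      refine norm_integral_le_of_norm_le (hw.norm.mul_const _)
        (Filter.Eventually.of_forall fun z => ?_)
      rw [norm_mul]
      exact mul_le_mul_of_nonneg_left (F.norm_coe_le_norm _) (norm_nonneg _)

lemma pairing_apply (F : C(Torus, ℂ)) :
    pairing a b hw F = ∫ z in square a b, w z * F (toTorus a b z) := rfl

lemma coeff_eq_pairing (k : ℤ × ℤ) :
    coeff a b w k = (1 / ((b - a) ^ 2 : ℝ) : ℂ) * pairing a b hw (chr (-k)) := by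
  simp only [coeff, pairing_apply, chr_toTorus]

end Pairing

/-- The pairing is continuous in the sup norm and vanishes on the characters, whose span is dense in
the continuous functions on the torus. -/
lemma pairing_eq_zero {a b : ℝ} (hab : a < b) {w : ℝ × ℝ → ℂ} (hw : IntegrableOn w (square a b))
    (h : ∀ k, coeff a b w k = 0) (F : C(Torus, ℂ)) : pairing a b hw F = 0 := by
  have h1 : Submodule.span ℂ (Set.range chr) ≤ LinearMap.ker (pairing a b hw).toLinearMap := by
    rw [Submodule.span_le]
    rintro _ ⟨k, rfl⟩
    have := h (-k)
    rw [coeff_eq_pairing a b hw, neg_neg, mul_eq_zero] at this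
    refine this.resolve_left ?_
    have : ((b - a) ^ 2 : ℝ) ≠ 0 := pow_ne_zero 2 (by linarith)
    exact one_div_ne_zero (Complex.ofReal_ne_zero.2 this)
  have h2 := Submodule.topologicalClosure_minimal _ h1 (pairing a b hw).isClosed_ker
  rw [span_chr_closure] at h2
  exact h2 Submodule.mem_top

/-- Functions supported in the open square descend to the torus. -/
lemma exists_torus_extension {a b : ℝ} (hab : a < b) {φ : ℝ × ℝ → ℝ} (hφ : Continuous φ)
    (hs : tsupport φ ⊆ square a b) :
    ∃ F : C(Torus, ℂ), ∀ z ∈ square a b, F (toTorus a b z) = φ z := by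
  have hba : 0 < b - a := by linarith
  have hz : ∀ z, z ∉ square a b → φ z = 0 := fun z hz =>
    image_eq_zero_of_notMem_tsupport fun h => hz (hs h)
  have hout : ∀ x y, (x = a ∨ x = b ∨ y = a ∨ y = b) → φ (x, y) = 0 := by
    rintro x y h
    refine hz _ fun hm => ?_
    obtain ⟨⟨h1, h2⟩, h3, h4⟩ := hm
    simp only at h1 h2 h3 h4
    rcases h with rfl | rfl | rfl | rfl <;> linarith
  -- The descent is made one variable at a time: as a function of the second coordinate with values
  -- in functions of the first, then with the roles exchanged. Since φ vanishes on the boundary of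
  -- the square, the values at the two ends of a period agree each time.
  let A : C(ℝ, C(ℝ, ℂ)) := ContinuousMap.curry
    ⟨fun p : ℝ × ℝ => ((φ (a + (b - a) * p.2, a + (b - a) * p.1) : ℝ) : ℂ), by fun_prop⟩
  have hA : ∀ t s, A t s = ((φ (a + (b - a) * s, a + (b - a) * t) : ℝ) : ℂ) := fun t s => rfl
  have hA01 : A 0 = A (0 + 1) := by
    ext s
    rw [hA, hA, hout _ _ (by simp), hout _ _ (by simp)]
  let A1 : C(UnitAddCircle, C(ℝ, ℂ)) := ⟨AddCircle.liftIco 1 0 A,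
    AddCircle.liftIco_continuous hA01 A.continuous.continuousOn⟩
  have hA1 : ∀ t ∈ Set.Ico (0 : ℝ) (0 + 1), A1 (t : UnitAddCircle) = A t := fun t ht =>
    AddCircle.liftIco_coe_apply (f := A) ht
  have hA1' : ∀ θ : UnitAddCircle, ∀ s, (s = 0 ∨ s = 1) → A1 θ s = 0 := by
    intro θ s hs
    obtain ⟨t, ht, rfl⟩ : ∃ t ∈ Set.Ico (0 : ℝ) (0 + 1), (t : UnitAddCircle) = θ := by
      have := AddCircle.coe_image_Ico_eq (1 : ℝ) 0
      have h2 : θ ∈ ((↑) : ℝ → UnitAddCircle) '' Set.Ico 0 (0 + 1) := by rw [this]; trivial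
      exact h2
    rw [hA1 t ht, hA, hout]
    · simp
    · rcases hs with rfl | rfl <;> simp
  let A2 : C(ℝ, C(UnitAddCircle, ℂ)) := ContinuousMap.curry
    ⟨fun p : ℝ × UnitAddCircle => A1 p.2 p.1,
      (ContinuousMap.continuous_uncurry_of_continuous A1).comp continuous_swap⟩
  have hA2 : ∀ s θ, A2 s θ = A1 θ s := fun s θ => rfl
  have hA201 : A2 0 = A2 (0 + 1) := by
    ext θ
    rw [hA2, hA2, hA1' θ _ (by simp), hA1' θ _ (by simp)]
  let A3 : C(UnitAddCircle, C(UnitAddCircle, ℂ)) := ⟨AddCircle.liftIco 1 0 A2,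
    AddCircle.liftIco_continuous hA201 A2.continuous.continuousOn⟩
  have hA3 : ∀ t ∈ Set.Ico (0 : ℝ) (0 + 1), A3 (t : UnitAddCircle) = A2 t := fun t ht =>
    AddCircle.liftIco_coe_apply (f := A2) ht
  have hc := ContinuousMap.continuous_uncurry_of_continuous A3
  have hc' : Continuous fun x : Torus => A3 (x 0) (x 1) :=
    Continuous.comp (g := Function.uncurry fun x y => A3 x y) (f := fun x : Torus => (x 0, x 1))
      hc ((continuous_apply 0).prodMk (continuous_apply 1))
  refine ⟨⟨fun x => A3 (x 0) (x 1), hc'⟩, fun z hz => ?_⟩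
  obtain ⟨⟨h1, h2⟩, h3, h4⟩ := hz
  have m1 : (z.1 - a) / (b - a) ∈ Set.Ico (0 : ℝ) (0 + 1) := by
    constructor
    · exact div_nonneg (by linarith) hba.le
    · rw [zero_add, div_lt_one hba]; linarith
  have m2 : (z.2 - a) / (b - a) ∈ Set.Ico (0 : ℝ) (0 + 1) := by
    constructor
    · exact div_nonneg (by linarith) hba.le
    · rw [zero_add, div_lt_one hba]; linarith
  change A3 (((z.1 - a) / (b - a) : ℝ) : UnitAddCircle)
    (((z.2 - a) / (b - a) : ℝ) : UnitAddCircle) = _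
  rw [hA3 _ m1, hA2, hA1 _ m2, hA, mul_div_cancel₀ _ hba.ne', mul_div_cancel₀ _ hba.ne']
  simp

/-- Uniqueness of Fourier coefficients. -/
lemma ae_eq_zero_of_coeff {a b : ℝ} (hab : a < b) {w : ℝ × ℝ → ℂ}
    (hw : IntegrableOn w (square a b)) (h : ∀ k, coeff a b w k = 0) :
    ∀ᵐ z ∂(volume.restrict (square a b)), w z = 0 := by
  rw [ae_restrict_iff' (isOpen_square a b).measurableSet]
  -- Test functions with compact support in the open square descend to the torus, where the pairing
  -- is already known to vanish.
  refine (isOpen_square a b).ae_eq_zero_of_integral_contDiff_smul_eq_zero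
    hw.locallyIntegrableOn fun g hg _ hsupp => ?_
  obtain ⟨F, hF⟩ := exists_torus_extension hab hg.continuous hsupp
  rw [← pairing_eq_zero hab hw h F, pairing_apply,
    ← setIntegral_eq_integral_of_forall_compl_eq_zero (s := square a b)]
  · refine setIntegral_congr_fun (isOpen_square a b).measurableSet fun z hz => ?_
    simp only [hF z hz, Complex.real_smul]; ring
  · intro z hz
    rw [image_eq_zero_of_notMem_tsupport fun h' => hz (hsupp h'), zero_smul]

/-! ### Fourier series -/

lemma coeff_add (a b : ℝ) {f g : ℝ × ℝ → ℂ} (hf : IntegrableOn f (square a b))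
    (hg : IntegrableOn g (square a b)) (k : ℤ × ℤ) :
    coeff a b (fun z => f z + g z) k = coeff a b f k + coeff a b g k := by
  have hf' := integrableOn_mul_torus a b hf (chr (-k))
  have hg' := integrableOn_mul_torus a b hg (chr (-k))
  simp only [chr_toTorus] at hf' hg'
  simp only [coeff, add_mul]
  rw [integral_add hf' hg', mul_add]

lemma coeff_const_mul (a b : ℝ) (r : ℂ) (f : ℝ × ℝ → ℂ) (k : ℤ × ℤ) :
    coeff a b (fun z => r * f z) k = r * coeff a b f k := by
  simp only [coeff, mul_assoc, integral_const_mul]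
  ring

lemma coeff_sub (a b : ℝ) {f g : ℝ × ℝ → ℂ} (hf : IntegrableOn f (square a b))
    (hg : IntegrableOn g (square a b)) (k : ℤ × ℤ) :
    coeff a b (fun z => f z - g z) k = coeff a b f k - coeff a b g k := by
  have h := coeff_add a b hf (g := fun z => (-1) * g z) (hg.const_mul (-1)) k
  rw [coeff_const_mul] at h
  simpa [sub_eq_add_neg] using h

lemma coeff_congr {a b : ℝ} {f g : ℝ × ℝ → ℂ}
    (h : ∀ᵐ z ∂(volume.restrict (square a b)), f z = g z) (k : ℤ × ℤ) :
    coeff a b f k = coeff a b g k := by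
  unfold coeff
  congr 1
  refine integral_congr_ae ?_
  filter_upwards [h] with z hz
  rw [hz]

lemma integral_exp_freq {a b : ℝ} (hab : a < b) {j : ℤ} (hj : j ≠ 0) :
    ∫ x in Set.Ioo a b, Complex.exp (Complex.I * ((freq a b j * (x - a) : ℝ) : ℂ)) = 0 := by
  have hba : ((b : ℂ) - a) ≠ 0 := by
    rw [← Complex.ofReal_sub, Complex.ofReal_ne_zero]; linarith
  have hμ : Complex.I * (freq a b j : ℂ) ≠ 0 := by
    refine mul_ne_zero Complex.I_ne_zero (Complex.ofReal_ne_zero.2 ?_)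
    have := Real.pi_pos
    have h2 : b - a ≠ 0 := by linarith
    have h3 : (j : ℝ) ≠ 0 := Int.cast_ne_zero.2 hj
    unfold freq; positivity
  have e : ∀ x : ℝ, Complex.exp (Complex.I * ((freq a b j * (x - a) : ℝ) : ℂ))
      = Complex.exp (-(Complex.I * (freq a b j : ℂ) * a))
        * Complex.exp (Complex.I * (freq a b j : ℂ) * x) := fun x => by
    rw [← Complex.exp_add]; congr 1; push_cast; ring
  rw [← integral_Ioc_eq_integral_Ioo, ← intervalIntegral.integral_of_le hab.le]
  simp only [e]
  rw [intervalIntegral.integral_const_mul, integral_exp_mul_complex hμ]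
  have e2 : Complex.exp (Complex.I * (freq a b j : ℂ) * b)
      = Complex.exp (Complex.I * (freq a b j : ℂ) * a) := by
    rw [Complex.exp_eq_exp_iff_exists_int]
    refine ⟨j, ?_⟩
    unfold freq; push_cast
    field_simp; ring
  rw [e2]; simp

lemma coeff_mode {a b : ℝ} (hab : a < b) (l k : ℤ × ℤ) :
    coeff a b (mode a b l) k = if l = k then 1 else 0 := by
  have e : ∀ z, mode a b l z * mode a b (-k) z = mode a b (l - k) z := fun z => by
    rw [← mode_add, sub_eq_add_neg]
  simp only [coeff, e]
  split_ifs with h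
  · subst h
    simp only [sub_self, mode_zero]
    rw [setIntegral_const, measureReal_def, volume_square hab]
    have : ((b : ℂ) - a) ≠ 0 := by
      rw [← Complex.ofReal_sub, Complex.ofReal_ne_zero]; linarith
    simp only [Complex.real_smul]
    push_cast
    field_simp
  · have e2 : ∀ z : ℝ × ℝ, mode a b (l - k) z
        = Complex.exp (Complex.I * ((freq a b (l - k).1 * (z.1 - a) : ℝ) : ℂ))
          * Complex.exp (Complex.I * ((freq a b (l - k).2 * (z.2 - a) : ℝ) : ℂ)) := fun z => by
      rw [mode, ← Complex.exp_add]; congr 1; push_cast; ring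
    simp only [e2]
    rw [square, Measure.volume_eq_prod, setIntegral_prod_mul
      (fun x : ℝ => Complex.exp (Complex.I * ((freq a b (l - k).1 * (x - a) : ℝ) : ℂ)))
      (fun y : ℝ => Complex.exp (Complex.I * ((freq a b (l - k).2 * (y - a) : ℝ) : ℂ)))]
    by_cases h1 : (l - k).1 = 0
    · have h2 : (l - k).2 ≠ 0 := fun h2 => h (sub_eq_zero.1 (Prod.ext h1 h2))
      rw [integral_exp_freq hab h2]; simp
    · rw [integral_exp_freq hab h1]; simp

/-- The Fourier series with given coefficients. -/
def series (c : ℤ × ℤ → ℂ) : C(Torus, ℂ) := ∑' k, c k • chr k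

lemma hasSum_series {c : ℤ × ℤ → ℂ} (hc : Summable fun k => ‖c k‖) :
    HasSum (fun k => c k • chr k) (series c) := by
  refine Summable.hasSum (Summable.of_norm ?_)
  simpa [norm_smul, norm_chr] using hc

lemma hasSum_series_apply (a b : ℝ) {c : ℤ × ℤ → ℂ} (hc : Summable fun k => ‖c k‖)
    (z : ℝ × ℝ) : HasSum (fun k => c k * mode a b k z) (series c (toTorus a b z)) := by
  have h := (hasSum_series hc).mapL (ContinuousMap.evalCLM ℂ (toTorus a b z))
  simpa [chr_toTorus] using h

lemma continuous_torus_comp (a b : ℝ) (F : C(Torus, ℂ)) :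
    Continuous fun z => F (toTorus a b z) := F.continuous.comp (continuous_toTorus a b)

lemma coeff_series {a b : ℝ} (hab : a < b) {c : ℤ × ℤ → ℂ} (hc : Summable fun k => ‖c k‖)
    (k : ℤ × ℤ) : coeff a b (fun z => series c (toTorus a b z)) k = c k := by
  have hm := integrableOn_of_continuous a b (continuous_mode a b (-k))
  have e1 : coeff a b (fun z => series c (toTorus a b z)) k
      = (1 / ((b - a) ^ 2 : ℝ) : ℂ) * pairing a b hm (series c) := by
    simp only [coeff, pairing_apply, mul_comm]
  have e2 : ∀ l, (1 / ((b - a) ^ 2 : ℝ) : ℂ) * pairing a b hm (c l • chr l)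
      = if l = k then c l else 0 := fun l => by
    have := coeff_mode hab l k
    simp only [coeff] at this
    simp only [map_smul, pairing_apply, chr_toTorus, mul_comm (mode a b (-k) _), smul_eq_mul]
    rw [mul_left_comm, this]; simp
  have h := ((hasSum_series hc).mapL (pairing a b hm)).mul_left
    (1 / ((b - a) ^ 2 : ℝ) : ℂ)
  simp only [e2] at h
  rw [e1]
  refine h.unique ?_
  refine (hasSum_ite_eq k (c k)).congr_fun fun l => ?_
  by_cases hl : l = k
  · simp [hl]
  · simp [hl]

/-- An integrable function with summable Fourier coefficients is the sum of its series. -/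
lemma ae_eq_series {a b : ℝ} (hab : a < b) {w : ℝ × ℝ → ℂ} (hw : IntegrableOn w (square a b))
    (hc : Summable fun k => ‖coeff a b w k‖) :
    ∀ᵐ z ∂(volume.restrict (square a b)), w z = series (coeff a b w) (toTorus a b z) := by
  have h2 := integrableOn_of_continuous a b (continuous_torus_comp a b (series (coeff a b w)))
  have h := ae_eq_zero_of_coeff hab (hw.sub h2) fun k => by
    have := coeff_sub a b hw h2 k
    rw [coeff_series hab hc, sub_self] at this
    exact this
  filter_upwards [h] with z hz
  exact sub_eq_zero.1 hz

/-- A continuous function with summable Fourier coefficients is the sum of its series. -/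
lemma eqOn_series {a b : ℝ} (hab : a < b) {w : ℝ × ℝ → ℂ} (hw : Continuous w)
    (hc : Summable fun k => ‖coeff a b w k‖) :
    ∀ z ∈ Set.Icc a b ×ˢ Set.Icc a b, w z = series (coeff a b w) (toTorus a b z) := by
  have h := Measure.eqOn_open_of_ae_eq
    (ae_eq_series hab (integrableOn_of_continuous a b hw) hc) (isOpen_square a b)
    hw.continuousOn (continuous_torus_comp a b _).continuousOn
  rw [← closure_square hab]
  exact h.closure hw (continuous_torus_comp a b _)

end NSFSGE

namespace NSFSGE

/-! ### Riemann sums of functions on the torus -/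

lemma tendsto_of_span_dense {E : Type*} [NormedAddCommGroup E] [NormedSpace ℂ E]
    {L : ℕ → E →ₗ[ℂ] ℂ} {L₀ : E →ₗ[ℂ] ℂ} (hL : ∀ n x, ‖L n x‖ ≤ ‖x‖) (hL₀ : ∀ x, ‖L₀ x‖ ≤ ‖x‖)
    {s : Set E} (hs : (Submodule.span ℂ s).topologicalClosure = ⊤)
    (h : ∀ x ∈ s, Filter.Tendsto (fun n => L n x) Filter.atTop (nhds (L₀ x))) (x : E) :
    Filter.Tendsto (fun n => L n x) Filter.atTop (nhds (L₀ x)) := by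
  have hspan : ∀ y ∈ Submodule.span ℂ s,
      Filter.Tendsto (fun n => L n y) Filter.atTop (nhds (L₀ y)) := fun y hy => by
    induction hy using Submodule.span_induction with
    | mem y hy => exact h y hy
    | zero => simp
    | add y z _ _ h1 h2 => simpa using h1.add h2
    | smul r y _ h1 => simpa using h1.const_mul r
  have hx : x ∈ closure (Submodule.span ℂ s : Set E) := by
    rw [← Submodule.topologicalClosure_coe, hs]; trivial
  rw [Metric.tendsto_atTop]
  intro ε hε
  obtain ⟨y, hy, hxy⟩ := Metric.mem_closure_iff.1 hx (ε / 3) (by linarith)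
  obtain ⟨n₀, hn₀⟩ := Metric.tendsto_atTop.1 (hspan y hy) (ε / 3) (by linarith)
  refine ⟨n₀, fun n hn => ?_⟩
  rw [dist_eq_norm] at hxy
  have h1 := hL n (x - y)
  have h2 := hL₀ (x - y)
  have h3 := hn₀ n hn
  rw [map_sub] at h1 h2
  rw [dist_eq_norm] at h3 ⊢
  have e : L n x - L₀ x = (L n x - L n y) + (L n y - L₀ y) - (L₀ x - L₀ y) := by ring
  rw [e]
  have h4 := norm_sub_le ((L n x - L n y) + (L n y - L₀ y)) (L₀ x - L₀ y)
  have h5 := norm_add_le (L n x - L n y) (L n y - L₀ y)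
  linarith

/-- The values of a function on the torus at the grid points. -/
def onGrid (a b : ℝ) (N : ℕ) (F : C(Torus, ℂ)) : Grid N := fun p =>
  F (toTorus a b (gridPoint a b N p))

/-- The mean value over the grid. -/
def gridMean (a b : ℝ) (N : ℕ) : C(Torus, ℂ) →ₗ[ℂ] ℂ where
  toFun F := discreteCoeff a b (onGrid a b N F) 0
  map_add' F H := by
    simp [discreteCoeff, onGrid, add_mul, Finset.sum_add_distrib, mul_add]
  map_smul' r F := by
    simp only [discreteCoeff, onGrid, ContinuousMap.smul_apply, smul_eq_mul, mul_assoc,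
      ← Finset.mul_sum, RingHom.id_apply]
    ring

/-- The mean value over the square. -/
def squareMean (a b : ℝ) : C(Torus, ℂ) →ₗ[ℂ] ℂ where
  toFun F := coeff a b (fun z => F (toTorus a b z)) 0
  map_add' F H := coeff_add a b (integrableOn_of_continuous a b (continuous_torus_comp a b F))
    (integrableOn_of_continuous a b (continuous_torus_comp a b H)) 0
  map_smul' r _ := coeff_const_mul a b r _ 0

lemma norm_gridMean_le {a b : ℝ} (N : ℕ) [NeZero N] (F : C(Torus, ℂ)) :
    ‖gridMean a b N F‖ ≤ ‖F‖ := by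
  have hN : (0 : ℝ) < N := Nat.cast_pos.2 (Nat.pos_of_ne_zero (NeZero.ne N))
  change ‖discreteCoeff a b (onGrid a b N F) 0‖ ≤ _
  rw [discreteCoeff, norm_mul]
  have h1 : ‖∑ p, onGrid a b N F p * mode a b (-0) (gridPoint a b N p)‖ ≤ (N : ℝ) ^ 2 * ‖F‖ := by
    refine (norm_sum_le_of_le (Finset.univ : Finset (Fin N × Fin N)) (n := fun _ => ‖F‖)
      fun p _ => ?_).trans (le_of_eq ?_)
    · rw [norm_mul, norm_mode, mul_one]; exact F.norm_coe_le_norm _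
    · simp [sq]
  have h2 : ‖1 / (N : ℂ) ^ 2‖ = 1 / (N : ℝ) ^ 2 := by simp
  rw [h2]
  calc _ ≤ 1 / (N : ℝ) ^ 2 * ((N : ℝ) ^ 2 * ‖F‖) := by gcongr
    _ = ‖F‖ := by field_simp

lemma norm_squareMean_le {a b : ℝ} (hab : a < b) (F : C(Torus, ℂ)) :
    ‖squareMean a b F‖ ≤ ‖F‖ := by
  have hba : 0 < b - a := by linarith
  change ‖coeff a b (fun z => F (toTorus a b z)) 0‖ ≤ _
  rw [coeff, norm_mul]
  have h1 : ‖∫ z in square a b, F (toTorus a b z) * mode a b (-0) z‖ ≤ ‖F‖ * (b - a) ^ 2 := by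
    rw [← volume_square hab]
    refine norm_setIntegral_le_of_norm_le_const (volume_square_lt_top a b) fun z _ => ?_
    rw [norm_mul, norm_mode, mul_one]; exact F.norm_coe_le_norm _
  have h2 : ‖(1 / ((b - a) ^ 2 : ℝ) : ℂ)‖ = 1 / (b - a) ^ 2 := by
    rw [norm_div, norm_one, Complex.norm_real, Real.norm_of_nonneg (by positivity)]
  rw [h2]
  calc _ ≤ 1 / (b - a) ^ 2 * (‖F‖ * (b - a) ^ 2) := by gcongr
    _ = ‖F‖ := by field_simp

lemma discreteCoeff_mode {a b : ℝ} (hab : a < b) {N : ℕ} [NeZero N] (k : ℤ × ℤ) :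
    discreteCoeff a b (fun p : Fin N × Fin N => mode a b k (gridPoint a b N p)) 0
      = if toGrp N k = 0 then 1 else 0 := by
  have h := anal_mode hab le_rfl zero_le_two (N := N) k 0
  rw [anal_gridSystem] at h
  have h0 : rep (0 : ZMod N × ZMod N) = 0 := by simp [rep, repInt]
  rwa [h0] at h

lemma toGrp_eq_zero_of_lt {N : ℕ} {k : ℤ × ℤ} (h : k.1.natAbs + k.2.natAbs < N)
    (hk : toGrp N k = 0) : k = 0 := by
  have key : ∀ j : ℤ, (j : ZMod N) = 0 → j.natAbs < N → j = 0 := fun j hj hlt => by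
    rw [ZMod.intCast_zmod_eq_zero_iff_dvd] at hj
    exact Int.eq_zero_of_abs_lt_dvd hj (by rw [Int.abs_eq_natAbs]; exact_mod_cast hlt)
  exact Prod.ext (key _ (congrArg Prod.fst hk) (by omega))
    (key _ (congrArg Prod.snd hk) (by omega))

/-- The grid mean of a character is exact once the grid is fine enough compared with its frequency;
density of trigonometric polynomials and the uniform bound on the means do the rest. Only even grid
sizes occur in the limit, as in the scheme. -/
lemma tendsto_gridMean {a b : ℝ} (hab : a < b) (F : C(Torus, ℂ)) :
    Filter.Tendsto (fun n => gridMean a b (2 * (n + 1)) F) Filter.atTop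
      (nhds (squareMean a b F)) := by
  refine tendsto_of_span_dense (L := fun n => gridMean a b (2 * (n + 1)))
    (fun n F => norm_gridMean_le (2 * (n + 1)) F) (norm_squareMean_le hab) span_chr_closure ?_ F
  rintro _ ⟨k, rfl⟩
  refine Filter.Tendsto.congr' ?_ tendsto_const_nhds
  filter_upwards [Filter.eventually_ge_atTop (k.1.natAbs + k.2.natAbs)] with n hn
  change coeff a b (fun z => chr k (toTorus a b z)) 0
    = discreteCoeff a b (fun p => chr k (toTorus a b (gridPoint a b (2 * (n + 1)) p))) 0
  simp only [chr_toTorus]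
  rw [coeff_mode hab, discreteCoeff_mode hab]
  congr 1
  rw [eq_iff_iff]
  constructor
  · rintro rfl; simp [toGrp]
  · exact fun h => toGrp_eq_zero_of_lt (by omega) h

/-- Discrete Fourier coefficients converge to Fourier coefficients. -/
lemma tendsto_discreteCoeff {a b : ℝ} (hab : a < b) (F : C(Torus, ℂ)) (k : ℤ × ℤ) :
    Filter.Tendsto (fun n => discreteCoeff a b (onGrid a b (2 * (n + 1)) F) k) Filter.atTop
      (nhds (coeff a b (fun z => F (toTorus a b z)) k)) := by
  have h := tendsto_gridMean hab (F * chr (-k))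
  have e1 : ∀ n, gridMean a b (2 * (n + 1)) (F * chr (-k))
      = discreteCoeff a b (onGrid a b (2 * (n + 1)) F) k := fun n => by
    change discreteCoeff a b (onGrid a b _ (F * chr (-k))) 0 = _
    simp [discreteCoeff, onGrid, chr_toTorus, mode_zero]
  have e2 : squareMean a b (F * chr (-k)) = coeff a b (fun z => F (toTorus a b z)) k := by
    change coeff a b (fun z => (F * chr (-k)) (toTorus a b z)) 0 = _
    simp [coeff, chr_toTorus, mode_zero]
  simpa only [e1, e2] using h

/-! ### Sobolev bounds of coefficient sequences -/

/-- The sequence `c` has `H^s`-norm at most `M`. -/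
def SeqBound (a b s : ℝ) (c : ℤ × ℤ → ℂ) (M : ℝ) : Prop :=
  ∀ F : Finset (ℤ × ℤ), ∑ k ∈ F, (wt a b k ^ s * ‖c k‖) ^ 2 ≤ M ^ 2

namespace SeqBound

variable {a b s : ℝ} {c : ℤ × ℤ → ℂ} {M : ℝ}

lemma mono_exp (h : SeqBound a b s c M) {r : ℝ} (hr : r ≤ s) : SeqBound a b r c M := fun F =>
  (Finset.sum_le_sum fun k _ => by
    have h1 : wt a b k ^ r ≤ wt a b k ^ s := Real.rpow_le_rpow_of_exponent_le (one_le_wt a b k) hr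
    have h2 : 0 ≤ wt a b k ^ r := Real.rpow_nonneg (wt_pos a b k).le _
    gcongr).trans (h F)

lemma sum_norm_le (h : SeqBound a b s c M) (hM : 0 ≤ M) (hab : a < b) (hs : 1 < s)
    (F : Finset (ℤ × ℤ)) : ∑ k ∈ F, ‖c k‖ ≤ √(weightSum a b s) * M := by
  have hsum := sum_wt_le hab hs F
  have hK0 : 0 ≤ weightSum a b s := le_trans (Finset.sum_nonneg fun i _ =>
    Real.rpow_nonneg (wt_pos a b i).le _) hsum
  have h1 := Finset.sum_mul_sq_le_sq_mul_sq F (fun k => wt a b k ^ (-s))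
    (fun k => wt a b k ^ s * ‖c k‖)
  refine abs_le_of_sq_le_sq' ?_ (mul_nonneg (Real.sqrt_nonneg _) hM) |>.2
  rw [mul_pow, Real.sq_sqrt hK0]
  have e1 : ∀ i, wt a b i ^ (-s) * (wt a b i ^ s * ‖c i‖) = ‖c i‖ := fun i => by
    rw [← mul_assoc, ← Real.rpow_add (wt_pos a b i)]; simp
  have e2 : ∀ i, (wt a b i ^ (-s)) ^ 2 = wt a b i ^ (-(2 * s)) := fun i => by
    rw [← Real.rpow_natCast, ← Real.rpow_mul (wt_pos a b i).le]; congr 1; push_cast; ring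
  simp only [e1, e2] at h1
  exact h1.trans (mul_le_mul hsum (h F) (Finset.sum_nonneg fun _ _ => sq_nonneg _) hK0)

lemma summable (h : SeqBound a b s c M) (hM : 0 ≤ M) (hab : a < b) (hs : 1 < s) :
    Summable fun k => ‖c k‖ :=
  summable_of_sum_le (fun _ => norm_nonneg _) (h.sum_norm_le hM hab hs)

lemma norm_series_le (h : SeqBound a b s c M) (hM : 0 ≤ M) (hab : a < b) (hs : 1 < s) (z : ℝ × ℝ) :
    ‖series c (toTorus a b z)‖ ≤ √(weightSum a b s) * M := by
  have h1 := hasSum_series_apply a b (h.summable hM hab hs) z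
  rw [← h1.tsum_eq]
  refine (norm_tsum_le_tsum_norm ?_).trans ?_
  · simpa [norm_mode] using h.summable hM hab hs
  · simp only [norm_mul, norm_mode, mul_one]
    exact (h.summable hM hab hs).tsum_le_of_sum_le (h.sum_norm_le hM hab hs)

end SeqBound

/-! ### Aliasing on the grid -/

section Alias

variable {a b α : ℝ} {N : ℕ} [NeZero N]

lemma meshSize_pos (hab : a < b) : 0 < meshSize a b N :=
  div_pos (by linarith) (Nat.cast_pos.2 (Nat.pos_of_ne_zero (NeZero.ne N)))

lemma freqSq_eq_mesh (hab : a < b) (k : ℤ × ℤ) : freqSq a b k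
    = Real.pi ^ 2 / meshSize a b N ^ 2 * ((4 * ((k.1 : ℝ) ^ 2 + (k.2 : ℝ) ^ 2)) / (N : ℝ) ^ 2) := by
  have hba : b - a ≠ 0 := by linarith
  have hN : (N : ℝ) ≠ 0 := Nat.cast_ne_zero.2 (NeZero.ne N)
  rw [freqSq_eq, meshSize]
  field_simp
  ring

lemma natAbs_repInt_le (x : ZMod N) : 2 * (repInt x).natAbs ≤ N := by
  rw [repInt, Int.natAbs_neg]
  have := ZMod.natAbs_valMinAbs_le (-x)
  omega

lemma wt_rep_le (hab : a < b) (hh : meshSize a b N ≤ 1) (x : ZMod N × ZMod N) :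
    wt a b (rep x) ≤ 5 / meshSize a b N := by
  have hpos := meshSize_pos (N := N) hab
  have hN : (0 : ℝ) < N := Nat.cast_pos.2 (Nat.pos_of_ne_zero (NeZero.ne N))
  have key : ∀ y : ZMod N, 4 * ((repInt y : ℤ) : ℝ) ^ 2 ≤ (N : ℝ) ^ 2 := fun y => by
    have h1 := natAbs_repInt_le y
    have h2 : 2 * |((repInt y : ℤ) : ℝ)| ≤ N := by
      have h3 : ((2 * (repInt y).natAbs : ℕ) : ℝ) ≤ (N : ℕ) := by exact_mod_cast h1
      push_cast at h3
      simpa [Nat.cast_natAbs] using h3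
    rw [← sq_abs]
    nlinarith [abs_nonneg ((repInt y : ℤ) : ℝ)]
  refine Real.sqrt_le_iff.2 ⟨by positivity, ?_⟩
  rw [freqSq_eq_mesh (N := N) hab, div_pow]
  have h3 : (4 * (((rep x).1 : ℝ) ^ 2 + ((rep x).2 : ℝ) ^ 2)) / (N : ℝ) ^ 2 ≤ 2 := by
    rw [div_le_iff₀ (by positivity)]
    have := key x.1
    have := key x.2
    simp only [rep]
    linarith
  -- With h ≤ 1 this gives w² ≤ (1 + 2·12)/h², whose root is the constant 5.
  have h4 : Real.pi ^ 2 ≤ 12 := by nlinarith [Real.pi_lt_d2, Real.pi_pos]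
  have h5 : 1 ≤ 1 / meshSize a b N ^ 2 := by
    rw [le_div_iff₀ (by positivity)]; nlinarith
  calc _ ≤ 1 / meshSize a b N ^ 2 + 12 / meshSize a b N ^ 2 * 2 := by gcongr
    _ = 5 ^ 2 / meshSize a b N ^ 2 := by ring

lemma one_div_le_wt (hab : a < b) (hN : Even N) {k : ℤ × ℤ} (hk : k ∉ indexSet N) :
    1 / meshSize a b N ≤ wt a b k := by
  have hpos := meshSize_pos (N := N) hab
  have hN0 : (0 : ℝ) < N := Nat.cast_pos.2 (Nat.pos_of_ne_zero (NeZero.ne N))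
  have h1 : (N : ℝ) ^ 2 ≤ 4 * ((k.1 : ℝ) ^ 2 + (k.2 : ℝ) ^ 2) := by
    have key : ∀ j : ℤ, j ∉ Finset.Ico (-((N : ℤ) / 2)) ((N : ℤ) / 2) →
        (N : ℝ) ^ 2 ≤ 4 * (j : ℝ) ^ 2 := fun j hj => by
      obtain ⟨n, hn⟩ := hN
      rw [Finset.mem_Ico] at hj
      have h3 : (N : ℤ) ≤ 2 * |j| := by
        rcases abs_cases j with h | h <;> omega
      have h4 : (N : ℝ) ≤ 2 * |(j : ℝ)| := by exact_mod_cast h3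
      rw [← sq_abs (j : ℝ)]
      nlinarith
    have h5 : k.1 ∉ Finset.Ico (-((N : ℤ) / 2)) ((N : ℤ) / 2)
        ∨ k.2 ∉ Finset.Ico (-((N : ℤ) / 2)) ((N : ℤ) / 2) := by
      by_contra! h
      exact hk (Finset.mem_product.2 h)
    rcases h5 with h | h
    · nlinarith [key _ h, sq_nonneg (k.2 : ℝ)]
    · nlinarith [key _ h, sq_nonneg (k.1 : ℝ)]
  refine Real.le_sqrt_of_sq_le ?_
  rw [freqSq_eq_mesh (N := N) hab, div_pow]
  have h3 : 1 ≤ (4 * ((k.1 : ℝ) ^ 2 + (k.2 : ℝ) ^ 2)) / (N : ℝ) ^ 2 := by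
    rw [le_div_iff₀ (by positivity)]; linarith
  have h4 : 1 ≤ Real.pi ^ 2 := by nlinarith [Real.pi_gt_three]
  have h6 : (1 : ℝ) ^ 2 / meshSize a b N ^ 2 ≤ Real.pi ^ 2 / meshSize a b N ^ 2 := by
    rw [one_pow]; gcongr
  have h7 : 0 ≤ Real.pi ^ 2 / meshSize a b N ^ 2 := by positivity
  nlinarith

/-- The lattice shift from the representative in `T_N`. -/
def shiftIdx (N : ℕ) (l : ℤ × ℤ) : ℤ × ℤ :=
  ((l.1 - (rep (toGrp N l)).1) / N, (l.2 - (rep (toGrp N l)).2) / N)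

lemma eq_add_shiftIdx (l : ℤ × ℤ) :
    l.1 = (rep (toGrp N l)).1 + N * (shiftIdx N l).1
      ∧ l.2 = (rep (toGrp N l)).2 + N * (shiftIdx N l).2 := by
  have key : ∀ j : ℤ, (N : ℤ) ∣ j - repInt (j : ZMod N) := fun j => by
    rw [← ZMod.intCast_eq_intCast_iff_dvd_sub, coe_repInt]
  have h1 := Int.mul_ediv_cancel' (key l.1)
  have h2 := Int.mul_ediv_cancel' (key l.2)
  simp only [shiftIdx, rep, toGrp]
  constructor <;> linarith

/-- An aliased frequency is l = k + Nj with |k_i| ≤ N/2 and j ≠ 0, hence N|j_i| ≤ 2|l_i|. Thus w_l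
is at least (1 + |j|²)^{1/2}/h, the summand 1 being absorbed by π² ≥ 2, and the shifts j index a
convergent lattice sum. -/
lemma wt_rpow_le_shift (hab : a < b) {s : ℝ} (hs : 0 ≤ s) {l : ℤ × ℤ}
    (hl : l ≠ rep (toGrp N l)) : wt a b l ^ (-(2 * s)) ≤ meshSize a b N ^ (2 * s)
      * (1 + ((shiftIdx N l).1 : ℝ) ^ 2 + ((shiftIdx N l).2 : ℝ) ^ 2) ^ (-s) := by
  have hpos := meshSize_pos (N := N) hab
  have hN0 : (0 : ℝ) < N := Nat.cast_pos.2 (Nat.pos_of_ne_zero (NeZero.ne N))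
  obtain ⟨e1, e2⟩ := eq_add_shiftIdx (N := N) l
  set j := shiftIdx N l with hj
  have hj0 : 1 ≤ (j.1 : ℝ) ^ 2 + (j.2 : ℝ) ^ 2 := by
    have : j.1 ≠ 0 ∨ j.2 ≠ 0 := by
      by_contra! h
      rw [h.1] at e1; rw [h.2] at e2
      exact hl (Prod.ext (by simpa using e1) (by simpa using e2))
    have h3 : ∀ i : ℤ, i ≠ 0 → 1 ≤ (i : ℝ) ^ 2 := fun i hi => by
      have : 1 ≤ i ^ 2 := by have := sq_pos_of_ne_zero hi; omega
      exact_mod_cast this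
    rcases this with h | h
    · nlinarith [h3 _ h, sq_nonneg (j.2 : ℝ)]
    · nlinarith [h3 _ h, sq_nonneg (j.1 : ℝ)]
  have key : ∀ (i k q : ℤ), 2 * k.natAbs ≤ N → q = k + N * i →
      (N : ℝ) ^ 2 * (i : ℝ) ^ 2 ≤ 4 * (q : ℝ) ^ 2 := fun i k q hk hq => by
    have h4 : (N : ℤ) * |i| ≤ 2 * |q| := by
      by_cases hi : i = 0
      · subst hi; simp
      have h5 : 1 ≤ |i| := Int.one_le_abs hi
      have h6 : (N : ℤ) * |i| = |q - k| := by rw [hq, add_sub_cancel_left, abs_mul, Nat.abs_cast]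
      have h7 : |q - k| ≤ |q| + |k| := abs_sub q k
      have h8 : 2 * |k| ≤ N := by
        rw [Int.abs_eq_natAbs]; exact_mod_cast hk
      nlinarith [(Nat.cast_nonneg N : (0:ℤ) ≤ N)]
    have h9 : (N : ℝ) * |(i : ℝ)| ≤ 2 * |(q : ℝ)| := by exact_mod_cast h4
    have h10 : 0 ≤ (N : ℝ) * |(i : ℝ)| := by positivity
    rw [← sq_abs (i : ℝ), ← sq_abs (q : ℝ)]
    nlinarith
  have k1 := key _ _ _ (natAbs_repInt_le _) e1
  have k2 := key _ _ _ (natAbs_repInt_le _) e2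
  have hw : (1 / meshSize a b N ^ 2) * (1 + (j.1 : ℝ) ^ 2 + (j.2 : ℝ) ^ 2) ≤ wt a b l ^ 2 := by
    rw [wt_sq, freqSq_eq_mesh (N := N) hab]
    have h3 : (j.1 : ℝ) ^ 2 + (j.2 : ℝ) ^ 2
        ≤ (4 * ((l.1 : ℝ) ^ 2 + (l.2 : ℝ) ^ 2)) / (N : ℝ) ^ 2 := by
      rw [le_div_iff₀ (by positivity)]; linarith
    have h4 : 2 ≤ Real.pi ^ 2 := by nlinarith [Real.pi_gt_three]
    calc _ ≤ (1 / meshSize a b N ^ 2) * (2 * ((j.1 : ℝ) ^ 2 + (j.2 : ℝ) ^ 2)) := by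
          gcongr; linarith
      _ ≤ (1 / meshSize a b N ^ 2) * (Real.pi ^ 2
          * ((4 * ((l.1 : ℝ) ^ 2 + (l.2 : ℝ) ^ 2)) / (N : ℝ) ^ 2)) := by gcongr
      _ ≤ _ := by
          rw [← mul_assoc, one_div_mul_eq_div]; linarith
  have e : wt a b l ^ (-(2 * s)) = (wt a b l ^ 2) ^ (-s) := by
    rw [← Real.rpow_natCast, ← Real.rpow_mul (wt_pos a b l).le]; congr 1; push_cast; ring
  have e3 : meshSize a b N ^ (2 * s) = (1 / meshSize a b N ^ 2) ^ (-s) := by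
    rw [one_div, ← Real.rpow_natCast, ← Real.rpow_neg hpos.le, ← Real.rpow_mul hpos.le]
    congr 1; push_cast; ring
  rw [e, e3, ← Real.mul_rpow (by positivity) (by positivity)]
  exact Real.rpow_le_rpow_of_nonpos (by positivity) hw (by linarith)

/-- The part of the lattice sum aliased to the frequency `x`. -/
def aliasSum (c : ℤ × ℤ → ℂ) (F : Finset (ℤ × ℤ)) (x : ZMod N × ZMod N) : ℂ :=
  ∑ l ∈ F, if toGrp N l = x ∧ l ≠ rep x then c l else 0

/-- Cauchy–Schwarz within one residue class. The shift determines the frequency in its class, so the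
sum of the weights is at most h^{2s} times the full lattice sum. -/
lemma norm_aliasSum_sq_le (hab : a < b) {s : ℝ} (hs : 1 < s) (c : ℤ × ℤ → ℂ)
    (F : Finset (ℤ × ℤ)) (x : ZMod N × ZMod N) : ‖aliasSum c F x‖ ^ 2
      ≤ (meshSize a b N ^ (2 * s) * latticeSum s)
        * ∑ l ∈ F with toGrp N l = x, (wt a b l ^ s * ‖c l‖) ^ 2 := by
  have hpos := meshSize_pos (N := N) hab
  obtain ⟨F', hF'⟩ : ∃ F', F' = F.filter fun l => toGrp N l = x ∧ l ≠ rep x := ⟨_, rfl⟩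
  have e0 : aliasSum c F x = ∑ l ∈ F', c l := by rw [aliasSum, hF', Finset.sum_filter]
  have h1 := Finset.sum_mul_sq_le_sq_mul_sq F' (fun l => wt a b l ^ (-s))
    (fun l => wt a b l ^ s * ‖c l‖)
  have e1 : ∀ i, wt a b i ^ (-s) * (wt a b i ^ s * ‖c i‖) = ‖c i‖ := fun i => by
    rw [← mul_assoc, ← Real.rpow_add (wt_pos a b i)]; simp
  have e2 : ∀ i, (wt a b i ^ (-s)) ^ 2 = wt a b i ^ (-(2 * s)) := fun i => by
    rw [← Real.rpow_natCast, ← Real.rpow_mul (wt_pos a b i).le]; congr 1; push_cast; ring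
  simp only [e1, e2] at h1
  have h3 : ∑ l ∈ F', wt a b l ^ (-(2 * s)) ≤ meshSize a b N ^ (2 * s) * latticeSum s := by
    have hmem : ∀ l ∈ F', toGrp N l = x ∧ l ≠ rep x := fun l hl => by
      rw [hF'] at hl; exact (Finset.mem_filter.1 hl).2
    have hinj : Set.InjOn (shiftIdx N) F' := fun l hl l' hl' he => by
      obtain ⟨p1, p2⟩ := eq_add_shiftIdx (N := N) l
      obtain ⟨q1, q2⟩ := eq_add_shiftIdx (N := N) l'
      rw [(hmem l hl).1, he] at p1 p2
      rw [(hmem l' hl').1] at q1 q2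
      exact Prod.ext (p1.trans q1.symm) (p2.trans q2.symm)
    calc _ ≤ ∑ l ∈ F', meshSize a b N ^ (2 * s)
          * (1 + ((shiftIdx N l).1 : ℝ) ^ 2 + ((shiftIdx N l).2 : ℝ) ^ 2) ^ (-s) :=
          Finset.sum_le_sum fun l hl => wt_rpow_le_shift hab (by linarith) (by
            rw [(hmem l hl).1]; exact (hmem l hl).2)
      _ = meshSize a b N ^ (2 * s) * ∑ j ∈ F'.image (shiftIdx N),
          (1 + (j.1 : ℝ) ^ 2 + (j.2 : ℝ) ^ 2) ^ (-s) := by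
          rw [Finset.sum_image hinj, Finset.mul_sum]
      _ ≤ _ := mul_le_mul_of_nonneg_left (sum_lattice_le hs _) (by positivity)
  rw [e0]
  calc _ ≤ (∑ l ∈ F', ‖c l‖) ^ 2 := by gcongr; exact norm_sum_le _ _
    _ ≤ _ := h1
    _ ≤ _ := by
      have h4 : 0 ≤ ∑ l ∈ F', (wt a b l ^ s * ‖c l‖) ^ 2 := Finset.sum_nonneg fun _ _ => sq_nonneg _
      refine mul_le_mul h3 ?_ h4 ?_
      · refine Finset.sum_le_sum_of_subset_of_nonneg ?_ fun _ _ _ => sq_nonneg _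
        rw [hF']
        intro l hl
        rw [Finset.mem_filter] at hl ⊢
        exact ⟨hl.1, hl.2.1⟩
      · exact mul_nonneg (by positivity) (latticeSum_nonneg s)

/-- The constant of the aliasing estimate. -/
def aliasC (r s : ℝ) : ℝ := 5 ^ r * √(latticeSum s)

lemma aliasC_nonneg (r s : ℝ) : 0 ≤ aliasC r s := by unfold aliasC; positivity

/-- On T_N the weight is at most 5/h, so r derivatives cost h^{-r}; the residue classes partition
the lattice, so the sums over classes reassemble to the H^s bound. -/
lemma sum_aliasSum_le (hab : a < b) (hh : meshSize a b N ≤ 1) {r s M : ℝ} (hr : 0 ≤ r) (hs : 1 < s)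
    {c : ℤ × ℤ → ℂ} (hc : SeqBound a b s c M) (F : Finset (ℤ × ℤ)) :
    ∑ x : ZMod N × ZMod N, (wt a b (rep x) ^ r * ‖aliasSum c F x‖) ^ 2
      ≤ (aliasC r s * (meshSize a b N ^ (s - r) * M)) ^ 2 := by
  have hpos := meshSize_pos (N := N) hab
  have hL := latticeSum_nonneg s
  obtain ⟨X, hX⟩ : ∃ X, X = ((5 / meshSize a b N) ^ r) ^ 2
    * (meshSize a b N ^ (2 * s) * latticeSum s) := ⟨_, rfl⟩
  have hX0 : 0 ≤ X := by rw [hX]; positivity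
  have h1 : ∀ x : ZMod N × ZMod N, (wt a b (rep x) ^ r * ‖aliasSum c F x‖) ^ 2
      ≤ X * ∑ l ∈ F with toGrp N l = x, (wt a b l ^ s * ‖c l‖) ^ 2 := fun x => by
    have h2 : wt a b (rep x) ^ r ≤ (5 / meshSize a b N) ^ r :=
      Real.rpow_le_rpow (wt_pos a b _).le (wt_rep_le hab hh x) hr
    have h3 := norm_aliasSum_sq_le hab hs c F x
    have h4 : 0 ≤ wt a b (rep x) ^ r := Real.rpow_nonneg (wt_pos a b _).le _
    rw [mul_pow, hX, mul_assoc]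
    gcongr
  refine (Finset.sum_le_sum fun x _ => h1 x).trans ?_
  rw [← Finset.mul_sum, Finset.sum_fiberwise F (fun l => toGrp N l)
    (fun l => (wt a b l ^ s * ‖c l‖) ^ 2)]
  refine (mul_le_mul_of_nonneg_left (hc F) hX0).trans (le_of_eq ?_)
  rw [hX, aliasC, mul_pow, mul_pow, mul_pow, Real.sq_sqrt hL, Real.div_rpow (by norm_num) hpos.le,
    Real.rpow_sub hpos]
  have e : meshSize a b N ^ (2 * s) = (meshSize a b N ^ s) ^ 2 := by
    rw [← Real.rpow_natCast, ← Real.rpow_mul hpos.le]; congr 1; push_cast; ring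
  rw [e]
  ring

variable (hab : a < b) (h0 : 0 ≤ α) (h2 : α ≤ 2)

/-- A mode contributes to the discrete coefficient at x exactly when its class is x. Removing the
representative leaves the aliased sum. -/
lemma tendsto_aliasSum {c : ℤ × ℤ → ℂ} (hc : Summable fun k => ‖c k‖) (x : ZMod N × ZMod N) :
    Filter.Tendsto (fun F => aliasSum c F x) Filter.atTop
      (nhds ((gridSystem hab h0 h2 N).anal (onGrid a b N (series c)) x - c (rep x))) := by
  have h1 : HasSum (fun l => if toGrp N l = x then c l else 0)
      ((gridSystem hab h0 h2 N).anal (onGrid a b N (series c)) x) := by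
    have h3 : HasSum (fun l => (Fintype.card (Fin N × Fin N) : ℂ)⁻¹
        * ∑ p, c l * mode a b l (gridPoint a b N p) * (gridSystem hab h0 h2 N).e (-x) p)
        ((gridSystem hab h0 h2 N).anal (onGrid a b N (series c)) x) :=
      (hasSum_sum fun p _ => (hasSum_series_apply a b hc _).mul_right _).mul_left _
    refine h3.congr_fun fun l => ?_
    have h4 := anal_mode hab h0 h2 (N := N) l x
    simp only [GridSystem.anal] at h4
    simp only [mul_assoc, ← Finset.mul_sum]
    rw [mul_left_comm, h4]; simp
  have h3 := h1.sub (hasSum_ite_eq (rep x) (c (rep x)))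
  refine h3.congr fun F => Finset.sum_congr rfl fun l _ => ?_
  by_cases hl : l = rep x
  · subst hl; simp
  · simp [hl]

/-- The aliasing estimate. -/
lemma wnorm_alias_le (hh : meshSize a b N ≤ 1) {r s M : ℝ} (hr : 0 ≤ r) (hs : 1 < s)
    (hM : 0 ≤ M) {c : ℤ × ℤ → ℂ} (hc : SeqBound a b s c M) :
    wnorm (gridSystem hab h0 h2 N).w r
      (fun x => (gridSystem hab h0 h2 N).anal (onGrid a b N (series c)) x - c (rep x))
      ≤ aliasC r s * (meshSize a b N ^ (s - r) * M) := by
  have hpos := meshSize_pos (N := N) hab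
  refine abs_le_of_sq_le_sq' ?_ (mul_nonneg (aliasC_nonneg r s) (by positivity)) |>.2
  rw [wnorm_sq (gridSystem hab h0 h2 N).one_le_w]
  have ht : Filter.Tendsto (fun F : Finset (ℤ × ℤ) => ∑ x : ZMod N × ZMod N,
      (wt a b (rep x) ^ r * ‖aliasSum c F x‖) ^ 2) Filter.atTop
      (nhds (∑ x : ZMod N × ZMod N, (wt a b (rep x) ^ r
        * ‖(gridSystem hab h0 h2 N).anal (onGrid a b N (series c)) x - c (rep x)‖) ^ 2)) :=
    tendsto_finsetSum _ fun x _ => (((tendsto_aliasSum hab h0 h2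
      (hc.summable hM hab hs) x).norm).const_mul _).pow 2
  exact le_of_tendsto' ht fun F => sum_aliasSum_le hab hh hr hs hc F

lemma wnorm_rep_le {s M : ℝ} (hM : 0 ≤ M) {c : ℤ × ℤ → ℂ} (hc : SeqBound a b s c M) :
    wnorm (gridSystem hab h0 h2 N).w s (fun x => c (rep x)) ≤ M := by
  refine abs_le_of_sq_le_sq' ?_ hM |>.2
  rw [wnorm_sq (gridSystem hab h0 h2 N).one_le_w]
  have hinj : Function.Injective (rep : ZMod N × ZMod N → ℤ × ℤ) :=
    Function.LeftInverse.injective (g := toGrp N) toGrp_rep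
  have := hc (Finset.univ.map ⟨_, hinj⟩)
  rwa [Finset.sum_map] at this

/-- The inverse inequality on the grid. -/
lemma wnorm_inverse_le {ι : Type} [Fintype ι] {W : ι → ℝ} (hW : ∀ i, 1 ≤ W i) {X : ℝ}
    (hX : ∀ i, W i ≤ X) {s : ℝ} (hs : 0 ≤ s) (c : ι → ℂ) :
    wnorm W s c ≤ X ^ s * wnorm W 0 c := by
  by_cases hι : IsEmpty ι
  · have : c = 0 := Subsingleton.elim _ _
    rw [this]; simp [wnorm_zero]
  rw [not_isEmpty_iff] at hι
  have hX1 : 1 ≤ X := (hW hι.some).trans (hX _)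
  refine abs_le_of_sq_le_sq' ?_ (mul_nonneg (by positivity) (wnorm_nonneg _)) |>.2
  rw [mul_pow, wnorm_sq hW, wnorm_sq hW, Finset.mul_sum]
  refine Finset.sum_le_sum fun i _ => ?_
  have h3 : 0 ≤ W i := by linarith [hW i]
  rw [← mul_pow, Real.rpow_zero, one_mul]
  have := Real.rpow_le_rpow h3 (hX i) hs
  gcongr

/-- Uniform discrete Sobolev bounds pass to the Fourier coefficients. -/
lemma seqBound_of_hnorm_le {s R : ℝ} {F : C(Torus, ℂ)}
    (h : ∀ᶠ n : ℕ in Filter.atTop,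
      (gridSystem hab h0 h2 (2 * (n + 1))).hnorm s (onGrid a b (2 * (n + 1)) F) ≤ R) :
    SeqBound a b s (coeff a b fun z => F (toTorus a b z)) R := by
  intro A
  have ht : Filter.Tendsto (fun n => ∑ k ∈ A,
      (wt a b k ^ s * ‖discreteCoeff a b (onGrid a b (2 * (n + 1)) F) k‖) ^ 2) Filter.atTop
      (nhds (∑ k ∈ A, (wt a b k ^ s * ‖coeff a b (fun z => F (toTorus a b z)) k‖) ^ 2)) :=
    tendsto_finsetSum _ fun k _ => (((tendsto_discreteCoeff hab F k).norm).const_mul _).pow 2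
  refine le_of_tendsto ht ?_
  filter_upwards [h, Filter.eventually_ge_atTop (∑ k ∈ A, (k.1.natAbs + k.2.natAbs))] with n hn hA
  -- For large grids a fixed finite set of frequencies lies in T_N, so its partial sum is part of
  -- the discrete norm.
  have hsub : A ⊆ indexSet (2 * (n + 1)) := fun k hk => by
    have := Finset.single_le_sum (f := fun k : ℤ × ℤ => k.1.natAbs + k.2.natAbs)
      (fun _ _ => Nat.zero_le _) hk
    refine Finset.mem_product.2 ⟨Finset.mem_Ico.2 ?_, Finset.mem_Ico.2 ?_⟩ <;> push_cast <;> omega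
  refine (Finset.sum_le_sum_of_subset_of_nonneg hsub fun _ _ _ => sq_nonneg _).trans ?_
  rw [sum_indexSet (by simp)]
  have h3 := (gridSystem hab h0 h2 (2 * (n + 1))).hnorm_nonneg s (onGrid a b (2 * (n + 1)) F)
  have h4 := pow_le_pow_left₀ h3 hn 2
  rw [GridSystem.hnorm, wnorm_sq (gridSystem hab h0 h2 _).one_le_w] at h4
  simp only [anal_gridSystem] at h4
  exact h4

end Alias

end NSFSGE

namespace NSFSGE

namespace GridSystem

variable {G P : Type} [AddCommGroup G] [Fintype G] [Fintype P] {β : ℝ} (S : GridSystem G P β)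

/-- Norm of a pair `φ_±` that is controlled by `u` and `⟨∇⟩⁻¹ v`. -/
lemma pnorm_pair_le {s : ℝ} {Ψ : Bool × G → ℂ} {c d : G → ℂ}
    (h : ∀ j, ‖Ψ j‖ ≤ ‖c j.2‖ + S.w j.2 ^ (-β) * ‖d j.2‖) :
    S.pnorm (s + β) Ψ ≤ 2 * (wnorm S.w (s + β) c + wnorm S.w s d) := by
  have hw : ∀ k, 0 ≤ S.w k ^ (-β) := fun k => Real.rpow_nonneg (S.w_pos k).le _
  let c' : G → ℂ := fun k => ((‖c k‖ : ℝ) : ℂ)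
  let d' : G → ℂ := fun k => ((S.w k ^ (-β) : ℝ) : ℂ) * ((‖d k‖ : ℝ) : ℂ)
  have hn : ∀ k, ‖(c' + d') k‖ = ‖c k‖ + S.w k ^ (-β) * ‖d k‖ := fun k => by
    have e : (c' + d') k = ((‖c k‖ + S.w k ^ (-β) * ‖d k‖ : ℝ) : ℂ) := by
      simp [c', d']
    rw [e, Complex.norm_real, Real.norm_of_nonneg]
    have := hw k; positivity
  have h1 : S.pnorm (s + β) Ψ ≤ 2 * wnorm S.w (s + β) (c' + d') := by
    refine abs_le_of_sq_le_sq' ?_ (mul_nonneg zero_le_two (wnorm_nonneg _)) |>.2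
    rw [pnorm_sq, mul_pow, wnorm_sq S.one_le_w, Finset.mul_sum]
    refine Finset.sum_le_sum fun k _ => ?_
    rw [mul_pow, mul_left_comm]
    refine mul_le_mul_of_nonneg_left ?_ (by positivity)
    rw [hn]
    have e1 := pow_le_pow_left₀ (norm_nonneg _) (h (true, k)) 2
    have e2 := pow_le_pow_left₀ (norm_nonneg _) (h (false, k)) 2
    simp only at e1 e2
    nlinarith [sq_nonneg (‖c k‖ + S.w k ^ (-β) * ‖d k‖)]
  have h2 : wnorm S.w (s + β) c' ≤ wnorm S.w (s + β) c := by
    refine le_of_eq (wnorm_congr_norm S.one_le_w fun k => by simp [c'])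
  have h3 : wnorm S.w (s + β) d' ≤ wnorm S.w s d := by
    have h4 := wnorm_le_of_le (W := S.w) (s := s + β) (r := -β) S.one_le_w zero_le_one (c := d')
      (d := d) fun k => by
        have := hw k
        simp [d', abs_of_nonneg this]
    simpa using h4
  have h4 := wnorm_add_le (W := S.w) (s := s + β) c' d'
  linarith

end GridSystem

/-! ### The exact solution -/

/-- Each coefficient is continuous in time, hence so is every finite partial sum of the norm, and a
bound almost everywhere holds everywhere. -/
lemma seqBound_of_ae {a b S s M : ℝ} (hS : 0 < S) {f : ℝ → ℝ × ℝ → ℂ}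
    (hc : ∀ k, ContinuousOn (fun t => coeff a b (f t) k) (Set.Icc 0 S))
    (hm : ∀ t ∈ Set.Icc 0 S, MemH a b s (f t))
    (hb : ∀ᵐ t ∂(volume.restrict (Set.Icc 0 S)), normH a b s (f t) ≤ M) :
    ∀ t ∈ Set.Icc 0 S, SeqBound a b s (coeff a b (f t)) |M| := by
  intro t ht F
  rw [sq_abs]
  let Q : ℝ → ℝ := fun t => ∑ k ∈ F, (wt a b k ^ s * ‖coeff a b (f t) k‖) ^ 2
  have hQ : ContinuousOn Q (Set.Icc 0 S) := continuousOn_finsetSum _ fun k _ =>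
    (continuousOn_const.mul (hc k).norm).pow 2
  -- An inequality almost everywhere is rewritten as an equality of continuous functions, to which
  -- the uniqueness principle on intervals applies.
  have hae : (fun t => max (Q t) (M ^ 2)) =ᵐ[volume.restrict (Set.Icc 0 S)] fun _ => M ^ 2 := by
    filter_upwards [hb, ae_restrict_mem measurableSet_Icc] with r hr hrm
    refine max_eq_right ?_
    have h1 : Q r ≤ ∑' k, sobolevTerm a b s (f r) k := by
      have h2 : Q r = ∑ k ∈ F, sobolevTerm a b s (f r) k :=
        Finset.sum_congr rfl fun k _ => by rw [sobolevTerm, rpow_wt, mul_pow]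
      rw [h2]
      exact (hm r hrm).2.sum_le_tsum _ fun k _ => by
        rw [sobolevTerm, rpow_wt]; positivity
    refine h1.trans ?_
    have h0 : 0 ≤ ∑' k, sobolevTerm a b s (f r) k := tsum_nonneg fun k => by
      rw [sobolevTerm, rpow_wt]; positivity
    rw [← Real.sq_sqrt h0]
    exact pow_le_pow_left₀ (Real.sqrt_nonneg _) hr 2
  have h := Measure.eqOn_Icc_of_ae_eq volume hS.ne hae (hQ.sup continuousOn_const)
    continuousOn_const ht
  exact max_eq_right_iff.1 h

/-- The nonlinearity on the torus. -/
def gTorus (ε : ℝ) (U : C(Torus, ℂ)) : C(Torus, ℂ) :=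
  ⟨fun x => gfun ε (U x), by unfold gfun; fun_prop⟩

/-- The Fourier coefficients of the nonlinearity. -/
def ghat (a b ε : ℝ) (c : ℤ × ℤ → ℂ) : ℤ × ℤ → ℂ :=
  coeff a b fun z => gTorus ε (series c) (toTorus a b z)

/-! ### Regularity of the nonlinearity and the spatial defect -/

section Algebra

variable {a b α : ℝ}

/-- The bound of the nonlinearity in `H^s`. -/
def ghatC (K s R : ℝ) : ℝ := Real.exp (GridSystem.algC K s * (R + aliasC s s * R))

/-- The discrete algebra bounds do not depend on N, and sampling preserves H^s bounds up to
aliasing. Composing on finer and finer grids and passing to the limit gives the bound on the torus,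
with no separate algebra property there. -/
lemma seqBound_ghat (hab : a < b) (h0 : 0 ≤ α) (h2 : α ≤ 2) {ε : ℝ} (hε : 0 < ε) (hε1 : ε ≤ 1) {σ s R : ℝ} (hσ : 1 < σ) (hs : σ ≤ s)
    (hR : 0 ≤ R) {c : ℤ × ℤ → ℂ} (hc : SeqBound a b s c R) :
    SeqBound a b s (ghat a b ε c) (ghatC (weightSum a b σ) s R) := by
  refine seqBound_of_hnorm_le hab h0 h2 ?_
  have hev : ∀ᶠ n : ℕ in Filter.atTop, meshSize a b (2 * (n + 1)) ≤ 1 := by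
    obtain ⟨n₀, hn₀⟩ := exists_nat_ge (b - a)
    filter_upwards [Filter.eventually_ge_atTop n₀] with n hn
    have h3 : (n₀ : ℝ) ≤ n := by exact_mod_cast hn
    have h4 : (0 : ℝ) ≤ n := n.cast_nonneg
    rw [meshSize, div_le_one (by positivity)]
    push_cast
    linarith
  filter_upwards [hev] with n hn
  refine (gridSystem hab h0 h2 (2 * (n + 1))).hnorm_comp_le
    (sum_w_gridSystem_le hab h0 h2 hσ) (by linarith) hs (expMajorized_gfun hε hε1)
    (f := onGrid a b (2 * (n + 1)) (series c)) ?_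
  have h3 := wnorm_alias_le hab h0 h2 hn (r := s) (s := s) (by linarith) (by linarith) hR hc
  rw [sub_self, Real.rpow_zero, one_mul] at h3
  have h4 := wnorm_rep_le hab h0 h2 (N := 2 * (n + 1)) hR hc
  have h5 := wnorm_add_le (W := (gridSystem hab h0 h2 (2 * (n + 1))).w) (s := s)
    (fun x => c (rep x)) (fun x => (gridSystem hab h0 h2 (2 * (n + 1))).anal
      (onGrid a b (2 * (n + 1)) (series c)) x - c (rep x))
  have e : ((fun x => c (rep x)) + fun x => (gridSystem hab h0 h2 (2 * (n + 1))).anal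
      (onGrid a b (2 * (n + 1)) (series c)) x - c (rep x))
      = (gridSystem hab h0 h2 (2 * (n + 1))).anal (onGrid a b (2 * (n + 1)) (series c)) := by
    ext x; simp
  rw [e] at h5
  exact h5.trans (add_le_add h4 h3)

variable {N : ℕ} [NeZero N]

lemma gridPoint_mem (hab : a < b) (p : Fin N × Fin N) :
    gridPoint a b N p ∈ Set.Icc a b ×ˢ Set.Icc a b := by
  have hN : (0 : ℝ) < N := Nat.cast_pos.2 (Nat.pos_of_ne_zero (NeZero.ne N))
  have hpos := meshSize_pos (N := N) hab
  have key : ∀ i : Fin N, a + (i : ℕ) * meshSize a b N ∈ Set.Icc a b := fun i => by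
    have h1 : ((i : ℕ) : ℝ) ≤ N := by exact_mod_cast i.2.le
    have h3 : (N : ℝ) * meshSize a b N = b - a := by rw [meshSize]; field_simp
    constructor
    · have : 0 ≤ ((i : ℕ) : ℝ) * meshSize a b N := by positivity
      linarith
    · nlinarith
  exact ⟨key p.1, key p.2⟩

lemma onGrid_series (hab : a < b) {w : ℝ × ℝ → ℂ} (hw : Continuous w)
    (hc : Summable fun k => ‖coeff a b w k‖) :
    onGrid a b N (series (coeff a b w)) = fun p => w (gridPoint a b N p) := by
  ext p
  exact (eqOn_series hab hw hc _ (gridPoint_mem hab p)).symm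

variable (hab : a < b) (h0 : 0 ≤ α) (h2 : α ≤ 2)

/-- The grid function whose force is the defect of the exact solution. -/
def defectFun (ε : ℝ) (c : ℤ × ℤ → ℂ) : Grid N :=
  (gridSystem hab h0 h2 N).synth (fun x => ghat a b ε c (rep x))
    - fun p => gfun ε ((gridSystem hab h0 h2 N).synth (fun x => c (rep x)) p)

/-- The constant of the spatial defect. -/
def defectC (K m M : ℝ) : ℝ :=
  aliasC 0 m * ghatC K m M + Real.exp (√K * M) * (aliasC 0 m * M)

/-- Two aliasing errors: truncating versus sampling g(u), which uses the H^m bound of g(u), and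
evaluating g at the truncated instead of the sampled u, which uses its L² Lipschitz bound. -/
lemma hnorm_defectFun_le (hh : meshSize a b N ≤ 1) {ε : ℝ} (hε : 0 < ε) (hε1 : ε ≤ 1)
    {σ m M : ℝ} (hσ : 1 < σ) (hσm : σ ≤ m) (hM : 0 ≤ M) {c : ℤ × ℤ → ℂ}
    (hc : SeqBound a b m c M) :
    (gridSystem hab h0 h2 N).hnorm 0 (defectFun hab h0 h2 ε c)
      ≤ defectC (weightSum a b σ) m M * meshSize a b N ^ m := by
  obtain ⟨S, hS⟩ : ∃ S, S = gridSystem hab h0 h2 N := ⟨_, rfl⟩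
  have hg := seqBound_ghat hab h0 h2 hε hε1 hσ hσm hM hc
  have hR : 0 ≤ ghatC (weightSum a b σ) m M := (Real.exp_pos _).le
  have hm : 1 < m := by linarith
  have hgs := hg.summable hR hab hm
  have hcσ := hc.mono_exp hσm
  have hK := sum_w_gridSystem_le hab h0 h2 (N := N) hσ
  have h3 := wnorm_alias_le hab h0 h2 hh le_rfl hm hR hg
  have h4 := wnorm_alias_le hab h0 h2 hh le_rfl hm hM hc
  have hgrid : onGrid a b N (series (ghat a b ε c)) = fun p =>
      gfun ε (onGrid a b N (series c) p) := by
    rw [ghat, onGrid_series hab (continuous_torus_comp a b _) hgs]; rfl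
  rw [hgrid] at h3
  rw [sub_zero] at h3 h4
  have hrep := wnorm_rep_le hab h0 h2 (N := N) hM hcσ
  unfold defectFun
  rw [← hS] at h3 h4 hK hrep ⊢
  have e : S.synth (fun x => ghat a b ε c (rep x))
      - (fun p => gfun ε (S.synth (fun x => c (rep x)) p))
      = (S.synth (fun x => ghat a b ε c (rep x)) - fun p => gfun ε (onGrid a b N (series c) p))
        + ((fun p => gfun ε (onGrid a b N (series c) p))
          - fun p => gfun ε (S.synth (fun x => c (rep x)) p)) := by abel
  rw [e]
  refine (S.hnorm_add_le _ _ _).trans ?_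
  have h5 : S.hnorm 0 (S.synth (fun x => ghat a b ε c (rep x))
      - fun p => gfun ε (onGrid a b N (series c) p))
      ≤ aliasC 0 m * (meshSize a b N ^ m * ghatC (weightSum a b σ) m M) := by
    rw [GridSystem.hnorm, S.anal_sub, S.anal_synth, wnorm_sub_comm]
    exact h3
  have h6 : S.hnorm 0 (onGrid a b N (series c) - S.synth fun x => c (rep x))
      ≤ aliasC 0 m * (meshSize a b N ^ m * M) := by
    rw [GridSystem.hnorm, S.anal_sub, S.anal_synth]
    exact h4
  have h7 := S.hnorm_zero_comp_sub_le (hasDerivAt_gfun hε) (expMajorized_gfun' hε hε1)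
    (R := √(weightSum a b σ) * M) (f := onGrid a b N (series c))
    (g := S.synth fun x => c (rep x)) (fun p => hcσ.norm_series_le hM hab hσ _) (fun p => by
      refine (S.norm_le_hnorm hK _ p).trans ?_
      rw [S.hnorm_synth]
      exact mul_le_mul_of_nonneg_left hrep (Real.sqrt_nonneg _))
  have h8 := mul_le_mul_of_nonneg_left h6 (Real.exp_pos (√(weightSum a b σ) * M)).le
  unfold defectC
  calc _ ≤ _ := add_le_add h5 (h7.trans h8)
    _ = _ := by ring

end Algebra

/-! ### The exact solution in twisted variables -/

section Solution

variable {a b α m S M ε : ℝ} {u₀ u₁ : ℝ × ℝ → ℂ} {u v : ℝ → ℝ × ℝ → ℂ}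

lemma integrableOn_of_memLp {w : ℝ × ℝ → ℂ} (h : MemLp w 2 (volume.restrict (square a b))) :
    IntegrableOn w (square a b) := h.integrable (by norm_num)

lemma coeff_sin (hab : a < b) (hε : 0 < ε) {w : ℝ × ℝ → ℂ} (hw : IntegrableOn w (square a b))
    (hc : Summable fun k => ‖coeff a b w k‖) (k : ℤ × ℤ) :
    coeff a b (fun z => (1 / (ε : ℂ)) * Complex.sin ((ε : ℂ) * w z)) k
      = coeff a b w k + (ε : ℂ) ^ 2 * ghat a b ε (coeff a b w) k := by
  have h1 := ae_eq_series hab hw hc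
  have e : ∀ᵐ z ∂(volume.restrict (square a b)),
      (1 / (ε : ℂ)) * Complex.sin ((ε : ℂ) * w z) = series (coeff a b w) (toTorus a b z)
        + (ε : ℂ) ^ 2 * gTorus ε (series (coeff a b w)) (toTorus a b z) := by
    filter_upwards [h1] with z hz
    rw [hz]
    have := nonlin_eq hε (series (coeff a b w) (toTorus a b z))
    rw [nonlin] at this
    change _ = _ + (ε : ℂ) ^ 2 * gfun ε (series (coeff a b w) (toTorus a b z))
    rw [← this]; ring
  rw [coeff_congr e, coeff_add a b (integrableOn_of_continuous a b (continuous_torus_comp a b _))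
    ((integrableOn_of_continuous a b (continuous_torus_comp a b _)).const_mul _),
    coeff_const_mul, coeff_series hab hc]
  rfl

variable (hab : a < b) (h0 : 0 ≤ α) (h2 : α ≤ 2) (N : ℕ) [NeZero N]

/-- The twisted variables of the exact solution. -/
def exactTwist (u v : ℝ → ℝ × ℝ → ℂ) (t : ℝ) (j : Bool × (ZMod N × ZMod N)) : ℂ :=
  (gridSystem hab h0 h2 N).phase (-t) j * (coeff a b (u t) (rep j.2)
    - Complex.I / ((gridSystem hab h0 h2 N).lam j : ℂ) * coeff a b (v t) (rep j.2))

lemma uOf_exactTwist (t : ℝ) : (gridSystem hab h0 h2 N).uOf t (exactTwist hab h0 h2 N u v t)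
    = (gridSystem hab h0 h2 N).synth fun x => coeff a b (u t) (rep x) := by
  rw [GridSystem.uOf]
  congr 1
  ext x
  have e1 := (gridSystem hab h0 h2 N).phase_mul_neg t (true, x)
  have e2 := (gridSystem hab h0 h2 N).phase_mul_neg t (false, x)
  have e3 : ((gridSystem hab h0 h2 N).lam (false, x) : ℂ)
      = -((gridSystem hab h0 h2 N).lam (true, x) : ℂ) := by
    simp [GridSystem.lam, GridSystem.sgn]
  simp only [exactTwist, ← mul_assoc, e1, e2, e3, div_neg]
  ring

lemma lam_sq (j : Bool × (ZMod N × ZMod N)) :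
    ((gridSystem hab h0 h2 N).lam j : ℂ) ^ 2 = 1 + (fracSymbol a b α (rep j.2) : ℂ) := by
  have h := delta_sq a b α (rep j.2)
  have e : (gridSystem hab h0 h2 N).lam j ^ 2 = 1 + fracSymbol a b α (rep j.2) := by
    rw [← h]
    obtain ⟨s, x⟩ := j
    cases s <;> simp [GridSystem.lam, GridSystem.sgn, gridSystem]
  rw [← Complex.ofReal_pow, e]; push_cast; ring

/-- Since λ² = 1 + symbol, the derivative of the phase cancels all linear terms, including the u
split off from the sine. What remains is ε² times the forcing by the true coefficients of g(u); the
defect is its difference from the semidiscrete forcing. -/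
lemma hasDerivAt_exactTwist (hε : 0 < ε) (hsol : IsSolution a b α ε S u₀ u₁ u v) {t : ℝ}
    (ht : t ∈ Set.Ioo 0 S) (hc : Summable fun k => ‖coeff a b (u t) k‖) :
    HasDerivAt (exactTwist hab h0 h2 N u v)
      ((ε ^ 2 : ℝ) • ((gridSystem hab h0 h2 N).nl (gfun ε) t (exactTwist hab h0 h2 N u v t)
        + (gridSystem hab h0 h2 N).force t (defectFun hab h0 h2 ε (coeff a b (u t))))) t := by
  rw [GridSystem.nl, uOf_exactTwist, ← GridSystem.force_add, defectFun, add_sub_cancel]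
  rw [hasDerivAt_pi]
  intro j
  have hl : ((gridSystem hab h0 h2 N).lam j : ℂ) ≠ 0 :=
    Complex.ofReal_ne_zero.2 ((gridSystem hab h0 h2 N).lam_ne_zero (by linarith) j)
  have hl2 := lam_sq hab h0 h2 N j
  have du := hsol.deriv_u (rep j.2) t ht
  have dv := hsol.deriv_v (rep j.2) t ht
  rw [coeff_sin hab hε (integrableOn_of_memLp (hsol.memLp_u t ⟨ht.1.le, ht.2.le⟩)) hc] at dv
  refine (((gridSystem hab h0 h2 N).hasDerivAt_phase_neg t j).mul
    (du.sub (dv.const_mul (Complex.I / ((gridSystem hab h0 h2 N).lam j : ℂ))))).congr_deriv ?_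
  simp only [Pi.smul_apply, GridSystem.force, GridSystem.anal_synth, Complex.real_smul,
    Complex.ofReal_pow]
  have hI := Complex.I_sq
  have e : (fracSymbol a b α (rep j.2) : ℂ) = ((gridSystem hab h0 h2 N).lam j : ℂ) ^ 2 - 1 := by
    rw [hl2]; ring
  rw [e]
  simp only [Pi.sub_apply]
  field_simp
  ring_nf
  simp only [hI]
  ring

lemma norm_I_div_lam_le (j : Bool × (ZMod N × ZMod N)) :
    ‖Complex.I / ((gridSystem hab h0 h2 N).lam j : ℂ)‖
      ≤ (gridSystem hab h0 h2 N).w j.2 ^ (-(α / 2)) := by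
  have hw := (gridSystem hab h0 h2 N).w_pos j.2
  rw [norm_div, Complex.norm_I, Complex.norm_real, Real.norm_eq_abs,
    (gridSystem hab h0 h2 N).abs_lam (by linarith), Real.rpow_neg hw.le, one_div]
  exact inv_anti₀ (Real.rpow_pos_of_pos hw _) ((gridSystem hab h0 h2 N).le_δ j.2)

lemma pnorm_exactTwist_le {t : ℝ} {s : ℝ} (hM : 0 ≤ M)
    (hu : SeqBound a b (s + α / 2) (coeff a b (u t)) M) (hv : SeqBound a b s (coeff a b (v t)) M) :
    (gridSystem hab h0 h2 N).pnorm (s + α / 2) (exactTwist hab h0 h2 N u v t) ≤ 4 * M := by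
  have h := (gridSystem hab h0 h2 N).pnorm_pair_le (s := s)
    (Ψ := exactTwist hab h0 h2 N u v t) (c := fun x => coeff a b (u t) (rep x))
    (d := fun x => coeff a b (v t) (rep x)) fun j => by
      rw [exactTwist, norm_mul, GridSystem.norm_phase, one_mul]
      refine (norm_sub_le _ _).trans (add_le_add le_rfl ?_)
      rw [norm_mul]
      exact mul_le_mul_of_nonneg_right (norm_I_div_lam_le hab h0 h2 N j) (norm_nonneg _)
  have h3 := wnorm_rep_le hab h0 h2 (N := N) hM hu
  have h4 := wnorm_rep_le hab h0 h2 (N := N) hM hv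
  linarith

end Solution

end NSFSGE

namespace NSFSGE

section Scheme

variable {a b α : ℝ} (hab : a < b) (h0 : 0 ≤ α) (h2 : α ≤ 2) {N : ℕ} [NeZero N]

/-! ### The scheme in twisted variables -/

lemma anal_linearHalfStep_true (hN : Even N) (τ : ℝ) (g : Grid N) (x : ZMod N × ZMod N) :
    (gridSystem hab h0 h2 N).anal (linearHalfStep a b α τ 1 g) x
      = (gridSystem hab h0 h2 N).phase (τ / 2) (true, x)
        * (gridSystem hab h0 h2 N).anal g x := by
  rw [linearHalfStep, anal_multiplier hab h0 h2 hN]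
  congr 1
  simp only [GridSystem.phase, GridSystem.lam, GridSystem.sgn, gridSystem, cond_true]
  congr 3
  push_cast; ring

lemma anal_linearHalfStep_false (hN : Even N) (τ : ℝ) (g : Grid N) (x : ZMod N × ZMod N) :
    (gridSystem hab h0 h2 N).anal (linearHalfStep a b α τ (-1) g) x
      = (gridSystem hab h0 h2 N).phase (τ / 2) (false, x)
        * (gridSystem hab h0 h2 N).anal g x := by
  rw [linearHalfStep, anal_multiplier hab h0 h2 hN]
  congr 1
  simp only [GridSystem.phase, GridSystem.lam, GridSystem.sgn, gridSystem, cond_false]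
  congr 3
  push_cast; ring

/-- The twisted variables of a pair of grid functions. -/
def gridTwist (t : ℝ) (φ : Grid N × Grid N) (j : Bool × (ZMod N × ZMod N)) : ℂ :=
  (gridSystem hab h0 h2 N).phase (-t) j
    * (gridSystem hab h0 h2 N).anal (cond j.1 φ.1 φ.2) j.2

lemma phase_mul_gridTwist (s t : ℝ) (φ : Grid N × Grid N) (j : Bool × (ZMod N × ZMod N)) :
    (gridSystem hab h0 h2 N).phase (t + s) j * gridTwist hab h0 h2 t φ j
      = (gridSystem hab h0 h2 N).phase s j
        * (gridSystem hab h0 h2 N).anal (cond j.1 φ.1 φ.2) j.2 := by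
  have := (gridSystem hab h0 h2 N).phase_mul_neg t j
  rw [gridTwist, GridSystem.phase_add, ← mul_assoc,
    mul_right_comm ((gridSystem hab h0 h2 N).phase t j), this, one_mul]

lemma anal_smul_add (r : ℂ) (f g : Grid N) (x : ZMod N × ZMod N) :
    (gridSystem hab h0 h2 N).anal (fun p => f p + r * g p) x
      = (gridSystem hab h0 h2 N).anal f x + r * (gridSystem hab h0 h2 N).anal g x := by
  have e : (fun p => f p + r * g p) = f + r • g := by ext p; simp
  rw [e, GridSystem.anal_add, GridSystem.anal_smul]; simp

/-- The two linear half steps only change phases, and the kick is computed from u after the first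
half step, that is, with phases at t + τ/2. In twisted variables the splitting is therefore one
explicit step with the forcing evaluated at the midpoint time and at the old Ψ. -/
lemma gridTwist_strangStep (hN : Even N) {ε : ℝ} (hε : 0 < ε) (t τ : ℝ) (φ : Grid N × Grid N) :
    gridTwist hab h0 h2 (t + τ) (strangStep a b α ε τ φ) = gridTwist hab h0 h2 t φ
      + (ε ^ 2 * τ) • (gridSystem hab h0 h2 N).nl (gfun ε) (t + τ / 2)
        (gridTwist hab h0 h2 t φ) := by
  obtain ⟨S, hS⟩ : ∃ S, S = gridSystem hab h0 h2 N := ⟨_, rfl⟩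
  obtain ⟨gp, hgp⟩ : ∃ gp : Grid N, gp = linearHalfStep a b α τ 1 φ.1 := ⟨_, rfl⟩
  obtain ⟨gm, hgm⟩ : ∃ gm : Grid N, gm = linearHalfStep a b α τ (-1) φ.2 := ⟨_, rfl⟩
  have hu : S.uOf (t + τ / 2) (gridTwist hab h0 h2 t φ) = fun p => (gp p + gm p) / 2 := by
    have e : (fun p => (gp p + gm p) / 2) = S.synth (S.anal ((2 : ℂ)⁻¹ • (gp + gm))) := by
      rw [S.synth_anal]; ext p; simp; ring
    rw [e, GridSystem.uOf]
    congr 1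
    ext x
    rw [S.anal_smul, S.anal_add, Pi.smul_apply, Pi.add_apply, hgp, hgm, hS,
      anal_linearHalfStep_true hab h0 h2 hN, anal_linearHalfStep_false hab h0 h2 hN,
      phase_mul_gridTwist, phase_mul_gridTwist]
    simp only [cond_true, cond_false, smul_eq_mul]; ring
  have hnl : (fun p => nonlin ε ((gp p + gm p) / 2))
      = ((ε : ℂ) ^ 2) • fun p => gfun ε ((gp p + gm p) / 2) := by
    ext p; rw [nonlin_eq hε]; rfl
  have hstep : strangStep a b α ε τ φ
      = (linearHalfStep a b α τ 1 (fun p => gp p + (τ : ℂ)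
          * multiplier a b (fun k => Complex.I / (delta a b α k : ℂ))
            (fun p => nonlin ε ((gp p + gm p) / 2)) p),
        linearHalfStep a b α τ (-1) (fun p => gm p + (-(τ : ℂ))
          * multiplier a b (fun k => Complex.I / (delta a b α k : ℂ))
            (fun p => nonlin ε ((gp p + gm p) / 2)) p)) := by
    rw [hgp, hgm, strangStep]
    simp only [neg_mul, ← sub_eq_add_neg]
  have hph : ∀ j, S.phase (-(t + τ)) j * S.phase (τ / 2) j = S.phase (-(t + τ / 2)) j := fun j => by
    rw [← S.phase_add]; congr 1; ring
  have hph2 : ∀ j, S.phase (-(t + τ / 2)) j * S.phase (τ / 2) j = S.phase (-t) j := fun j => by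
    rw [← S.phase_add]; congr 1; ring
  rw [← hS, GridSystem.nl, hu]
  ext ⟨s, x⟩
  simp only [Pi.add_apply, Pi.smul_apply, GridSystem.force]
  have hδ : S.lam (true, x) = delta a b α (rep x) := by
    simp [hS, GridSystem.lam, GridSystem.sgn, gridSystem]
  have hδ' : S.lam (false, x) = -delta a b α (rep x) := by
    simp [hS, GridSystem.lam, GridSystem.sgn, gridSystem]
  cases s
  · rw [gridTwist, gridTwist, hstep]
    simp only [cond_false]
    rw [anal_linearHalfStep_false hab h0 h2 hN, anal_smul_add, anal_multiplier hab h0 h2 hN, hnl,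
      GridSystem.anal_smul, hgm, anal_linearHalfStep_false hab h0 h2 hN, ← hgm, ← hS, ← mul_assoc,
      hph, mul_add, ← mul_assoc, hph2, hδ', Pi.smul_apply, Complex.real_smul, smul_eq_mul]
    push_cast
    rw [div_neg]
    ring
  · rw [gridTwist, gridTwist, hstep]
    simp only [cond_true]
    rw [anal_linearHalfStep_true hab h0 h2 hN, anal_smul_add, anal_multiplier hab h0 h2 hN, hnl,
      GridSystem.anal_smul, hgp, anal_linearHalfStep_true hab h0 h2 hN, ← hgp, ← hS, ← mul_assoc,
      hph, mul_add, ← mul_assoc, hph2, hδ, Pi.smul_apply, Complex.real_smul, smul_eq_mul]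
    push_cast
    ring

lemma gridTwist_initialState (hN : Even N) (u₀ u₁ : ℝ × ℝ → ℂ) (j : Bool × (ZMod N × ZMod N)) :
    gridTwist hab h0 h2 0 (initialState a b α N u₀ u₁) j
      = (gridSystem hab h0 h2 N).anal (fun p => u₀ (gridPoint a b N p)) j.2
        - Complex.I / ((gridSystem hab h0 h2 N).lam j : ℂ)
          * (gridSystem hab h0 h2 N).anal (fun p => u₁ (gridPoint a b N p)) j.2 := by
  obtain ⟨s, x⟩ := j
  rw [gridTwist, neg_zero, GridSystem.phase_zero, one_mul]
  have e1 : (initialState a b α N u₀ u₁).1 = fun p => u₀ (gridPoint a b N p) + (-Complex.I)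
      * multiplier a b (fun k => 1 / (delta a b α k : ℂ)) (fun p => u₁ (gridPoint a b N p)) p := by
    ext p; simp [initialState, sub_eq_add_neg]
  have e2 : (initialState a b α N u₀ u₁).2 = fun p => u₀ (gridPoint a b N p) + Complex.I
      * multiplier a b (fun k => 1 / (delta a b α k : ℂ)) (fun p => u₁ (gridPoint a b N p)) p := rfl
  have hδ : (gridSystem hab h0 h2 N).lam (true, x) = delta a b α (rep x) := by
    simp [GridSystem.lam, GridSystem.sgn, gridSystem]
  have hδ' : (gridSystem hab h0 h2 N).lam (false, x) = -delta a b α (rep x) := by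
    simp [GridSystem.lam, GridSystem.sgn, gridSystem]
  cases s
  · simp only [cond_false]
    rw [e2, anal_smul_add, anal_multiplier hab h0 h2 hN, hδ']
    push_cast
    rw [div_neg]; ring
  · simp only [cond_true]
    rw [e1, anal_smul_add, anal_multiplier hab h0 h2 hN, hδ]
    ring

/-! ### Interpolation -/

lemma coeff_interp (hab : a < b) (g : Grid N) (k : ℤ × ℤ) :
    coeff a b (interp a b g) k = if k ∈ indexSet N then discreteCoeff a b g k else 0 := by
  let c : ℤ × ℤ → ℂ := fun k => if k ∈ indexSet N then discreteCoeff a b g k else 0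
  have hc : Summable fun k => ‖c k‖ :=
    summable_of_ne_finset_zero (s := indexSet N) fun k hk => by simp [c, hk]
  have e : interp a b g = fun z => series c (toTorus a b z) := by
    ext z
    have h1 := hasSum_series_apply a b hc z
    have h3 : HasSum (fun k => c k * mode a b k z) (∑ k ∈ indexSet N, c k * mode a b k z) :=
      hasSum_sum_of_ne_finset_zero fun k hk => by simp [c, hk]
    rw [h1.unique h3, interp]
    exact Finset.sum_congr rfl fun k hk => by simp [c, hk]
  rw [e, coeff_series hab hc]

lemma continuous_interp (g : Grid N) : Continuous (interp a b g) :=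
  continuous_finsetSum _ fun k _ => continuous_const.mul (continuous_mode a b k)

/-- The error of a trigonometric polynomial is the error of its coefficients plus a tail. -/
lemma normH_sub_interp_le (hN : Even N) {r s M : ℝ} (hs : 0 ≤ s) (hM : 0 ≤ M)
    {w : ℝ × ℝ → ℂ} (hw : IntegrableOn w (square a b)) (hc : SeqBound a b (s + r) (coeff a b w) M)
    (g : Grid N) :
    normH a b r (fun z => w z - interp a b g z) ≤
      wnorm (gridSystem hab h0 h2 N).w r
        ((fun x => coeff a b w (rep x)) - (gridSystem hab h0 h2 N).anal g)
      + M * meshSize a b N ^ s := by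
  have hpos := meshSize_pos (N := N) hab
  obtain ⟨X, hX⟩ : ∃ X, X = wnorm (gridSystem hab h0 h2 N).w r
        ((fun x => coeff a b w (rep x)) - (gridSystem hab h0 h2 N).anal g) := ⟨_, rfl⟩
  have hX0 : 0 ≤ X := hX ▸ wnorm_nonneg _
  have hY0 : 0 ≤ M * meshSize a b N ^ s := by positivity
  have hcoef : ∀ k, coeff a b (fun z => w z - interp a b g z) k
      = coeff a b w k - if k ∈ indexSet N then discreteCoeff a b g k else 0 := fun k => by
    rw [coeff_sub a b hw (integrableOn_of_continuous a b (continuous_interp g)), coeff_interp hab]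
  rw [← hX]
  refine Real.sqrt_le_iff.2 ⟨by linarith, ?_⟩
  refine tsum_le_of_sum_le' (sq_nonneg _) fun F => ?_
  have hterm : ∀ k, sobolevTerm a b r (fun z => w z - interp a b g z) k
      = (wt a b k ^ r * ‖coeff a b w k - if k ∈ indexSet N then discreteCoeff a b g k else 0‖) ^ 2 :=
    fun k => by rw [sobolevTerm, rpow_wt, mul_pow, hcoef]
  simp only [hterm]
  rw [← Finset.sum_filter_add_sum_filter_not F (fun k => k ∈ indexSet N)]
  have e1 : ∑ k ∈ F with k ∈ indexSet N, (wt a b k ^ r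
      * ‖coeff a b w k - if k ∈ indexSet N then discreteCoeff a b g k else 0‖) ^ 2 ≤ X ^ 2 := by
    rw [hX, wnorm_sq (gridSystem hab h0 h2 N).one_le_w]
    refine (Finset.sum_le_sum_of_subset_of_nonneg (t := indexSet N)
      (fun k hk => (Finset.mem_filter.1 hk).2) fun _ _ _ => sq_nonneg _).trans (le_of_eq ?_)
    rw [sum_indexSet hN]
    refine Finset.sum_congr rfl fun x _ => ?_
    rw [if_pos (rep_mem hN x), Pi.sub_apply, anal_gridSystem]
    rfl
  have e2 : ∑ k ∈ F with k ∉ indexSet N, (wt a b k ^ r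
      * ‖coeff a b w k - if k ∈ indexSet N then discreteCoeff a b g k else 0‖) ^ 2
      ≤ (M * meshSize a b N ^ s) ^ 2 := by
    have h3 : ∀ k ∈ F.filter (fun k => k ∉ indexSet N), (wt a b k ^ r
        * ‖coeff a b w k - if k ∈ indexSet N then discreteCoeff a b g k else 0‖) ^ 2
        ≤ (meshSize a b N ^ s) ^ 2 * (wt a b k ^ (s + r) * ‖coeff a b w k‖) ^ 2 := fun k hk => by
      have hk' := (Finset.mem_filter.1 hk).2
      have hwt := wt_pos a b k
      rw [if_neg hk', sub_zero, ← mul_pow, ← mul_assoc, Real.rpow_add hwt, ← mul_assoc]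
      -- Outside T_N the weight is at least 1/h, so s spare derivatives are worth h^s.
      have h4 : 1 ≤ meshSize a b N ^ s * wt a b k ^ s := by
        rw [← Real.mul_rpow hpos.le hwt.le]
        refine Real.one_le_rpow ?_ hs
        have := one_div_le_wt hab hN hk'
        rwa [div_le_iff₀' hpos] at this
      have h5 : 0 ≤ wt a b k ^ r := Real.rpow_nonneg hwt.le _
      refine pow_le_pow_left₀ (by positivity) ?_ 2
      refine mul_le_mul_of_nonneg_right ?_ (norm_nonneg _)
      nlinarith
    refine (Finset.sum_le_sum h3).trans ?_
    rw [← Finset.mul_sum, mul_pow, mul_comm]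
    exact mul_le_mul_of_nonneg_right (hc _) (sq_nonneg _)
  nlinarith

/-! ### The error of the scheme -/

variable {ε τ : ℝ} {u₀ u₁ : ℝ × ℝ → ℂ} {u v : ℝ → ℝ × ℝ → ℂ}

/-- The twisted variables of the scheme. -/
def schemeTwist (ε τ : ℝ) (u₀ u₁ : ℝ × ℝ → ℂ) (n : ℕ) : Bool × (ZMod N × ZMod N) → ℂ :=
  gridTwist hab h0 h2 (n * τ) (tsfp a b α ε τ N u₀ u₁ n)

lemma schemeTwist_succ (hN : Even N) (hε : 0 < ε) (n : ℕ) :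
    schemeTwist hab h0 h2 (N := N) ε τ u₀ u₁ (n + 1) = schemeTwist hab h0 h2 ε τ u₀ u₁ n
      + (ε ^ 2 * τ) • (gridSystem hab h0 h2 N).nl (gfun ε) (n * τ + τ / 2)
        (schemeTwist hab h0 h2 ε τ u₀ u₁ n) := by
  have := gridTwist_strangStep hab h0 h2 hN hε (n * τ) τ (tsfp a b α ε τ N u₀ u₁ n)
  rw [schemeTwist, tsfp, schemeTwist, ← this]
  congr 1
  push_cast; ring

lemma anal_numU (n : ℕ) : (gridSystem hab h0 h2 N).anal (numU a b α ε τ N u₀ u₁ n)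
    = (gridSystem hab h0 h2 N).anal ((gridSystem hab h0 h2 N).uOf (n * τ)
      (schemeTwist hab h0 h2 ε τ u₀ u₁ n)) := by
  rw [GridSystem.uOf, GridSystem.anal_synth]
  have e : numU a b α ε τ N u₀ u₁ n = (2 : ℂ)⁻¹
      • ((tsfp a b α ε τ N u₀ u₁ n).1 + (tsfp a b α ε τ N u₀ u₁ n).2) := by
    ext p; simp [numU]; ring
  ext x
  have h1 := phase_mul_gridTwist hab h0 h2 0 (n * τ) (tsfp a b α ε τ N u₀ u₁ n) (true, x)
  have h3 := phase_mul_gridTwist hab h0 h2 0 (n * τ) (tsfp a b α ε τ N u₀ u₁ n) (false, x)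
  rw [add_zero, GridSystem.phase_zero, one_mul] at h1 h3
  rw [e, GridSystem.anal_smul, GridSystem.anal_add, schemeTwist, h1, h3]
  simp only [cond_true, cond_false, Pi.smul_apply, Pi.add_apply, smul_eq_mul]
  ring

lemma anal_numV (hN : Even N) (n : ℕ) (x : ZMod N × ZMod N) :
    (gridSystem hab h0 h2 N).anal (numV a b α ε τ N u₀ u₁ n) x
    = Complex.I / 2 * ((gridSystem hab h0 h2 N).δ x : ℂ)
      * ((gridSystem hab h0 h2 N).phase (n * τ) (true, x)
          * schemeTwist hab h0 h2 ε τ u₀ u₁ n (true, x)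
        - (gridSystem hab h0 h2 N).phase (n * τ) (false, x)
          * schemeTwist hab h0 h2 ε τ u₀ u₁ n (false, x)) := by
  have h1 := phase_mul_gridTwist hab h0 h2 0 (n * τ) (tsfp a b α ε τ N u₀ u₁ n) (true, x)
  have h3 := phase_mul_gridTwist hab h0 h2 0 (n * τ) (tsfp a b α ε τ N u₀ u₁ n) (false, x)
  rw [add_zero, GridSystem.phase_zero, one_mul] at h1 h3
  rw [schemeTwist, h1, h3, numV, anal_multiplier hab h0 h2 hN]
  have e : (fun p => (tsfp a b α ε τ N u₀ u₁ n).1 p - (tsfp a b α ε τ N u₀ u₁ n).2 p)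
    = (tsfp a b α ε τ N u₀ u₁ n).1 - (tsfp a b α ε τ N u₀ u₁ n).2 := rfl
  rw [e, GridSystem.anal_sub]
  rfl

lemma coeff_v_eq (t : ℝ) (x : ZMod N × ZMod N) : coeff a b (v t) (rep x)
    = Complex.I / 2 * ((gridSystem hab h0 h2 N).δ x : ℂ)
      * ((gridSystem hab h0 h2 N).phase t (true, x) * exactTwist hab h0 h2 N u v t (true, x)
        - (gridSystem hab h0 h2 N).phase t (false, x)
          * exactTwist hab h0 h2 N u v t (false, x)) := by
  have e1 := (gridSystem hab h0 h2 N).phase_mul_neg t (true, x)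
  have e2 := (gridSystem hab h0 h2 N).phase_mul_neg t (false, x)
  have hδ : ((gridSystem hab h0 h2 N).lam (true, x) : ℂ) = (gridSystem hab h0 h2 N).δ x := by
    simp [GridSystem.lam, GridSystem.sgn]
  have hδ' : ((gridSystem hab h0 h2 N).lam (false, x) : ℂ) = -(gridSystem hab h0 h2 N).δ x := by
    simp [GridSystem.lam, GridSystem.sgn]
  have hne : ((gridSystem hab h0 h2 N).δ x : ℂ) ≠ 0 := by
    have := (gridSystem hab h0 h2 N).one_le_δ (by linarith) x
    exact Complex.ofReal_ne_zero.2 (by linarith)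
  simp only [exactTwist, ← mul_assoc, e1, e2, hδ, hδ', div_neg]
  field_simp
  ring_nf
  simp only [Complex.I_sq]
  ring

lemma _root_.NSFSGE.GridSystem.wnorm_zero_le_pnorm {G P : Type} [AddCommGroup G] [Fintype G]
    [Fintype P] {β : ℝ} (S : GridSystem G P β) {c : G → ℂ} {D : Bool × G → ℂ}
    (h : ∀ k, ‖c k‖ ≤ S.w k ^ β * (‖D (true, k)‖ + ‖D (false, k)‖)) :
    wnorm S.w 0 c ≤ 2 * S.pnorm β D := by
  refine abs_le_of_sq_le_sq' ?_ (mul_nonneg zero_le_two (S.pnorm_nonneg _ _)) |>.2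
  rw [mul_pow, S.pnorm_sq, wnorm_sq S.one_le_w, Finset.mul_sum]
  refine Finset.sum_le_sum fun k _ => ?_
  rw [Real.rpow_zero, one_mul]
  have h1 := pow_le_pow_left₀ (norm_nonneg _) (h k) 2
  rw [mul_pow] at h1
  refine h1.trans ?_
  rw [mul_left_comm]
  refine mul_le_mul_of_nonneg_left ?_ (sq_nonneg _)
  nlinarith [sq_nonneg (‖D (true, k)‖ - ‖D (false, k)‖), sq_nonneg (‖D (true, k)‖),
    sq_nonneg (‖D (false, k)‖)]

/-- The error in u is bounded by one twisted norm and the error in ∂ₜu by two, since v carries the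
factor δ/2 ≤ w^{α/2}; each also has a truncation tail M h^m. -/
lemma schemeError_le (hN : Even N) {m M : ℝ} (hm : 0 ≤ m) (hM : 0 ≤ M) (n : ℕ)
    (hu : IntegrableOn (u (n * τ)) (square a b)) (hv : IntegrableOn (v (n * τ)) (square a b))
    (hcu : SeqBound a b (m + α / 2) (coeff a b (u (n * τ))) M)
    (hcv : SeqBound a b m (coeff a b (v (n * τ))) M) :
    schemeError a b α ε τ N u₀ u₁ u v n ≤
      3 * (gridSystem hab h0 h2 N).pnorm (α / 2)
        (schemeTwist hab h0 h2 ε τ u₀ u₁ n - exactTwist hab h0 h2 N u v (n * τ))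
      + 2 * (M * meshSize a b N ^ m) := by
  obtain ⟨D, hD⟩ : ∃ D, D = exactTwist hab h0 h2 N u v (n * τ)
    - schemeTwist hab h0 h2 ε τ u₀ u₁ n := ⟨_, rfl⟩
  have hDn : (gridSystem hab h0 h2 N).pnorm (α / 2)
      (schemeTwist hab h0 h2 ε τ u₀ u₁ n - exactTwist hab h0 h2 N u v (n * τ))
      = (gridSystem hab h0 h2 N).pnorm (α / 2) D := by
    rw [hD, GridSystem.pnorm, GridSystem.pnorm, wnorm_sub_comm]
  have h1 := normH_sub_interp_le hab h0 h2 hN hm hM hu hcu (numU a b α ε τ N u₀ u₁ n)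
  have h3 := normH_sub_interp_le hab h0 h2 hN (r := 0) hm hM hv (by simpa using hcv)
    (numV a b α ε τ N u₀ u₁ n)
  have h4 : wnorm (gridSystem hab h0 h2 N).w (α / 2) ((fun x => coeff a b (u (n * τ)) (rep x))
      - (gridSystem hab h0 h2 N).anal (numU a b α ε τ N u₀ u₁ n))
      ≤ (gridSystem hab h0 h2 N).pnorm (α / 2) D := by
    have e := uOf_exactTwist hab h0 h2 N (u := u) (v := v) (n * τ)
    have e2 : (fun x => coeff a b (u (n * τ)) (rep x)) = (gridSystem hab h0 h2 N).anal
        ((gridSystem hab h0 h2 N).uOf (n * τ) (exactTwist hab h0 h2 N u v (n * τ))) := by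
      rw [e, GridSystem.anal_synth]
    rw [e2, anal_numU, ← GridSystem.anal_sub, ← GridSystem.uOf_sub, ← hD]
    exact (gridSystem hab h0 h2 N).hnorm_uOf_le _ _ _
  have h5 : wnorm (gridSystem hab h0 h2 N).w 0 ((fun x => coeff a b (v (n * τ)) (rep x))
      - (gridSystem hab h0 h2 N).anal (numV a b α ε τ N u₀ u₁ n))
      ≤ 2 * (gridSystem hab h0 h2 N).pnorm (α / 2) D := by
    refine (gridSystem hab h0 h2 N).wnorm_zero_le_pnorm fun x => ?_
    have e : ((fun x => coeff a b (v (n * τ)) (rep x))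
        - (gridSystem hab h0 h2 N).anal (numV a b α ε τ N u₀ u₁ n) : ZMod N × ZMod N → ℂ) x
        = Complex.I / 2 * ((gridSystem hab h0 h2 N).δ x : ℂ)
          * ((gridSystem hab h0 h2 N).phase (n * τ) (true, x) * D (true, x)
            - (gridSystem hab h0 h2 N).phase (n * τ) (false, x) * D (false, x)) := by
      rw [Pi.sub_apply, anal_numV hab h0 h2 hN, coeff_v_eq hab h0 h2 (u := u), hD]
      simp only [Pi.sub_apply]
      ring
    have hδ := (gridSystem hab h0 h2 N).δ_le x
    have hδ0 := (gridSystem hab h0 h2 N).one_le_δ (by linarith) x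
    have h6 := norm_sub_le ((gridSystem hab h0 h2 N).phase (n * τ) (true, x) * D (true, x))
      ((gridSystem hab h0 h2 N).phase (n * τ) (false, x) * D (false, x))
    rw [norm_mul, norm_mul, GridSystem.norm_phase, GridSystem.norm_phase, one_mul, one_mul] at h6
    have h7 : ‖Complex.I / 2 * ((gridSystem hab h0 h2 N).δ x : ℂ)‖
        ≤ (gridSystem hab h0 h2 N).w x ^ (α / 2) := by
      rw [norm_mul, norm_div, Complex.norm_I, Complex.norm_real,
        Real.norm_of_nonneg (by linarith), Complex.norm_ofNat]
      linarith
    rw [e, norm_mul]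
    exact mul_le_mul h7 h6 (norm_nonneg _) ((norm_nonneg _).trans h7)
  rw [schemeError, hDn]
  linarith

end Scheme

end NSFSGE

/-! ### Convergence for all small mesh and step sizes -/

namespace NSFSGE

section Convergence

variable {a b α T m M ε τ : ℝ} {u₀ u₁ : ℝ × ℝ → ℂ} {u v : ℝ → ℝ × ℝ → ℂ}
variable {N : ℕ} [NeZero N]

/-- The constant of the spatial error. -/
def spaceC (a b α σ m M : ℝ) : ℝ :=
  2 * defectC (weightSum a b σ) m M + 2 * (aliasC (α / 2) (m + α / 2) * M + aliasC 0 m * M)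

lemma weightSum_nonneg (a b s : ℝ) : 0 ≤ weightSum a b s := by
  have := latticeSum_nonneg s
  unfold weightSum
  have : 0 ≤ min 1 ((2 * Real.pi / (b - a)) ^ 2) := le_min zero_le_one (sq_nonneg _)
  positivity

lemma defectC_nonneg (K m : ℝ) (hM : 0 ≤ M) : 0 ≤ defectC K m M := by
  have := aliasC_nonneg 0 m
  unfold defectC ghatC
  positivity

lemma spaceC_nonneg (a b α σ m : ℝ) (hM : 0 ≤ M) : 0 ≤ spaceC a b α σ m M := by
  have := aliasC_nonneg 0 m
  have := aliasC_nonneg (α / 2) (m + α / 2)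
  have := defectC_nonneg (weightSum a b σ) m hM
  unfold spaceC
  positivity

/-- The scheme starts from sampled data and the truncated solution from true coefficients, so the
initial error is pure aliasing of u₀ and u₁. -/
lemma pnorm_initial_le (hab : a < b) (h0 : 0 < α) (h2 : α ≤ 2) (hN : Even N)
    (hh : meshSize a b N ≤ 1) (hm : 1 < m) (hM : 0 ≤ M) {S : ℝ}
    (hsol : IsSolution a b α ε S u₀ u₁ u v)
    (hu : SeqBound a b (m + α / 2) (coeff a b (u 0)) M)
    (hv : SeqBound a b m (coeff a b (v 0)) M) :
    (gridSystem hab h0.le h2 N).pnorm (α / 2) (schemeTwist hab h0.le h2 ε τ u₀ u₁ 0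
      - exactTwist hab h0.le h2 N u v 0)
      ≤ 2 * (aliasC (α / 2) (m + α / 2) * M + aliasC 0 m * M) * meshSize a b N ^ m := by
  have hsq : ∀ z ∈ square a b, z ∈ Set.Icc a b ×ˢ Set.Icc a b := fun z hz =>
    ⟨Set.Ioo_subset_Icc_self hz.1, Set.Ioo_subset_Icc_self hz.2⟩
  have eu : coeff a b (u 0) = coeff a b u₀ := funext fun k => coeff_congr
    ((ae_restrict_mem (isOpen_square a b).measurableSet).mono fun z hz => hsol.init_u z (hsq z hz)) k
  have ev : coeff a b (v 0) = coeff a b u₁ := funext fun k => coeff_congr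
    ((ae_restrict_mem (isOpen_square a b).measurableSet).mono fun z hz => hsol.init_v z (hsq z hz)) k
  rw [eu] at hu
  rw [ev] at hv
  have gu := onGrid_series (N := N) hab hsol.contPer_u₀.1 (hu.summable hM hab (by linarith))
  have gv := onGrid_series (N := N) hab hsol.contPer_u₁.1 (hv.summable hM hab hm)
  have a1 := wnorm_alias_le hab h0.le h2 (N := N) hh (r := α / 2) (by linarith) (by linarith) hM hu
  have a2 := wnorm_alias_le hab h0.le h2 (N := N) hh (r := 0) le_rfl hm hM hv
  rw [gu, add_sub_cancel_right] at a1
  rw [gv, sub_zero] at a2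
  have h3 := (gridSystem hab h0.le h2 N).pnorm_pair_le (s := 0)
    (Ψ := schemeTwist hab h0.le h2 ε τ u₀ u₁ 0 - exactTwist hab h0.le h2 N u v 0)
    (c := fun x => (gridSystem hab h0.le h2 N).anal (fun p => u₀ (gridPoint a b N p)) x
      - coeff a b u₀ (rep x))
    (d := fun x => (gridSystem hab h0.le h2 N).anal (fun p => u₁ (gridPoint a b N p)) x
      - coeff a b u₁ (rep x)) fun j => by
      have e : (schemeTwist hab h0.le h2 ε τ u₀ u₁ 0 - exactTwist hab h0.le h2 N u v 0 :
          Bool × (ZMod N × ZMod N) → ℂ) j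
          = ((gridSystem hab h0.le h2 N).anal (fun p => u₀ (gridPoint a b N p)) j.2
              - coeff a b u₀ (rep j.2))
            - Complex.I / ((gridSystem hab h0.le h2 N).lam j : ℂ)
              * ((gridSystem hab h0.le h2 N).anal (fun p => u₁ (gridPoint a b N p)) j.2
                - coeff a b u₁ (rep j.2)) := by
        rw [Pi.sub_apply, schemeTwist, Nat.cast_zero, zero_mul, tsfp,
          gridTwist_initialState hab h0.le h2 hN, exactTwist, neg_zero, GridSystem.phase_zero,
          one_mul, eu, ev]
        ring
      rw [e]
      refine (norm_sub_le _ _).trans (add_le_add le_rfl ?_)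
      rw [norm_mul]
      exact mul_le_mul_of_nonneg_right (norm_I_div_lam_le hab h0.le h2 N j) (norm_nonneg _)
  rw [zero_add] at h3
  refine h3.trans ?_
  calc _ ≤ 2 * (aliasC (α / 2) (m + α / 2) * (meshSize a b N ^ m * M)
        + aliasC 0 m * (meshSize a b N ^ m * M)) := by gcongr
    _ = _ := by ring

/-- The defect and the initial error are small only in the weak norm; the inverse inequality
transports them to H^σ at the price h^{-σ}, affordable because σ < m. -/
lemma pnorm_inverse_le (hab : a < b) (h0 : 0 < α) (h2 : α ≤ 2) (hh : meshSize a b N ≤ 1) {σ : ℝ}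
    (hσ : 0 ≤ σ) (Ψ : Bool × (ZMod N × ZMod N) → ℂ) :
    (gridSystem hab h0.le h2 N).pnorm σ Ψ ≤ (5 / meshSize a b N) ^ σ
      * (gridSystem hab h0.le h2 N).pnorm (α / 2) Ψ := by
  have hpos := meshSize_pos (N := N) hab
  refine (wnorm_inverse_le (gridSystem hab h0.le h2 N).one_le_wJ
    (fun j => wt_rep_le hab hh j.2) hσ Ψ).trans ?_
  exact mul_le_mul_of_nonneg_left ((gridSystem hab h0.le h2 N).pnorm_mono (by linarith) Ψ)
    (by positivity)

lemma isApproxFlow_exactTwist (hab : a < b) (h0 : 0 < α) (h2 : α ≤ 2) (hT : 0 < T)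
    (hh : meshSize a b N ≤ 1) {σ : ℝ} (hσ : 1 < σ) (hσm : σ ≤ m) (hM : 0 ≤ M) (hε : 0 < ε)
    (hε1 : ε ≤ 1) (hsol : IsSolution a b α ε (T / ε ^ 2) u₀ u₁ u v)
    (hu : ∀ t ∈ Set.Icc 0 (T / ε ^ 2), SeqBound a b (m + α / 2) (coeff a b (u t)) M)
    (hv : ∀ t ∈ Set.Icc 0 (T / ε ^ 2), SeqBound a b m (coeff a b (v t)) M)
    (hsmall : (5 / meshSize a b N) ^ σ * (spaceC a b α σ m M * meshSize a b N ^ m) ≤ 1) :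
    (gridSystem hab h0.le h2 N).IsApproxFlow (weightSum a b σ) σ m (4 * M) T ε
      (spaceC a b α σ m M * meshSize a b N ^ m)
      ((5 / meshSize a b N) ^ σ * (spaceC a b α σ m M * meshSize a b N ^ m))
      (exactTwist hab h0.le h2 N u v)
      (fun t => (gridSystem hab h0.le h2 N).force t
        (defectFun hab h0.le h2 ε (coeff a b (u t)))) := by
  have hpos := meshSize_pos (N := N) hab
  have hdef : ∀ t ∈ Set.Ioo 0 (T / ε ^ 2), (gridSystem hab h0.le h2 N).pnorm (α / 2)
      ((gridSystem hab h0.le h2 N).force t (defectFun hab h0.le h2 ε (coeff a b (u t))))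
      ≤ spaceC a b α σ m M * meshSize a b N ^ m := fun t ht => by
    have hc := (hu t ⟨ht.1.le, ht.2.le⟩).mono_exp (r := m) (by linarith)
    refine ((gridSystem hab h0.le h2 N).pnorm_force_β_le (by linarith) t _).trans ?_
    have h3 := hnorm_defectFun_le hab h0.le h2 hh hε hε1 hσ hσm hM hc
    have h4 := aliasC_nonneg 0 m
    have h5 := aliasC_nonneg (α / 2) (m + α / 2)
    have h6 : 0 ≤ 2 * (aliasC (α / 2) (m + α / 2) * M + aliasC 0 m * M) * meshSize a b N ^ m := by
      positivity
    rw [spaceC, add_mul]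
    linarith
  exact
    { β_pos := by linarith
      β_le_one := by linarith
      β_le_σ := by linarith
      σ_le_m := hσm
      hK := sum_w_gridSystem_le hab h0.le h2 hσ
      T_pos := hT
      ε_pos := hε
      ε_le_one := hε1
      cont := continuousOn_pi.2 fun j => by
        have h3 : Continuous fun t => (gridSystem hab h0.le h2 N).phase (-t) j :=
          continuous_iff_continuousAt.2 fun t =>
            ((gridSystem hab h0.le h2 N).hasDerivAt_phase_neg t j).continuousAt
        exact h3.continuousOn.mul ((hsol.cont_u _).sub (continuousOn_const.mul (hsol.cont_v _)))
      deriv := fun t ht => hasDerivAt_exactTwist hab h0.le h2 N hε hsol ht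
        ((hu t ⟨ht.1.le, ht.2.le⟩).summable hM hab (by linarith))
      bound := fun t ht => pnorm_exactTwist_le hab h0.le h2 N hM (hu t ht) (hv t ht)
      defect := hdef
      defect' := fun t ht => (pnorm_inverse_le hab h0 h2 hh (by linarith) _).trans
        (mul_le_mul_of_nonneg_left (hdef t ht) (by positivity))
      η'_le_one := hsmall }

lemma exists_mesh_bound {p B y : ℝ} (hp : 0 < p) (hB : 0 ≤ B) (hy : 0 < y) :
    ∃ h₀ > (0 : ℝ), h₀ ≤ 1 ∧ ∀ h, 0 < h → h ≤ h₀ → B * h ^ p ≤ y := by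
  have hq : 0 < y / (B + 1) := by positivity
  refine ⟨min 1 ((y / (B + 1)) ^ (1 / p)), lt_min one_pos (by positivity), min_le_left _ _,
    fun h hh hle => ?_⟩
  have h1 : h ^ p ≤ y / (B + 1) := by
    have h3 := Real.rpow_le_rpow hh.le (hle.trans (min_le_right _ _)) hp.le
    rwa [← Real.rpow_mul hq.le, one_div, inv_mul_cancel₀ hp.ne', Real.rpow_one] at h3
  have h3 : B * (y / (B + 1)) ≤ y := by
    rw [mul_div_assoc', div_le_iff₀ (by positivity)]; nlinarith
  exact (mul_le_mul_of_nonneg_left h1 hB).trans h3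

/-- Convergence of the scheme for all small mesh and step sizes. -/
theorem exists_schemeError_bound (hab : a < b) (hα₁ : 1 < α) (hα₂ : α ≤ 2) (hT : 0 < T)
    (hm : 1 < m) (M : ℝ) :
    ∃ C > (0 : ℝ), ∃ h₀ > (0 : ℝ), h₀ ≤ 1 ∧ ∃ τ₁ > (0 : ℝ),
      ∀ ε : ℝ, 0 < ε → ε ≤ 1 → ∀ (u₀ u₁ : ℝ × ℝ → ℂ) (u v : ℝ → ℝ × ℝ → ℂ),
        IsSolution a b α ε (T / ε ^ 2) u₀ u₁ u v → AssumptionA a b α m (T / ε ^ 2) M u v →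
        ∀ N : ℕ, 0 < N → Even N → meshSize a b N ≤ h₀ →
        ∀ τ : ℝ, 0 < τ → τ ≤ τ₁ → ∀ n : ℕ, (n : ℝ) ≤ T / ε ^ 2 / τ →
          schemeError a b α ε τ N u₀ u₁ u v n
            ≤ C * (meshSize a b N ^ m + ε ^ 2 * τ ^ 2 + τ ^ (m + α / 2)) := by
  have h0 : 0 < α := by linarith
  -- Any σ strictly between 1 and m serves: σ > 1 for the algebra property, σ < m so that h^{m-σ}
  -- tends to 0.
  obtain ⟨σ, hσdef⟩ : ∃ σ, σ = (1 + m) / 2 := ⟨_, rfl⟩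
  have hσ : 1 < σ := by linarith
  have hσm : σ < m := by linarith
  obtain ⟨M', hM'⟩ : ∃ M', M' = |M| := ⟨_, rfl⟩
  have hM0 : 0 ≤ M' := hM' ▸ abs_nonneg M
  obtain ⟨K, hKdef⟩ : ∃ K, K = weightSum a b σ := ⟨_, rfl⟩
  have hK0 : 0 ≤ K := hKdef ▸ weightSum_nonneg a b σ
  obtain ⟨E, hE⟩ : ∃ E, E = spaceC a b α σ m M' := ⟨_, rfl⟩
  have hE0 : 0 ≤ E := hE ▸ spaceC_nonneg a b α σ m hM0
  obtain ⟨X, hX⟩ : ∃ X, X = Real.exp (T * GridSystem.lipC K σ (4 * M')) := ⟨_, rfl⟩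
  have hX0 : 0 < X := hX ▸ Real.exp_pos _
  obtain ⟨Y, hY⟩ : ∃ Y, Y = GridSystem.firstC K σ m (4 * M') := ⟨_, rfl⟩
  have hY0 : 0 ≤ Y := by
    have h3 := GridSystem.one_le_algC K σ
    have h4 := GridSystem.one_le_algC K m
    rw [hY, GridSystem.firstC]; positivity
  obtain ⟨D, hD⟩ : ∃ D, D = GridSystem.errC (α / 2) K σ m (4 * M') T := ⟨_, rfl⟩
  have hD0 : 0 ≤ D := by
    have h3 := GridSystem.localC_nonneg (β := α / 2) (K := K) (σ := σ) (m := m) (R := 4 * M')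
      (by positivity)
    have h4 := GridSystem.one_le_algC K σ
    rw [hD, GridSystem.errC]; positivity
  -- The quantity made small is the strong-norm defect 5^σ E h^{m-σ}. The bound 1 is required of an
  -- approximate flow; the other one uses up half of the smallness condition of the bootstrap.
  obtain ⟨h₀, hh₀, hh₁, hmesh⟩ := exists_mesh_bound (p := m - σ) (B := 5 ^ σ * E)
    (y := min 1 (1 / (2 * (1 + T) * X))) (by linarith) (by positivity)
    (lt_min one_pos (by positivity))
  -- The step size must satisfy 9τ ≤ 1 for the frequency cutoff and uses up the other half of the
  -- smallness condition. In the constant, 3D(E + 1) comes from the twisted error, 2M' from the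
  -- truncation tails, and 1 only ensures positivity.
  refine ⟨3 * (D * (E + 1)) + 2 * M' + 1, by positivity, h₀, hh₀, hh₁,
    min (1 / 9) (1 / (2 * (T * Y + 1) * X)), lt_min (by norm_num) (by positivity), ?_⟩
  intro ε hε hε1 u₀ u₁ u v hsol hA N hN0 hN hmeshN τ hτ hττ n hn
  have : NeZero N := ⟨hN0.ne'⟩
  have hpos := meshSize_pos (N := N) hab
  have hh : meshSize a b N ≤ 1 := hmeshN.trans hh₁
  have hS : 0 < T / ε ^ 2 := by positivity
  have hu := seqBound_of_ae hS hsol.cont_u hA.memH_u hA.bound_u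
  have hv := seqBound_of_ae hS hsol.cont_v hA.memH_v hA.bound_v
  rw [← hM'] at hu hv
  have hη' : (5 / meshSize a b N) ^ σ * (E * meshSize a b N ^ m)
      ≤ min 1 (1 / (2 * (1 + T) * X)) := by
    refine le_trans (le_of_eq ?_) (hmesh _ hpos hmeshN)
    rw [Real.div_rpow (by norm_num) hpos.le, Real.rpow_sub hpos]
    ring
  obtain ⟨η', hη'def⟩ : ∃ η', η' = (5 / meshSize a b N) ^ σ * (E * meshSize a b N ^ m) := ⟨_, rfl⟩
  have hflow := isApproxFlow_exactTwist (N := N) hab h0 hα₂ hT hh hσ hσm.le hM0 hε hε1 hsol hu hv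
    (by rw [← hE]; exact hη'.trans (min_le_left _ _))
  have hinit := pnorm_initial_le (τ := τ) hab h0 hα₂ hN hh hm hM0 hsol
    (hu 0 ⟨le_rfl, hS.le⟩) (hv 0 ⟨le_rfl, hS.le⟩)
  have hinit' : (gridSystem hab h0.le hα₂ N).pnorm (α / 2) (schemeTwist hab h0.le hα₂ ε τ u₀ u₁ 0
      - exactTwist hab h0.le hα₂ N u v 0) ≤ spaceC a b α σ m M' * meshSize a b N ^ m := by
    refine hinit.trans ?_
    have h3 := defectC_nonneg (weightSum a b σ) m hM0
    rw [spaceC]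
    exact mul_le_mul_of_nonneg_right (by linarith) (by positivity)
  have hnτ : (n : ℝ) * τ ≤ T / ε ^ 2 := (le_div_iff₀ hτ).1 hn
  have hτ9 : 9 * τ ≤ 1 := by
    have := hττ.trans (min_le_left _ _)
    linarith
  have hη'0 : 0 ≤ η' := by rw [hη'def]; positivity
  have hsmall : (η' + T * (Y * τ + η')) * X ≤ 1 := by
    rw [← hη'def] at hη'
    have h3 := hη'.trans (min_le_right _ _)
    have h4 := hττ.trans (min_le_right _ _)
    rw [le_div_iff₀ (by positivity)] at h3 h4
    nlinarith [mul_pos hτ hX0]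
  have hmain := hflow.pnorm_error_le hτ hτ9
    (fun n => schemeTwist_succ hab h0.le hα₂ (u₀ := u₀) (u₁ := u₁) (τ := τ) hN hε n) hinit'
    ((pnorm_inverse_le hab h0 hα₂ hh (by linarith) _).trans
      (mul_le_mul_of_nonneg_left hinit' (by positivity)))
    (by rw [← hE, ← hη'def, ← hKdef, ← hX, ← hY]; exact hsmall) hnτ
  rw [← hE, ← hKdef, ← hD] at hmain
  have hmem : (n : ℝ) * τ ∈ Set.Icc 0 (T / ε ^ 2) := ⟨by positivity, hnτ⟩
  have herr := schemeError_le (ε := ε) (u₀ := u₀) (u₁ := u₁) hab h0.le hα₂ hN (by linarith) hM0 n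
    (integrableOn_of_memLp (hsol.memLp_u _ hmem)) (integrableOn_of_memLp (hsol.memLp_v _ hmem))
    (hu _ hmem) (hv _ hmem)
  refine herr.trans ?_
  have p1 : 0 ≤ meshSize a b N ^ m := by positivity
  have p2 : 0 ≤ ε ^ 2 * τ ^ 2 := by positivity
  have p3 : 0 ≤ τ ^ (m + α / 2) := by positivity
  have q1 := mul_nonneg hD0 p1
  have q2 := mul_nonneg (mul_nonneg hD0 hE0) p2
  have q3 := mul_nonneg (mul_nonneg hD0 hE0) p3
  have q4 := mul_nonneg hM0 p2
  have q5 := mul_nonneg hM0 p3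
  nlinarith

end Convergence

end NSFSGE

end

/-! ### The two parts of the theorem -/

theorem theorem3 (a b α T γ : ℝ) (hab : a < b) (hα₁ : 1 < α) (hα₂ : α ≤ 2) (hT : 0 < T)
    (hγ : 0 < γ) :
    (∀ m : ℝ, 1 < m → ∀ M : ℝ,
      ∃ C > (0 : ℝ), ∃ h₀ > (0 : ℝ), ∃ τs : ℝ, 0 < τs ∧ τs < 1 ∧
        ∀ τ₀ : ℝ, 0 < τ₀ → τ₀ ≤ τs → ∀ ε : ℝ, 0 < ε → ε ≤ 1 →
          ∀ (u₀ u₁ : ℝ × ℝ → ℂ) (u v : ℝ → ℝ × ℝ → ℂ),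
            NSFSGE.IsSolution a b α ε (T / ε ^ 2) u₀ u₁ u v →
            NSFSGE.AssumptionA a b α m (T / ε ^ 2) M u v →
            ∀ N : ℕ, 0 < N → Even N → NSFSGE.meshSize a b N ≤ h₀ →
            ∀ τ : ℝ, 0 < τ → τ < γ * τ₀ →
            ∀ n : ℕ, (n : ℝ) ≤ T / ε ^ 2 / τ →
              NSFSGE.schemeError a b α ε τ N u₀ u₁ u v n
                ≤ C * (NSFSGE.meshSize a b N ^ m + ε ^ 2 * τ ^ 2 + τ₀ ^ (m + α / 2))) ∧
    (∀ m : ℝ, 0 ≤ m → ∀ M : ℝ → ℝ, ∀ κ : ℝ, 0 < κ →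
      ∃ C > (0 : ℝ), ∃ h₀ > (0 : ℝ), ∃ c > (0 : ℝ),
        ∀ ε : ℝ, 0 < ε → ε ≤ 1 →
          ∀ (u₀ u₁ : ℝ × ℝ → ℂ) (u v : ℝ → ℝ × ℝ → ℂ),
            NSFSGE.IsSolution a b α ε (T / ε ^ 2) u₀ u₁ u v →
            (∀ s : ℝ, 0 ≤ s → NSFSGE.AssumptionA a b α s (T / ε ^ 2) (M s) u v) →
            ∀ N : ℕ, 0 < N → Even N → NSFSGE.meshSize a b N ≤ h₀ →
            ∀ τ : ℝ, 0 < τ → τ ≤ c * ε ^ κ →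
            ∀ n : ℕ, (n : ℝ) ≤ T / ε ^ 2 / τ →
              NSFSGE.schemeError a b α ε τ N u₀ u₁ u v n
                ≤ C * (NSFSGE.meshSize a b N ^ m + ε ^ 2 * τ ^ 2)) := by
  have hα₀ : 0 < α / 2 := by linarith
  refine ⟨fun m hm M => ?_, fun m hm M κ hκ => ?_⟩
  · obtain ⟨C, hC, h₀, hh₀, -, τ₁, hτ₁, H⟩ :=
      NSFSGE.exists_schemeError_bound hab hα₁ hα₂ hT hm M
    have hG : 0 < γ ^ (m + α / 2) := Real.rpow_pos_of_pos hγ _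
    -- The bound in τ becomes a bound in τ₀ because τ < γτ₀; the ratio τ₁/γ makes τ admissible, and
    -- 1/2 keeps the threshold below 1.
    refine ⟨C * (1 + γ ^ (m + α / 2)), by positivity, h₀, hh₀, min (1 / 2) (τ₁ / γ),
      lt_min (by norm_num) (by positivity), (min_le_left _ _).trans_lt (by norm_num), ?_⟩
    intro τ₀ hτ₀ hτ₀s ε hε hε1 u₀ u₁ u v hsol hA N hN0 hN hmesh τ hτ hττ n hn
    have h1 : τ ≤ τ₁ := by
      have h2 := (le_div_iff₀ hγ).1 (hτ₀s.trans (min_le_right _ _))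
      linarith
    refine (H ε hε hε1 u₀ u₁ u v hsol hA N hN0 hN hmesh τ hτ h1 n hn).trans ?_
    have h3 : τ ^ (m + α / 2) ≤ γ ^ (m + α / 2) * τ₀ ^ (m + α / 2) := by
      rw [← Real.mul_rpow hγ.le hτ₀.le]
      exact Real.rpow_le_rpow hτ.le hττ.le (by linarith)
    have : NeZero N := ⟨hN0.ne'⟩
    have hpos := NSFSGE.meshSize_pos (N := N) hab
    have p1 : 0 ≤ NSFSGE.meshSize a b N ^ m := by positivity
    have p2 : 0 ≤ ε ^ 2 * τ ^ 2 := by positivity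
    have p3 : 0 ≤ τ₀ ^ (m + α / 2) := by positivity
    rw [mul_assoc]
    refine mul_le_mul_of_nonneg_left ?_ hC.le
    nlinarith [mul_nonneg hG.le p1, mul_nonneg hG.le p2]
  -- The exponent m + 2 + 2/κ leaves τ² after 2/κ powers of τ ≤ ε^κ have been traded for ε²; it also
  -- exceeds 1, so that m ≥ 0 is enough.
  · obtain ⟨C, hC, h₀, hh₀, hh₁, τ₁, hτ₁, H⟩ :=
      NSFSGE.exists_schemeError_bound (m := m + 2 + 2 / κ) hab hα₁ hα₂ hT
        (by have : 0 < 2 / κ := by positivity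
            linarith) (M (m + 2 + 2 / κ))
    have hκ2 : 0 < 2 / κ := by positivity
    refine ⟨C * 2, by positivity, h₀, hh₀, min 1 τ₁, lt_min one_pos hτ₁, ?_⟩
    intro ε hε hε1 u₀ u₁ u v hsol hA N hN0 hN hmesh τ hτ hττ n hn
    have hεκ : ε ^ κ ≤ 1 := Real.rpow_le_one hε.le hε1 hκ.le
    have hεκ0 : 0 < ε ^ κ := Real.rpow_pos_of_pos hε _
    have h1 : τ ≤ τ₁ := by
      have := min_le_right 1 τ₁
      nlinarith
    have h2 : τ ≤ ε ^ κ := by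
      have := min_le_left 1 τ₁
      nlinarith
    have : NeZero N := ⟨hN0.ne'⟩
    have hpos := NSFSGE.meshSize_pos (N := N) hab
    refine (H ε hε hε1 u₀ u₁ u v hsol (hA _ (by linarith)) N hN0 hN hmesh τ hτ h1 n hn).trans ?_
    have h3 : NSFSGE.meshSize a b N ^ (m + 2 + 2 / κ) ≤ NSFSGE.meshSize a b N ^ m :=
      Real.rpow_le_rpow_of_exponent_ge hpos (hmesh.trans hh₁) (by linarith)
    have h4 : τ ^ (m + 2 + 2 / κ + α / 2) ≤ ε ^ 2 * τ ^ 2 := by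
      have e : m + 2 + 2 / κ + α / 2 = (m + 2 / κ + α / 2) + (2 : ℕ) := by push_cast; ring
      rw [e, Real.rpow_add hτ, Real.rpow_natCast]
      refine mul_le_mul_of_nonneg_right ?_ (by positivity)
      calc τ ^ (m + 2 / κ + α / 2) ≤ (ε ^ κ) ^ (m + 2 / κ + α / 2) :=
            Real.rpow_le_rpow hτ.le h2 (by linarith)
        _ = ε ^ (κ * (m + 2 / κ + α / 2)) := by rw [← Real.rpow_mul hε.le]
        _ ≤ ε ^ ((2 : ℕ) : ℝ) := by
            refine Real.rpow_le_rpow_of_exponent_ge hε hε1 ?_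
            have e2 : κ * (m + 2 / κ + α / 2) = 2 + κ * (m + α / 2) := by field_simp; ring
            have : 0 ≤ κ * (m + α / 2) := by positivity
            rw [e2]; push_cast; linarith
        _ = ε ^ 2 := Real.rpow_natCast _ _
    have p1 : 0 ≤ NSFSGE.meshSize a b N ^ m := by positivity
    rw [mul_assoc]
    refine mul_le_mul_of_nonneg_left ?_ hC.le
    linarith
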